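/- Let $E\to Z$ be a smooth vector bundle with structure group $SU(3)$ over a compact smooth 1-manifold $Z$ (without boundary), that is, a smooth complex vector bundle of rank 3 with a smooth Hermitian metric $h$ and a smooth nowhere vanishing complex volume form $\Omega$ (a section of the complex determinant line bundle $\Lambda^3_{\mathbb C}E^*$); put $\omega=\operatorname{Im}h$. A special Lagrangian plane in a fibre $E_z$ is a real 3-dimensional subspace on which $\omega$ and $\operatorname{Im}\Omega$ vanish, and a special Lagrangian subbundle of $E$ is a smooth real subbundle all of whose fibres are special Lagrangian planes. A pair $(V,V')$ of special Lagrangian subbundles is transverse if $V_z\cap V'_z=0$ for all $z\in Z$. Two transverse pairs $(V,V')$, $(W,W')$ are equivalent, $(V,V')\cong(W,W')$, if there are smooth subbundles $F,F'$ of the pullback of $E$ to $Z\times[0,1]$ with $F|_{Z\times\{0\}}=V$, $F|_{Z\times\{1\}}=W$, $F'|_{Z\times\{0\}}=V'$, $F'|_{Z\times\{1\}}=W'$, such that $(F,F')|_{Z\times\{t\}}$ is a transverse pair of special Lagrangian subbundles of $E$ for every $t\in[0,1]$. Let $(V,V')$ and $(W,W')$ be two transverse pairs of special Lagrangian subbundles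 of $E$. Then: 1. $(V,V')\cong(W,W')$ if and only if for every $z\in Z$ the pairs $(V_z,V'_z)$ and $(W_z,W'_z)$ lie in the same path component of the space of (ordered) transverse pairs of special Lagrangian planes in $E_z$. 2. Up to order, any two transverse pairs are equivalent: there is an open and closed subset $A\subset Z$ such that the pair obtained from $(V,V')$ by interchanging $V$ and $V'$ over $A$ is equivalent to $(W,W')$. -/

import Mathlib

open Bundle Set
open scoped Manifold ContDiff

noncomputable section

namespace SLBundle

section Subbundle

variable {HM EM M : Type*} [NormedAddCommGroup EM] [NormedSpace ℝ EM] [TopologicalSpace HM]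
  (IM : ModelWithCorners ℝ EM HM) [TopologicalSpace M] [ChartedSpace HM M]
  {HZ EZ Z : Type*} [NormedAddCommGroup EZ] [NormedSpace ℝ EZ] [TopologicalSpace HZ]
  (IZ : ModelWithCorners ℝ EZ HZ) [TopologicalSpace Z] [ChartedSpace HZ Z]
  (F : Type*) [NormedAddCommGroup F] [NormedSpace ℝ F]
  {E : Z → Type*} [∀ z, AddCommGroup (E z)] [∀ z, Module ℝ (E z)]
  [TopologicalSpace (TotalSpace F E)] [∀ z, TopologicalSpace (E z)] [FiberBundle F E]

/-- Smoothness on `U` of a section `s` of the pullback bundle `f^* E` along a map `f : M → Z`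
(by the universal property of the pullback, for smooth `f` this is smoothness of the induced map
`M → E`). For `f` the identity these are the sections of `E` that are smooth on `U`. -/
def SmoothSectionOn (f : M → Z) (s : ∀ x, E (f x)) (U : Set M) : Prop :=
  ContMDiffOn IM (IZ.prod 𝓘(ℝ, F)) ∞ (fun x => TotalSpace.mk' F (f x) (s x)) U

/-- `V` is a smooth real vector subbundle of the pullback bundle `f^* E`: near every point there
is a smooth local frame of `f^* E` sections that is a basis of each fibre of `V`. -/
def IsSmoothSubbundle (f : M → Z) (V : ∀ x, Submodule ℝ (E (f x))) : Prop :=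
  ∀ x₀ : M, ∃ U : Set M, IsOpen U ∧ x₀ ∈ U ∧ ∃ (m : ℕ) (s : Fin m → ∀ x, E (f x)),
    (∀ i, SmoothSectionOn IM IZ F f (s i) U) ∧
    ∀ x ∈ U, LinearIndependent ℝ (fun i => s i x) ∧
      Submodule.span ℝ (Set.range fun i => s i x) = V x

end Subbundle

variable {n : ℕ} {Z : Type*} [TopologicalSpace Z] [ChartedSpace (EuclideanSpace ℝ (Fin 1)) Z]
  {E : Z → Type*} [∀ z, AddCommGroup (E z)] [∀ z, Module ℂ (E z)]
  [∀ z, TopologicalSpace (E z)] [TopologicalSpace (TotalSpace (EuclideanSpace ℂ (Fin n)) E)]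
  [FiberBundle (EuclideanSpace ℂ (Fin n)) E]

/-- An `SU(n)`-structure on a smooth vector bundle `E` over a 1-manifold `Z`, with model fibre
`ℂⁿ` and with complex vector spaces as fibres: the complex structure varies smoothly, and there
are a smooth Hermitian metric `h` and a smooth nowhere vanishing complex volume form `vol`.
Smoothness of these tensors is tested on smooth local sections. -/
structure SUStructure (n : ℕ) {Z : Type*} [TopologicalSpace Z]
    [ChartedSpace (EuclideanSpace ℝ (Fin 1)) Z]
    (E : Z → Type*) [∀ z, AddCommGroup (E z)] [∀ z, Module ℂ (E z)]
    [∀ z, TopologicalSpace (E z)] [TopologicalSpace (TotalSpace (EuclideanSpace ℂ (Fin n)) E)]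
    [FiberBundle (EuclideanSpace ℂ (Fin n)) E] where
  smooth_J : ∀ (U : Set Z) (s : ∀ z, E z), IsOpen U →
    SmoothSectionOn (𝓡 1) (𝓡 1) (EuclideanSpace ℂ (Fin n)) (fun z => z) s U →
    SmoothSectionOn (𝓡 1) (𝓡 1) (EuclideanSpace ℂ (Fin n)) (fun z => z)
      (fun z => Complex.I • s z) U
  /-- the Hermitian metric, conjugate-linear in the first argument -/
  h : ∀ z, E z →ₗ⋆[ℂ] E z →ₗ[ℂ] ℂ
  h_conj : ∀ z (u v : E z), star (h z u v) = h z v u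
  h_pos : ∀ z (u : E z), u ≠ 0 → 0 < (h z u u).re
  smooth_h : ∀ (U : Set Z) (s t : ∀ z, E z), IsOpen U →
    SmoothSectionOn (𝓡 1) (𝓡 1) (EuclideanSpace ℂ (Fin n)) (fun z => z) s U →
    SmoothSectionOn (𝓡 1) (𝓡 1) (EuclideanSpace ℂ (Fin n)) (fun z => z) t U →
    ContMDiffOn (𝓡 1) 𝓘(ℝ, ℂ) ∞ (fun z => h z (s z) (t z)) U
  /-- the complex volume form `Ω` -/
  vol : ∀ z, (E z) [⋀^Fin n]→ₗ[ℂ] ℂ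
  vol_ne_zero : ∀ z, vol z ≠ 0
  smooth_vol : ∀ (U : Set Z) (s : Fin n → ∀ z, E z), IsOpen U →
    (∀ i, SmoothSectionOn (𝓡 1) (𝓡 1) (EuclideanSpace ℂ (Fin n)) (fun z => z) (s i) U) →
    ContMDiffOn (𝓡 1) 𝓘(ℝ, ℂ) ∞ (fun z => vol z (fun i => s i z)) U

namespace SUStructure

/-- The 2-form `ω = Im h`. -/
def omega (S : SUStructure n E) (z : Z) (u v : E z) : ℝ := (S.h z u v).im

/-- `L` is a special Lagrangian `n`-plane in the fibre over `z`: a real subspace of dimension `n`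
on which `ω` and `Im Ω` vanish. -/
def IsSLPlane (S : SUStructure n E) (z : Z) (L : Submodule ℝ (E z)) : Prop :=
  Module.finrank ℝ L = n ∧ (∀ u ∈ L, ∀ v ∈ L, S.omega z u v = 0) ∧
    ∀ v : Fin n → E z, (∀ i, v i ∈ L) → (S.vol z v).im = 0

/-- `(L, L')` is a transverse pair of special Lagrangian planes in the fibre over `z`. -/
def IsTransversePlanes (S : SUStructure n E) (z : Z) (L L' : Submodule ℝ (E z)) : Prop :=
  S.IsSLPlane z L ∧ S.IsSLPlane z L' ∧ L ⊓ L' = ⊥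

/-- `(V, V')` is a transverse pair of (smooth) special Lagrangian subbundles of `E`. -/
def IsTransversePair (S : SUStructure n E) (V V' : ∀ z, Submodule ℝ (E z)) : Prop :=
  IsSmoothSubbundle (𝓡 1) (𝓡 1) (EuclideanSpace ℂ (Fin n)) (fun z : Z => z) V ∧
  IsSmoothSubbundle (𝓡 1) (𝓡 1) (EuclideanSpace ℂ (Fin n)) (fun z : Z => z) V' ∧
  ∀ z, S.IsTransversePlanes z (V z) (V' z)

/-- `(V, V') ≅ (W, W')`: there are homotopies `G` from `V` to `W` and `G'` from `V'` to `W'`,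
i.e. smooth subbundles of the pullback of `E` to `Z × [0,1]` with the given ends, whose
restrictions to each `Z × {t}` form a transverse pair of special Lagrangian subbundles. -/
def Equivalent (S : SUStructure n E) (V V' W W' : ∀ z, Submodule ℝ (E z)) : Prop :=
  ∃ G G' : ∀ p : Z × unitInterval, Submodule ℝ (E p.1),
    IsSmoothSubbundle ((𝓡 1).prod (𝓡∂ 1)) (𝓡 1) (EuclideanSpace ℂ (Fin n)) Prod.fst G ∧
    IsSmoothSubbundle ((𝓡 1).prod (𝓡∂ 1)) (𝓡 1) (EuclideanSpace ℂ (Fin n)) Prod.fst G' ∧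
    (∀ z, G (z, 0) = V z) ∧ (∀ z, G (z, 1) = W z) ∧
    (∀ z, G' (z, 0) = V' z) ∧ (∀ z, G' (z, 1) = W' z) ∧
    ∀ t : unitInterval, S.IsTransversePair (fun z => G (z, t)) (fun z => G' (z, t))

/-- `(L, L')` and `(K, K')` lie in the same (path) component of the space of transverse pairs of
special Lagrangian planes in the fibre over `z`: they are joined by a path of such pairs. The
path of pairs is given by continuously varying bases of the planes (every continuous path of
planes has such bases). -/
def SameComponent (S : SUStructure n E) (z : Z) (L L' K K' : Submodule ℝ (E z)) : Prop :=
  ∃ a a' : unitInterval → Fin n → E z, Continuous a ∧ Continuous a' ∧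
    (∀ t, S.IsTransversePlanes z (Submodule.span ℝ (Set.range (a t)))
      (Submodule.span ℝ (Set.range (a' t)))) ∧
    Submodule.span ℝ (Set.range (a 0)) = L ∧ Submodule.span ℝ (Set.range (a' 0)) = L' ∧
    Submodule.span ℝ (Set.range (a 1)) = K ∧ Submodule.span ℝ (Set.range (a' 1)) = K'

end SUStructure

open Classical in
/-- The family equal to `V'` over `A` and to `V` elsewhere. -/
def replaceOn (A : Set Z) (V V' : ∀ z, Submodule ℝ (E z)) (z : Z) : Submodule ℝ (E z) :=
  if z ∈ A then V' z else V z

end SLBundle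

end

noncomputable section

set_option linter.unusedSectionVars false
set_option linter.style.haveILetI false

namespace SLBundle

open Module Filter Topology ComplexConjugate

/-! Two facts carry the theorem: each fibre has exactly two components of transverse pairs, told
apart by a sign, and there is no further obstruction over a 1-dimensional base.

The sign. For bases `e`, `f` of the two planes, `pairing` is Re Ω(e) · Re Ω(f) · det ω(e_j, f_k). It
never vanishes, since a special Lagrangian plane is its own ω-orthogonal complement. A change of
bases multiplies it by a positive square (`pairing_pos_iff`), and interchanging the planes changes
its sign, because the matrix has odd size (`pairing_swap`). It is locally constant in continuous
families, so both equivalence and lying in one component preserve it (`Equivalent.posPair_iff`,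
`SameComponent.posPair_iff`).

The converse is `exists_frames`: pairs with equal signs everywhere are joined globally. General
position first gives each subbundle a global unitary frame (`exists_unitaryFrame`): over a
1-manifold, constants avoid a family of conditions of codimension 2, and Re Ω orients the remaining
line bundle. Next V is moved to W (`exists_frame_path`); topologically this reflects the simple
connectivity of SU(3)/SO(3). Two vectors that are ω-orthogonal and independent over ℂ determine,
together with the conjugate of their cross product, a unitary frame of determinant 1 after
orthonormalization, so it suffices to move such pairs, and generic constants p, q make an explicit
path of six segments work.

Finally, relative to a unitary frame e of V with Ω(e) real, V' is spanned by the columns of A + i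
with A real symmetric and Im det(A + i) = e₂(A) − 1 = 0. The form e₂ is Lorentzian on symmetric
matrices, so this is a two-sheeted hyperboloid, and the sign of det A − tr A selects the sheet. On
one sheet the segment from A to B stays inside the cone e₂ > 0 (`e₂_segment_pos`), and rescaling by
the square root of e₂ brings it back to the hyperboloid. Carrying these graphs along the moving
frame gives the homotopy. For the second claim, the pair is interchanged over the clopen set where
the signs disagree. -/

/-! ### Hausdorff dimension of unions of kernels -/

/-- The parameters killed by some member of a `C¹` family of linear maps onto `ℂ` form, locally in
the family, a set of codimension at least `2` minus the dimension of the family. -/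
theorem exists_nhds_dimH_ker_le {D T : Type*} [NormedAddCommGroup D] [NormedSpace ℝ D]
    [FiniteDimensional ℝ D] [NormedAddCommGroup T] [NormedSpace ℝ T] [FiniteDimensional ℝ T]
    {Φ : D → T →L[ℝ] ℂ} {y₀ : D} (hΦ : ContDiffAt ℝ 1 Φ y₀)
    (hs : Function.Surjective (Φ y₀)) :
    ∃ V ∈ 𝓝 y₀, dimH {c : T | ∃ y ∈ V, Φ y c = 0} ≤
      ((finrank ℝ D + (finrank ℝ T - 2) : ℕ) : ENNReal) := by
  have hsurj : (Φ y₀ : T →ₗ[ℝ] ℂ).range = ⊤ := LinearMap.range_eq_top.2 hs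
  obtain ⟨R, hR⟩ := (Φ y₀ : T →ₗ[ℝ] ℂ).exists_rightInverse_of_surjective hsurj
  let R' : ℂ →L[ℝ] T := LinearMap.toContinuousLinearMap R
  have hR' : (Φ y₀).comp R' = ContinuousLinearMap.id ℝ ℂ := by
    ext1 <;> exact LinearMap.congr_fun hR _
  let K : Submodule ℝ T := (Φ y₀ : T →ₗ[ℝ] ℂ).ker
  let P : D → ℂ →L[ℝ] ℂ := fun y => (Φ y).comp R'
  have hP : ContDiffAt ℝ 1 P y₀ := hΦ.clm_comp contDiffAt_const
  have hP0 : P y₀ = 1 := hR'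
  have hunit : ∀ᶠ y in 𝓝 y₀, IsUnit (P y) := by
    have : {x : ℂ →L[ℝ] ℂ | IsUnit x} ∈ 𝓝 (P y₀) :=
      Units.isOpen.mem_nhds (by rw [hP0]; exact isUnit_one)
    exact hP.continuousAt this
  let Q : D → ℂ →L[ℝ] ℂ := fun y => Ring.inverse (P y)
  have hQ : ContDiffAt ℝ 1 Q y₀ := by
    have h1 : ContDiffAt ℝ 1 (Ring.inverse : (ℂ →L[ℝ] ℂ) → _) (P y₀) := by
      rw [hP0]; exact contDiffAt_ringInverse ℝ (1 : (ℂ →L[ℝ] ℂ)ˣ)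
    exact h1.comp y₀ hP
  have e1 : ∀ᶠ y in 𝓝 y₀, ContDiffAt ℝ 1 Q y := hQ.eventually (by simp)
  have e2 : ∀ᶠ y in 𝓝 y₀, ContDiffAt ℝ 1 Φ y := hΦ.eventually (by simp)
  obtain ⟨r, hr, hball⟩ := Metric.eventually_nhds_iff_ball.1 ((e1.and e2).and hunit)
  refine ⟨Metric.ball y₀ r, Metric.ball_mem_nhds _ hr, ?_⟩
  -- As `P y = Φ y ∘ R'` is invertible with inverse `Q y`, subtracting `R' (Q y (Φ y k))` corrects
  -- `k ∈ ker (Φ y₀)` to an element of `ker (Φ y)`, and all of that kernel arises so. The union of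
  -- the nearby kernels is thus covered by a `C¹` image of a ball times `K`.
  let Ψ : D × K → T := fun x => x.2 - R' (Q x.1 (Φ x.1 x.2))
  have hΨ : ContDiffOn ℝ 1 Ψ (Metric.ball y₀ r ×ˢ univ) := by
    rintro ⟨y, k⟩ ⟨hy, -⟩
    obtain ⟨⟨h1, h2⟩, -⟩ := hball y hy
    have hk : ContDiffAt ℝ 1 (fun x : D × K => (x.2 : T)) (y, k) :=
      (K.subtypeL.contDiff.comp contDiff_snd).contDiffAt
    have h1' : ContDiffAt ℝ 1 (fun x : D × K => Q x.1) (y, k) := h1.comp (y, k) contDiffAt_fst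
    have h2' : ContDiffAt ℝ 1 (fun x : D × K => Φ x.1) (y, k) := h2.comp (y, k) contDiffAt_fst
    exact (hk.sub (contDiffAt_const.clm_apply (h1'.clm_apply (h2'.clm_apply hk)))).contDiffWithinAt
  have hsub : {c : T | ∃ y ∈ Metric.ball y₀ r, Φ y c = 0} ⊆ Ψ '' (Metric.ball y₀ r ×ˢ univ) := by
    rintro c ⟨y, hy, hc⟩
    have hk : c - R' (Φ y₀ c) ∈ K := by
      have : Φ y₀ (R' (Φ y₀ c)) = Φ y₀ c := DFunLike.congr_fun hR' (Φ y₀ c)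
      change Φ y₀ (c - R' (Φ y₀ c)) = 0
      rw [map_sub, this, sub_self]
    refine ⟨(y, ⟨_, hk⟩), ⟨hy, mem_univ _⟩, ?_⟩
    have hu := (hball y hy).2
    have h3 : Q y (P y (Φ y₀ c)) = Φ y₀ c := by
      have := Ring.inverse_mul_cancel (P y) hu
      exact DFunLike.congr_fun this (Φ y₀ c)
    change c - R' (Φ y₀ c) - R' (Q y (Φ y (c - R' (Φ y₀ c)))) = c
    rw [map_sub, hc, zero_sub, map_neg]
    change c - R' (Φ y₀ c) - R' (-(Q y (P y (Φ y₀ c)))) = c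
    rw [h3, map_neg]; abel
  have hconv : Convex ℝ (Metric.ball y₀ r ×ˢ (univ : Set K)) :=
    (convex_ball y₀ r).prod convex_univ
  refine (dimH_mono hsub).trans ((hΨ.dimH_image_le hconv Subset.rfl).trans ?_)
  refine (dimH_mono (subset_univ _)).trans ?_
  rw [Real.dimH_univ_eq_finrank, finrank_prod]
  have : finrank ℝ K + 2 = finrank ℝ T := by
    have := (Φ y₀ : T →ₗ[ℝ] ℂ).finrank_range_add_finrank_ker
    rw [hsurj, finrank_top, Complex.finrank_real_complex] at this
    change finrank ℝ (LinearMap.ker (Φ y₀ : T →ₗ[ℝ] ℂ)) + 2 = _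
    omega
  exact_mod_cast (by omega : finrank ℝ D + finrank ℝ K ≤ finrank ℝ D + (finrank ℝ T - 2))

/-! ### General position over a compact 1-manifold -/

section

variable {Z : Type*} [TopologicalSpace Z] [CompactSpace Z]
  [ChartedSpace (EuclideanSpace ℝ (Fin 1)) Z] [IsManifold (𝓡 1) ∞ Z]

/-- General position over a compact `1`-manifold: a family of subsets of `T`, locally contained in
the kernels of a smooth family of linear maps onto `ℂ`, has a union of positive codimension. -/
theorem dimH_iUnion_lt {T : Type*} [NormedAddCommGroup T] [NormedSpace ℝ T]
    [FiniteDimensional ℝ T] (Bad : Z → Set T)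
    (h : ∀ z₀, ∃ U : Set Z, IsOpen U ∧ z₀ ∈ U ∧ ∃ Φ : Z → T →L[ℝ] ℂ,
      ContMDiffOn (𝓡 1) 𝓘(ℝ, T →L[ℝ] ℂ) ∞ Φ U ∧ Function.Surjective (Φ z₀) ∧
      ∀ z ∈ U, ∀ c ∈ Bad z, Φ z c = 0) :
    dimH (⋃ z, Bad z) ≤ ((finrank ℝ T - 1 : ℕ) : ENNReal) := by
  have key : ∀ z₀, ∃ U ∈ 𝓝 z₀, dimH (⋃ z ∈ U, Bad z) ≤ ((finrank ℝ T - 1 : ℕ) : ENNReal) := by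
    intro z₀
    obtain ⟨U, hU, hz, Φ, hΦ, hs, hb⟩ := h z₀
    let φ := extChartAt (𝓡 1) z₀
    let Φ' : EuclideanSpace ℝ (Fin 1) → T →L[ℝ] ℂ := Φ ∘ φ.symm
    have hΦ' : ContDiffAt ℝ 1 Φ' (φ z₀) := by
      have h1 : ContMDiffAt (𝓡 1) 𝓘(ℝ, T →L[ℝ] ℂ) ∞ Φ (φ.symm (φ z₀)) := by
        rw [extChartAt_to_inv]
        exact (hΦ z₀ hz).contMDiffAt (hU.mem_nhds hz)
      have h2 : ContMDiffAt 𝓘(ℝ, EuclideanSpace ℝ (Fin 1)) (𝓡 1) ∞ φ.symm (φ z₀) :=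
        (contMDiffOn_extChartAt_symm z₀).contMDiffAt (extChartAt_target_mem_nhds z₀)
      exact ((h1.comp (φ z₀) h2).contDiffAt).of_le (by simp)
    have hs' : Function.Surjective (Φ' (φ z₀)) := by
      simpa only [Φ', Function.comp, φ, extChartAt_to_inv] using hs
    obtain ⟨V, hV, hd⟩ := exists_nhds_dimH_ker_le hΦ' hs'
    -- Needed because of truncated subtraction: 1 + (n − 2) equals n − 1 only for n ≥ 2.
    have hn : 2 ≤ finrank ℝ T := by
      have := LinearMap.finrank_le_finrank_of_surjective
        (f := (Φ z₀ : T →ₗ[ℝ] ℂ)) hs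
      rwa [Complex.finrank_real_complex] at this
    refine ⟨U ∩ (φ.source ∩ φ ⁻¹' V), inter_mem (hU.mem_nhds hz)
      (inter_mem (extChartAt_source_mem_nhds z₀) ((continuousAt_extChartAt z₀) hV)), ?_⟩
    refine (dimH_mono ?_).trans (hd.trans (le_of_eq ?_))
    · intro c hc
      simp only [mem_iUnion] at hc
      obtain ⟨z, ⟨hzU, hzs, hzV⟩, hc⟩ := hc
      refine ⟨φ z, hzV, ?_⟩
      simp only [Φ', Function.comp, φ.left_inv hzs]
      exact hb z hzU c hc
    · rw [finrank_euclideanSpace_fin]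
      congr 1; omega
  choose U hU hd using key
  obtain ⟨t, -, ht⟩ := isCompact_univ.elim_nhds_subcover U fun z _ => hU z
  have hsub : (⋃ z, Bad z) ⊆ ⋃ i ∈ t, ⋃ z ∈ U i, Bad z := by
    intro c hc
    obtain ⟨z, hc⟩ := mem_iUnion.1 hc
    obtain ⟨i, hi, hz⟩ := mem_iUnion₂.1 (ht (mem_univ z))
    exact mem_iUnion₂.2 ⟨i, hi, mem_iUnion₂.2 ⟨z, hz, hc⟩⟩
  refine (dimH_mono hsub).trans ?_
  have := dimH_bUnion t.countable_toSet fun i => ⋃ z ∈ U i, Bad z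
  simp only [Finset.mem_coe] at this
  rw [this]
  exact iSup₂_le fun i _ => hd i

/-- A set of Hausdorff dimension below that of the space has dense complement. Two families are
handled at once because the constants must be generic with respect to both ends of the homotopy. -/
theorem exists_forall_notMem_of_dimH_le {T : Type*} [NormedAddCommGroup T] [NormedSpace ℝ T]
    [FiniteDimensional ℝ T] (hT : 0 < finrank ℝ T) {B C : Z → Set T}
    (hB : dimH (⋃ z, B z) ≤ ((finrank ℝ T - 1 : ℕ) : ENNReal))
    (hC : dimH (⋃ z, C z) ≤ ((finrank ℝ T - 1 : ℕ) : ENNReal)) :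
    ∃ c : T, ∀ z, c ∉ B z ∧ c ∉ C z := by
  have hd : dimH ((⋃ z, B z) ∪ ⋃ z, C z) < (finrank ℝ T : ENNReal) := by
    rw [dimH_union]
    refine (max_le hB hC).trans_lt ?_
    exact_mod_cast Nat.sub_lt hT one_pos
  obtain ⟨c, hc⟩ := (dense_compl_of_dimH_lt_finrank hd).nonempty
  refine ⟨c, fun z => ⟨fun h => hc (Or.inl (mem_iUnion.2 ⟨z, h⟩)),
    fun h => hc (Or.inr (mem_iUnion.2 ⟨z, h⟩))⟩⟩

end

/-! ### Linear algebra of special Lagrangian planes in one fibre -/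

section Fibre

variable {Z : Type*} [TopologicalSpace Z] [ChartedSpace (EuclideanSpace ℝ (Fin 1)) Z]
  {E : Z → Type*} [∀ z, AddCommGroup (E z)] [∀ z, Module ℂ (E z)]
  [∀ z, TopologicalSpace (E z)] [TopologicalSpace (TotalSpace (EuclideanSpace ℂ (Fin 3)) E)]
  [FiberBundle (EuclideanSpace ℂ (Fin 3)) E]

namespace SUStructure

variable (S : SUStructure 3 E) {z : Z}

theorem h_smul_left (r : ℝ) (u v : E z) : S.h z (r • u) v = (r : ℂ) * S.h z u v := by
  rw [← Complex.coe_smul, LinearMap.map_smulₛₗ₂]; simp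

theorem h_smul_right (r : ℝ) (u v : E z) : S.h z u (r • v) = (r : ℂ) * S.h z u v := by
  rw [← Complex.coe_smul, map_smul]; simp

theorem h_csmul_left (c : ℂ) (u v : E z) : S.h z (c • u) v = star c * S.h z u v := by
  rw [LinearMap.map_smulₛₗ₂]; simp

theorem h_csmul_right (c : ℂ) (u v : E z) : S.h z u (c • v) = c * S.h z u v := by
  rw [map_smul]; simp

theorem h_add_left (u v w : E z) : S.h z (u + v) w = S.h z u w + S.h z v w := by
  rw [map_add, LinearMap.add_apply]

theorem h_sum_left {ι : Type*} (t : Finset ι) (f : ι → E z) (v : E z) :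
    S.h z (∑ i ∈ t, f i) v = ∑ i ∈ t, S.h z (f i) v := by
  rw [map_sum, LinearMap.sum_apply]

theorem h_self_im (u : E z) : (S.h z u u).im = 0 := by
  have := congrArg Complex.im (S.h_conj z u u)
  simp at this; linarith

theorem h_self_eq (u : E z) : S.h z u u = ((S.h z u u).re : ℂ) := by
  apply Complex.ext <;> simp [S.h_self_im u]

theorem h_im_symm (u v : E z) : (S.h z u v).im = -(S.h z v u).im := by
  rw [← S.h_conj z v u]; simp

theorem eq_zero_of_h_self {u : E z} (hu : (S.h z u u).re = 0) : u = 0 := by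
  by_contra h
  exact (S.h_pos z u h).ne' hu

theorem h_eq_zero_symm {u v : E z} (hu : S.h z u v = 0) : S.h z v u = 0 := by
  rw [← S.h_conj, hu, star_zero]

/-- A real-independent `ω`-isotropic family is independent over `ℂ`. -/
theorem linearIndependent_complex {ι : Type*} [Fintype ι] {u : ι → E z}
    (hu : LinearIndependent ℝ u)
    (hω : ∀ i j, (S.h z (u i) (u j)).im = 0) : LinearIndependent ℂ u := by
  rw [Fintype.linearIndependent_iff] at hu ⊢
  intro g hg
  set x := ∑ j, (g j).re • u j with hx
  set y := ∑ j, (g j).im • u j with hy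
  have hxy : x + Complex.I • y = 0 := by
    rw [← hg, hx, hy, Finset.smul_sum, ← Finset.sum_add_distrib]
    refine Finset.sum_congr rfl fun j _ => ?_
    rw [← Complex.coe_smul, ← Complex.coe_smul, smul_smul, ← add_smul]
    congr 1
    rw [mul_comm]; exact Complex.re_add_im _
  have him : (S.h z x y).im = 0 := by
    rw [hx, hy, S.h_sum_left, Complex.im_sum]
    refine Finset.sum_eq_zero fun i _ => ?_
    rw [map_sum, Complex.im_sum]
    refine Finset.sum_eq_zero fun j _ => ?_
    rw [S.h_smul_left, S.h_smul_right]
    simp [hω i j]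
  have hx' : x = -(Complex.I • y) := eq_neg_of_add_eq_zero_left hxy
  have hx0 : x = 0 := by
    apply S.eq_zero_of_h_self
    -- Since x = −iy and h(x, y) is real by isotropy, the right side is purely imaginary while h(x,
    -- x) is real.
    have : S.h z x x = -(Complex.I * S.h z x y) := by
      conv_lhs => rw [show S.h z x x = S.h z x (-(Complex.I • y)) from congrArg _ hx']
      rw [map_neg, S.h_csmul_right]
    rw [this]; simp [him]
  have hy0 : y = 0 := by
    rw [hx0, zero_add] at hxy
    exact (smul_eq_zero.1 hxy).resolve_left Complex.I_ne_zero
  intro i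
  exact Complex.ext (hu _ hx0 i) (hu _ hy0 i)

end SUStructure

variable [VectorBundle ℝ (EuclideanSpace ℂ (Fin 3)) E]

/-- The fibre of a vector bundle is linearly homeomorphic to the model fibre. -/
def fibreEquiv (z : Z) : E z ≃L[ℝ] EuclideanSpace ℂ (Fin 3) :=
  (trivializationAt (EuclideanSpace ℂ (Fin 3)) E z).continuousLinearEquivAt ℝ z
    (FiberBundle.mem_baseSet_trivializationAt' z)

theorem finiteDimensional_real_fibre (z : Z) : FiniteDimensional ℝ (E z) :=
  haveI : FiniteDimensional ℝ (EuclideanSpace ℂ (Fin 3)) := FiniteDimensional.complexToReal _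
  (fibreEquiv (E := E) z).symm.toLinearEquiv.finiteDimensional

theorem finiteDimensional_fibre (z : Z) : FiniteDimensional ℂ (E z) :=
  haveI := finiteDimensional_real_fibre (E := E) z
  FiniteDimensional.right ℝ ℂ (E z)

theorem finrank_fibre (z : Z) : finrank ℂ (E z) = 3 := by
  have h1 := (fibreEquiv (E := E) z).toLinearEquiv.finrank_eq
  rw [finrank_real_of_complex, finrank_real_of_complex, finrank_euclideanSpace_fin] at h1
  omega

namespace SUStructure

variable (S : SUStructure 3 E) {z : Z}

/-- A complex-independent triple in a fibre is a basis. -/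
def fibreBasis {u : Fin 3 → E z} (hu : LinearIndependent ℂ u) : Basis (Fin 3) ℂ (E z) :=
  haveI := finiteDimensional_fibre (E := E) z
  basisOfLinearIndependentOfCardEqFinrank hu (by rw [finrank_fibre]; rfl)

theorem coe_fibreBasis {u : Fin 3 → E z} (hu : LinearIndependent ℂ u) :
    ⇑(fibreBasis hu) = u := by
  simp [fibreBasis]

theorem vol_ne_zero_of_linearIndependent {u : Fin 3 → E z} (hu : LinearIndependent ℂ u) :
    S.vol z u ≠ 0 := by
  have := (AlternatingMap.map_basis_ne_zero_iff (fibreBasis hu) (S.vol z)).2 (S.vol_ne_zero z)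
  rwa [coe_fibreBasis] at this

/-- A form of top degree is its value on a basis times the determinant in that basis. -/
theorem vol_sum {u : Fin 3 → E z} (hu : LinearIndependent ℂ u) (m : Fin 3 → Fin 3 → ℂ) :
    S.vol z (fun k => ∑ j, m j k • u j) = S.vol z u * (Matrix.of m).det := by
  have h1 := AlternatingMap.eq_smul_basis_det (fibreBasis hu) (S.vol z)
  have h2 := congrArg (fun f => f fun k => ∑ j, m j k • u j) h1
  simp only [AlternatingMap.smul_apply, coe_fibreBasis, smul_eq_mul] at h2
  rw [h2]
  congr 1
  rw [Basis.det_apply]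
  congr 1
  ext i k
  rw [Basis.toMatrix_apply]
  have : (∑ j, m j k • u j) = ∑ j, m j k • fibreBasis hu j := by rw [coe_fibreBasis]
  rw [this, Basis.repr_sum_self]; rfl

/-- Every vector is `x + i y` with `x, y` real combinations of a given complex basis. -/
theorem exists_re_add_im {u : Fin 3 → E z} (hu : LinearIndependent ℂ u) (v : E z) :
    ∃ a b : Fin 3 → ℝ, v = ∑ j, a j • u j + Complex.I • ∑ j, b j • u j := by
  refine ⟨fun j => ((fibreBasis hu).repr v j).re, fun j => ((fibreBasis hu).repr v j).im, ?_⟩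
  conv_lhs => rw [← (fibreBasis hu).sum_repr v, coe_fibreBasis]
  rw [Finset.smul_sum, ← Finset.sum_add_distrib]
  refine Finset.sum_congr rfl fun j _ => ?_
  rw [← Complex.coe_smul, ← Complex.coe_smul, smul_smul, ← add_smul]
  congr 1
  rw [mul_comm]; exact (Complex.re_add_im _).symm

variable {S}

/-- A real basis of a special Lagrangian plane. -/
structure IsPlaneBasis (S : SUStructure 3 E) {z : Z} (L : Submodule ℝ (E z)) (u : Fin 3 → E z) :
    Prop where
  li : LinearIndependent ℝ u
  span_eq : Submodule.span ℝ (range u) = L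

theorem IsSLPlane.finite {L : Submodule ℝ (E z)} (_hL : S.IsSLPlane z L) :
    FiniteDimensional ℝ L :=
  haveI := finiteDimensional_real_fibre (E := E) z
  inferInstance

theorem IsPlaneBasis.mem {L : Submodule ℝ (E z)} {u : Fin 3 → E z} (hu : S.IsPlaneBasis L u)
    (i : Fin 3) : u i ∈ L := by
  rw [← hu.span_eq]; exact Submodule.subset_span (mem_range_self i)

theorem IsSLPlane.isPlaneBasis_of_li {L : Submodule ℝ (E z)} (hL : S.IsSLPlane z L)
    {u : Fin 3 → E z} (hu : LinearIndependent ℝ u) (hm : ∀ i, u i ∈ L) : S.IsPlaneBasis L u := by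
  haveI := hL.finite
  refine ⟨hu, Submodule.eq_of_le_of_finrank_eq (Submodule.span_le.2 ?_) ?_⟩
  · rintro _ ⟨i, rfl⟩; exact hm i
  · rw [finrank_span_eq_card hu, hL.1]; rfl

theorem IsSLPlane.isPlaneBasis_of_span {L : Submodule ℝ (E z)} (hL : S.IsSLPlane z L)
    {u : Fin 3 → E z} (hu : Submodule.span ℝ (range u) = L) : S.IsPlaneBasis L u := by
  refine ⟨?_, hu⟩
  rw [linearIndependent_iff_card_eq_finrank_span, Set.finrank, hu, hL.1]; rfl

theorem IsSLPlane.exists_basis {L : Submodule ℝ (E z)} (hL : S.IsSLPlane z L) :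
    ∃ u, S.IsPlaneBasis L u := by
  haveI := hL.finite
  let b := (finBasisOfFinrankEq ℝ L hL.1)
  refine ⟨fun i => b i, hL.isPlaneBasis_of_li ?_ fun i => (b i).2⟩
  exact b.linearIndependent.map' L.subtype (Submodule.ker_subtype L)

theorem IsPlaneBasis.liC {L : Submodule ℝ (E z)} {u : Fin 3 → E z} (hu : S.IsPlaneBasis L u)
    (hL : S.IsSLPlane z L) : LinearIndependent ℂ u :=
  S.linearIndependent_complex hu.li fun i j => hL.2.1 _ (hu.mem i) _ (hu.mem j)

/-- A real basis of a Lagrangian plane is a complex basis of the fibre, so Ω does not vanish on it,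
and its imaginary part does. Thus Re Ω orients every special Lagrangian plane. -/
theorem IsPlaneBasis.vol_re_ne_zero {L : Submodule ℝ (E z)} {u : Fin 3 → E z}
    (hu : S.IsPlaneBasis L u) (hL : S.IsSLPlane z L) : (S.vol z u).re ≠ 0 := by
  intro h
  exact S.vol_ne_zero_of_linearIndependent (hu.liC hL)
    (Complex.ext h (hL.2.2 u hu.mem))

theorem sum_smul_mem {L : Submodule ℝ (E z)} {ι : Type*} [Fintype ι] {u : ι → E z}
    (hm : ∀ i, u i ∈ L) (a : ι → ℝ) : ∑ j, a j • u j ∈ L :=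
  L.sum_mem fun j _ => L.smul_mem _ (hm j)

/-- A special Lagrangian plane is its own `ω`-orthogonal complement. -/
theorem IsSLPlane.mem_of_omega {L : Submodule ℝ (E z)} (hL : S.IsSLPlane z L) {v : E z}
    (hv : ∀ x ∈ L, S.omega z x v = 0) : v ∈ L := by
  obtain ⟨u, hu⟩ := hL.exists_basis
  obtain ⟨a, b, rfl⟩ := exists_re_add_im (hu.liC hL) v
  set x := ∑ j, a j • u j
  set y := ∑ j, b j • u j
  have hx : x ∈ L := sum_smul_mem hu.mem a
  have hy : y ∈ L := sum_smul_mem hu.mem b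
  -- Testing v = x + iy against y itself: ω(y, x) = 0, so ω(y, v) = h(y, y).
  have h1 := hv y hy
  have h2 := hL.2.1 y hy x hx
  rw [omega] at h1 h2
  rw [map_add, S.h_csmul_right, Complex.add_im, h2, Complex.mul_im] at h1
  have : y = 0 := S.eq_zero_of_h_self (by simpa using h1)
  rw [this]; simpa using hx

/-- Sufficient condition for the real span of a triple to be a special Lagrangian plane. -/
theorem isSLPlane_span {u : Fin 3 → E z} (hu : LinearIndependent ℝ u)
    (hω : ∀ i j, (S.h z (u i) (u j)).im = 0) (hv : (S.vol z u).im = 0) :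
    S.IsSLPlane z (Submodule.span ℝ (range u)) := by
  refine ⟨by rw [finrank_span_eq_card hu]; rfl, ?_, ?_⟩
  · intro x hx y hy
    obtain ⟨a, rfl⟩ := (Submodule.mem_span_range_iff_exists_fun ℝ).1 hx
    obtain ⟨b, rfl⟩ := (Submodule.mem_span_range_iff_exists_fun ℝ).1 hy
    rw [omega, S.h_sum_left, Complex.im_sum]
    refine Finset.sum_eq_zero fun i _ => ?_
    rw [map_sum, Complex.im_sum]
    refine Finset.sum_eq_zero fun j _ => ?_
    rw [S.h_smul_left, S.h_smul_right]
    simp [hω i j]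
  · intro v hm
    choose a ha using fun i => (Submodule.mem_span_range_iff_exists_fun ℝ).1 (hm i)
    have : v = fun k => ∑ j, ((a k j : ℝ) : ℂ) • u j := by
      ext k; rw [← ha k]
      exact Finset.sum_congr rfl fun j _ => (Complex.coe_smul _ _).symm
    rw [this, S.vol_sum (S.linearIndependent_complex hu hω) fun j k => ((a k j : ℝ) : ℂ)]
    have hd : (Matrix.of fun j k => ((a k j : ℝ) : ℂ)).det
        = (((Matrix.of fun j k => a k j).det : ℝ) : ℂ) := by
      have := (Complex.ofRealHom.map_det (Matrix.of fun j k => a k j))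
      simp only [Complex.ofRealHom_eq_coe] at this
      rw [this]; rfl
    rw [hd]; simp [hv]

end SUStructure

end Fibre

/-! ### Smooth sections and finite spanning families -/

section Sections

variable {Z : Type*} [TopologicalSpace Z] [ChartedSpace (EuclideanSpace ℝ (Fin 1)) Z]
  {E : Z → Type*} [∀ z, AddCommGroup (E z)] [∀ z, Module ℂ (E z)]
  [∀ z, TopologicalSpace (E z)] [TopologicalSpace (TotalSpace (EuclideanSpace ℂ (Fin 3)) E)]
  [FiberBundle (EuclideanSpace ℂ (Fin 3)) E]

/-- Smoothness of a section of `E` on a subset of the base. -/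
abbrev IsSmoothSection (s : ∀ z, E z) (U : Set Z) : Prop :=
  SmoothSectionOn (𝓡 1) (𝓡 1) (EuclideanSpace ℂ (Fin 3)) (fun z => z) s U

theorem IsSmoothSection.mono {s : ∀ z, E z} {U V : Set Z} (h : IsSmoothSection s U) (hVU : V ⊆ U) :
    IsSmoothSection s V :=
  ContMDiffOn.mono h hVU

variable [VectorBundle ℝ (EuclideanSpace ℂ (Fin 3)) E]

section Pullback

variable {HM EM M : Type*} [NormedAddCommGroup EM] [NormedSpace ℝ EM] [TopologicalSpace HM]
  {IM : ModelWithCorners ℝ EM HM} [TopologicalSpace M] [ChartedSpace HM M]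

variable [IsManifold (𝓡 1) ∞ Z] [ContMDiffVectorBundle ∞ (EuclideanSpace ℂ (Fin 3)) E (𝓡 1)]

/-- A trivialization is linear on fibres, which reduces the claim to sums of products of smooth
functions with values in the model fibre. -/
theorem smoothSectionOn_sum_smul {ι : Type*} [Fintype ι] {f : M → Z} {U : Set M}
    (hf : ContMDiffOn IM (𝓡 1) ∞ f U) {O : Set Z} (hO : IsOpen O) (hUO : MapsTo f U O)
    {e : ι → ∀ z, E z}
    (he : ∀ i, IsSmoothSection (e i) O) {r : ι → M → ℝ}
    (hr : ∀ i, ContMDiffOn IM 𝓘(ℝ, ℝ) ∞ (r i) U) :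
    SmoothSectionOn IM (𝓡 1) (EuclideanSpace ℂ (Fin 3)) f
      (fun x => ∑ i, r i x • e i (f x)) U := by
  intro x hx
  rw [contMDiffWithinAt_totalSpace]
  refine ⟨hf x hx, ?_⟩
  let t := trivializationAt (EuclideanSpace ℂ (Fin 3)) E (f x)
  have hb : f x ∈ t.baseSet := FiberBundle.mem_baseSet_trivializationAt' (f x)
  have hev : ∀ᶠ y in 𝓝[U] x, f y ∈ t.baseSet :=
    (hf x hx).continuousWithinAt (t.open_baseSet.mem_nhds hb)
  have hlin : ∀ y, f y ∈ t.baseSet →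
      (t (TotalSpace.mk' (EuclideanSpace ℂ (Fin 3)) (f y) (∑ i, r i y • e i (f y)))).2 =
        ∑ i, r i y • (t (TotalSpace.mk' (EuclideanSpace ℂ (Fin 3)) (f y) (e i (f y)))).2 := by
    intro y hy
    have h1 := map_sum (t.linearMapAt ℝ (f y)) (fun i => r i y • e i (f y)) Finset.univ
    simp only [map_smul, t.coe_linearMapAt_of_mem (R := ℝ) hy] at h1
    exact h1
  have hs : ContMDiffWithinAt IM 𝓘(ℝ, EuclideanSpace ℂ (Fin 3)) ∞ (fun y => ∑ i, r i y •
      (t (TotalSpace.mk' (EuclideanSpace ℂ (Fin 3)) (f y) (e i (f y)))).2) U x := by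
    refine ContMDiffWithinAt.sum fun i _ => (hr i x hx).smul ?_
    have h1 : ContMDiffAt (𝓡 1) ((𝓡 1).prod 𝓘(ℝ, EuclideanSpace ℂ (Fin 3))) ∞
        (fun z => TotalSpace.mk' (EuclideanSpace ℂ (Fin 3)) z (e i z)) (f x) :=
      ((he i) (f x) (hUO hx)).contMDiffAt (hO.mem_nhds (hUO hx))
    have h2 := (contMDiffAt_section (f x)).1 h1
    exact h2.comp_contMDiffWithinAt x (hf x hx)
  refine hs.congr_of_eventuallyEq ?_ (hlin x hb)
  filter_upwards [hev] with y hy using hlin y hy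

/-- The smooth bundle structure is only real linear, so each complex coefficient is split: its
imaginary part multiplies the section `I • e i`, which is smooth by `smooth_J`. -/
theorem SUStructure.smoothSectionOn_sum_csmul (S : SUStructure 3 E) {ι : Type*} [Fintype ι]
    {f : M → Z} {U : Set M}
    (hf : ContMDiffOn IM (𝓡 1) ∞ f U) {O : Set Z} (hO : IsOpen O) (hUO : MapsTo f U O)
    {e : ι → ∀ z, E z}
    (he : ∀ i, IsSmoothSection (e i) O) {c : ι → M → ℂ}
    (hc : ∀ i, ContMDiffOn IM 𝓘(ℝ, ℂ) ∞ (c i) U) :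
    SmoothSectionOn IM (𝓡 1) (EuclideanSpace ℂ (Fin 3)) f
      (fun x => ∑ i, c i x • e i (f x)) U := by
  have h := smoothSectionOn_sum_smul (ι := ι ⊕ ι) hf hO hUO
    (e := Sum.elim e fun i z => Complex.I • e i z)
    (by rintro (i | i); exacts [he i, S.smooth_J O (e i) hO (he i)])
    (r := Sum.elim (fun i x => (c i x).re) fun i x => (c i x).im)
    (by
      rintro (i | i)
      · exact (Complex.reCLM.contMDiff).comp_contMDiffOn (hc i)
      · exact (Complex.imCLM.contMDiff).comp_contMDiffOn (hc i))
  convert h using 2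
  rename_i x
  rw [Fintype.sum_sum_type, ← Finset.sum_add_distrib]
  refine Finset.sum_congr rfl fun j _ => ?_
  simp only [Sum.elim_inl, Sum.elim_inr]
  rw [← Complex.coe_smul, ← Complex.coe_smul, smul_smul, ← add_smul]
  congr 1
  exact (Complex.re_add_im _).symm

end Pullback

variable [IsManifold (𝓡 1) ∞ Z] [ContMDiffVectorBundle ∞ (EuclideanSpace ℂ (Fin 3)) E (𝓡 1)]

theorem IsSmoothSection.sum_smul {ι : Type*} [Fintype ι] {O : Set Z} (hO : IsOpen O)
    {e : ι → ∀ z, E z} (he : ∀ i, IsSmoothSection (e i) O) {r : ι → Z → ℝ}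
    (hr : ∀ i, ContMDiffOn (𝓡 1) 𝓘(ℝ, ℝ) ∞ (r i) O) :
    IsSmoothSection (fun z => ∑ i, r i z • e i z) O :=
  smoothSectionOn_sum_smul contMDiffOn_id hO (mapsTo_id _) he hr

theorem IsSmoothSection.smul {O : Set Z} (hO : IsOpen O)
    {e : ∀ z, E z} (he : IsSmoothSection e O) {r : Z → ℝ}
    (hr : ContMDiffOn (𝓡 1) 𝓘(ℝ, ℝ) ∞ r O) :
    IsSmoothSection (fun z => r z • e z) O := by
  simpa using IsSmoothSection.sum_smul (ι := Unit) hO (fun _ => he) (fun _ => hr)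

theorem IsSmoothSection.add {O : Set Z} (hO : IsOpen O)
    {e f : ∀ z, E z} (he : IsSmoothSection e O) (hf : IsSmoothSection f O) :
    IsSmoothSection (fun z => e z + f z) O := by
  have := IsSmoothSection.sum_smul (ι := Bool) hO (e := fun b => cond b e f)
    (by rintro (_ | _); exacts [hf, he]) (r := fun _ _ => 1) (fun _ => contMDiffOn_const)
  simpa using this

theorem IsSmoothSection.sub {O : Set Z} (hO : IsOpen O)
    {e f : ∀ z, E z} (he : IsSmoothSection e O) (hf : IsSmoothSection f O) :
    IsSmoothSection (fun z => e z - f z) O := by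
  have := he.add hO (hf.smul hO (r := fun _ => -1) contMDiffOn_const)
  simpa [sub_eq_add_neg] using this

theorem SUStructure.contMDiffOn_h_re (S : SUStructure 3 E) {O : Set Z} (hO : IsOpen O)
    {e f : ∀ z, E z} (he : IsSmoothSection e O) (hf : IsSmoothSection f O) :
    ContMDiffOn (𝓡 1) 𝓘(ℝ, ℝ) ∞ (fun z => (S.h z (e z) (f z)).re) O :=
  (Complex.reCLM.contMDiff).comp_contMDiffOn (S.smooth_h O e f hO he hf)

/-- A smooth subbundle over a compact base is spanned by finitely many global smooth sections. -/
theorem exists_spanning_sections [T2Space Z] [CompactSpace Z] {V : ∀ z, Submodule ℝ (E z)}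
    (hV : IsSmoothSubbundle (𝓡 1) (𝓡 1) (EuclideanSpace ℂ (Fin 3)) (fun z : Z => z) V) :
    ∃ (N : ℕ) (s : Fin N → ∀ z, E z), (∀ i, IsSmoothSection (s i) univ) ∧
      ∀ z, Submodule.span ℝ (range fun i => s i z) = V z := by
  choose U hU hz m s hs hb using hV
  have : ∀ z₀, ∃ φ : SmoothBumpFunction (𝓡 1) z₀, tsupport φ ⊆ U z₀ := fun z₀ => by
    obtain ⟨φ, -, hφ⟩ := (SmoothBumpFunction.nhds_basis_tsupport (I := 𝓡 1) z₀).mem_iff.1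
      ((hU z₀).mem_nhds (hz z₀))
    exact ⟨φ, hφ⟩
  choose φ hφ using this
  obtain ⟨t, -, ht⟩ := isCompact_univ.elim_nhds_subcover (fun z₀ => Function.support (φ z₀))
    fun z₀ _ => (φ z₀).support_mem_nhds
  let ι := Σ i : t, Fin (m i)
  -- Each local frame is cut off by a bump function supported where the frame spans V; the finitely
  -- many bump functions chosen have no common zero.
  let g : ι → ∀ z, E z := fun i z => φ i.1 z • s i.1 i.2 z
  have hg : ∀ i, IsSmoothSection (g i) univ := fun i =>
    (ContMDiffOn.smul_section_of_tsupport ((φ i.1).contMDiff.contMDiffOn) (hU _) (hφ _) (hs i.1 i.2)).contMDiffOn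
  refine ⟨Fintype.card ι, fun k => g ((Fintype.equivFin ι).symm k), fun k => hg _, fun z => ?_⟩
  have hr : (range fun k => g ((Fintype.equivFin ι).symm k) z) = range fun i => g i z :=
    (Fintype.equivFin ι).symm.surjective.range_comp fun i => g i z
  rw [hr]
  apply le_antisymm
  · rw [Submodule.span_le]
    rintro _ ⟨i, rfl⟩
    by_cases h0 : φ i.1 z = 0
    · simp [g, h0]
    · have hzU : z ∈ U i.1 := hφ _ (subset_tsupport _ h0)
      refine (V z).smul_mem _ ?_
      rw [← (hb i.1 z hzU).2]
      exact Submodule.subset_span (mem_range_self i.2)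
  · obtain ⟨i, hi, hzi⟩ := mem_iUnion₂.1 (ht (mem_univ z))
    have hzU : z ∈ U i := hφ _ (subset_tsupport _ hzi)
    rw [← (hb i z hzU).2, Submodule.span_le]
    rintro _ ⟨k, rfl⟩
    have : s i k z = (φ i z)⁻¹ • g ⟨⟨i, hi⟩, k⟩ z := by
      simp only [g]; rw [smul_smul, inv_mul_cancel₀ hzi, one_smul]
    change s i k z ∈ _
    rw [this]
    exact Submodule.smul_mem _ _ (Submodule.subset_span (mem_range_self _))

end Sections

/-! ### Global unitary frames of special Lagrangian subbundles -/

section Frames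

/-- Two independent members supply the two real equations, hence the map onto ℂ, that general
position over a 1-manifold requires. -/
theorem exists_pair_of_two_le_finrank_span {X ι : Type*} [AddCommGroup X] [Module ℝ X]
    (s : ι → X) (h : 2 ≤ finrank ℝ (Submodule.span ℝ (range s))) :
    ∃ i j, LinearIndependent ℝ ![s i, s j] := by
  by_contra! hn
  have hex : ∃ i, s i ≠ 0 := by
    by_contra! h0
    have : Submodule.span ℝ (range s) = ⊥ := by
      rw [Submodule.span_eq_bot]; rintro _ ⟨i, rfl⟩; exact h0 i
    rw [this] at h; simp at h
  obtain ⟨i, hi⟩ := hex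
  have hle : Submodule.span ℝ (range s) ≤ Submodule.span ℝ {s i} := by
    rw [Submodule.span_le]
    rintro _ ⟨j, rfl⟩
    have := hn i j
    rw [LinearIndependent.pair_iff' hi] at this
    push Not at this
    obtain ⟨a, ha⟩ := this
    exact Submodule.mem_span_singleton.2 ⟨a, ha⟩
  have h1 := (Submodule.finrank_mono hle).trans (finrank_span_le_card {s i})
  simp at h1; omega

variable {Z : Type*} [TopologicalSpace Z] [ChartedSpace (EuclideanSpace ℝ (Fin 1)) Z]
  {E : Z → Type*} [∀ z, AddCommGroup (E z)] [∀ z, Module ℂ (E z)]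
  [∀ z, TopologicalSpace (E z)] [TopologicalSpace (TotalSpace (EuclideanSpace ℂ (Fin 3)) E)]
  [FiberBundle (EuclideanSpace ℂ (Fin 3)) E] [VectorBundle ℝ (EuclideanSpace ℂ (Fin 3)) E]
  [IsManifold (𝓡 1) ∞ Z] [ContMDiffVectorBundle ∞ (EuclideanSpace ℂ (Fin 3)) E (𝓡 1)]

namespace SUStructure

/-- Over a compact `1`-manifold, sections spanning at least a plane in each fibre have a linear
combination with constant coefficients that vanishes nowhere. -/
theorem exists_nowhere_zero (S : SUStructure 3 E) [CompactSpace Z] {N : ℕ} {s : Fin N → ∀ z, E z}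
    (hs : ∀ i, IsSmoothSection (s i) univ)
    (h2 : ∀ z, 2 ≤ finrank ℝ (Submodule.span ℝ (range fun i => s i z))) :
    ∃ c : Fin N → ℝ, ∀ z, ∑ i, c i • s i z ≠ 0 := by
  rcases isEmpty_or_nonempty Z with hZ | ⟨⟨z₁⟩⟩
  · exact ⟨0, fun z => hZ.elim z⟩
  have hN : 0 < finrank ℝ (Fin N → ℝ) := by
    rw [finrank_fin_fun]
    rcases Nat.eq_zero_or_pos N with rfl | h
    · have := h2 z₁
      rw [range_eq_empty, Submodule.span_empty, finrank_bot] at this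
      omega
    · exact h
  have hd := dimH_iUnion_lt (T := Fin N → ℝ) (fun z => {c | ∑ i, c i • s i z = 0}) (by
    intro z₀
    obtain ⟨i, j, hij⟩ := exists_pair_of_two_le_finrank_span _ (h2 z₀)
    -- `Φ z c` records the real inner products of `∑ c k • s k z` with the two fixed sections `s i`
    -- and `s j`, so it vanishes on every bad `c`.
    let g : Fin N → Z → ℂ := fun k z =>
      (S.h z (s i z) (s k z)).re + (S.h z (s j z) (s k z)).re * Complex.I
    have hg : ∀ k, ContMDiffOn (𝓡 1) 𝓘(ℝ, ℂ) ∞ (g k) univ := fun k => by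
      have h1 := S.contMDiffOn_h_re isOpen_univ (hs i) (hs k)
      have h2 := S.contMDiffOn_h_re isOpen_univ (hs j) (hs k)
      exact ((Complex.ofRealCLM.contMDiff.comp_contMDiffOn h1).add
        (h2.smul (contMDiffOn_const (c := Complex.I)))).congr fun z _ => by simp [g]
    let Φ : Z → (Fin N → ℝ) →L[ℝ] ℂ := fun z =>
      ∑ k, (ContinuousLinearMap.proj (R := ℝ) (φ := fun _ : Fin N => ℝ) k).smulRight (g k z)
    have hΦ : ∀ z c, Φ z c = (S.h z (s i z) (∑ k, c k • s k z)).re +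
        (S.h z (s j z) (∑ k, c k • s k z)).re * Complex.I := by
      intro z c
      simp only [Φ, g, sum_apply, ContinuousLinearMap.smulRight_apply,
        ContinuousLinearMap.proj_apply, map_sum, S.h_smul_right, Complex.re_sum]
      push_cast
      rw [Finset.sum_mul, ← Finset.sum_add_distrib]
      refine Finset.sum_congr rfl fun k _ => ?_
      apply Complex.ext <;> simp
    refine ⟨univ, isOpen_univ, mem_univ _, Φ, ?_, ?_, ?_⟩
    · intro z hz
      refine ContMDiffWithinAt.sum fun k _ => ?_
      exact ((ContinuousLinearMap.smulRightL ℝ (Fin N → ℝ) ℂ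
        (ContinuousLinearMap.proj (R := ℝ) (φ := fun _ : Fin N => ℝ) k)).contMDiff).comp_contMDiffOn
        (hg k) z hz
    -- On the coordinates i and j the map is the Gram matrix of `s i z₀` and `s j z₀`, which is
    -- nondegenerate since these are independent.
    · let L : (Fin 2 → ℝ) →ₗ[ℝ] ℂ := (Φ z₀ : (Fin N → ℝ) →ₗ[ℝ] ℂ) ∘ₗ
        ((LinearMap.single ℝ (fun _ : Fin N => ℝ) i).comp (LinearMap.proj 0) +
          (LinearMap.single ℝ (fun _ : Fin N => ℝ) j).comp (LinearMap.proj 1))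
      have hLs : Function.Surjective L := by
        rw [← LinearMap.injective_iff_surjective_of_finrank_eq_finrank
          (by rw [finrank_fin_fun, Complex.finrank_real_complex])]
        rw [injective_iff_map_eq_zero]
        intro c hc
        have hval : L c = (S.h z₀ (s i z₀) (c 0 • s i z₀ + c 1 • s j z₀)).re +
            (S.h z₀ (s j z₀) (c 0 • s i z₀ + c 1 • s j z₀)).re * Complex.I := by
          have hsum : ∑ k, (Pi.single i (c 0) + Pi.single j (c 1) : Fin N → ℝ) k • s k z₀ =
              c 0 • s i z₀ + c 1 • s j z₀ := by
            simp [add_smul, Finset.sum_add_distrib, Pi.single_apply, ite_smul]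
          rw [← hsum]
          exact hΦ z₀ _
        set x := c 0 • s i z₀ + c 1 • s j z₀ with hx
        rw [hval] at hc
        have hre : (S.h z₀ (s i z₀) x).re = 0 := by simpa using congrArg Complex.re hc
        have him : (S.h z₀ (s j z₀) x).re = 0 := by simpa using congrArg Complex.im hc
        have hx0 : x = 0 := by
          apply S.eq_zero_of_h_self
          rw [hx, S.h_add_left, S.h_smul_left, S.h_smul_left, ← hx]
          simp [hre, him]
        have := LinearIndependent.pair_iff.1 hij (c 0) (c 1) hx0
        ext k; fin_cases k; exacts [this.1, this.2]
      intro w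
      obtain ⟨c, hc⟩ := hLs w
      exact ⟨_, hc⟩
    · intro z _ c hc
      have hc' : ∑ k, c k • s k z = 0 := hc
      rw [hΦ, hc']; simp)
  obtain ⟨c, hc⟩ := exists_forall_notMem_of_dimH_le hN hd hd
  exact ⟨c, fun z => (hc z).1⟩

/-- Normalization of a nowhere vanishing section. -/
theorem exists_normalize (S : SUStructure 3 E) {v : ∀ z, E z} (hv : IsSmoothSection v univ) (h0 : ∀ z, v z ≠ 0) :
    ∃ e : ∀ z, E z, (∀ z, ∃ r : ℝ, e z = r • v z) ∧ IsSmoothSection e univ ∧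
      ∀ z, S.h z (e z) (e z) = 1 := by
  let n : Z → ℝ := fun z => (S.h z (v z) (v z)).re
  have hn : ∀ z, 0 < n z := fun z => S.h_pos z _ (h0 z)
  have hns : ContMDiffOn (𝓡 1) 𝓘(ℝ, ℝ) ∞ n univ := S.contMDiffOn_h_re isOpen_univ hv hv
  refine ⟨fun z => (Real.sqrt (n z))⁻¹ • v z, fun z => ⟨_, rfl⟩, hv.smul isOpen_univ ?_, fun z => ?_⟩
  · intro z hz
    have h1 : ContDiffAt ℝ ∞ (fun x : ℝ => (Real.sqrt x)⁻¹) (n z) :=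
      (Real.contDiffAt_sqrt (hn z).ne').inv (Real.sqrt_pos.2 (hn z)).ne'
    exact h1.contMDiffAt.comp_contMDiffWithinAt z (hns z hz)
  · rw [S.h_smul_left, S.h_smul_right, S.h_self_eq]
    change ((Real.sqrt (n z))⁻¹ : ℝ) * (((Real.sqrt (n z))⁻¹ : ℝ) * ((n z : ℝ) : ℂ)) = 1
    norm_cast
    have := Real.mul_self_sqrt (hn z).le
    have h2 := (Real.sqrt_pos.2 (hn z)).ne'
    field_simp
    nlinarith

/-- Subtracting from the sections spanning a bundle their components along a unit section. -/
theorem finrank_span_sub_smul {X : Type*} [AddCommGroup X] [Module ℝ X] {ι : Type*} [Finite ι]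
    (s : ι → X) (e : X) (a : ι → ℝ) :
    finrank ℝ (Submodule.span ℝ (range s)) ≤
      finrank ℝ (Submodule.span ℝ (range fun i => s i - a i • e)) + 1 := by
  have hf1 : FiniteDimensional ℝ (Submodule.span ℝ (range fun i => s i - a i • e)) :=
    FiniteDimensional.span_of_finite ℝ (finite_range _)
  have hle : Submodule.span ℝ (range s) ≤
      Submodule.span ℝ (range fun i => s i - a i • e) ⊔ Submodule.span ℝ {e} := by
    rw [Submodule.span_le]
    rintro _ ⟨i, rfl⟩
    have h : s i = (s i - a i • e) + a i • e := by abel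
    rw [SetLike.mem_coe, h]
    exact Submodule.add_mem_sup (Submodule.subset_span (mem_range_self i))
      (Submodule.smul_mem _ _ (Submodule.mem_span_singleton_self e))
  refine (Submodule.finrank_mono hle).trans ((Submodule.finrank_add_le_finrank_add_finrank _ _).trans ?_)
  have := finrank_span_le_card (R := ℝ) ({e} : Set X)
  simp at this
  omega

/-- A unitary frame of `E` made of sections of a special Lagrangian subbundle. -/
structure IsUnitaryFrame (S : SUStructure 3 E) (V : ∀ z, Submodule ℝ (E z))
    (e : Fin 3 → ∀ z, E z) : Prop where
  smooth : ∀ i, IsSmoothSection (e i) univ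
  h_eq : ∀ z i j, S.h z (e i z) (e j z) = if i = j then 1 else 0
  mem : ∀ z i, e i z ∈ V z

set_option maxHeartbeats 400000 in
theorem exists_unitaryFrame [T2Space Z] [CompactSpace Z] (S : SUStructure 3 E)
    {V : ∀ z, Submodule ℝ (E z)}
    (hV : IsSmoothSubbundle (𝓡 1) (𝓡 1) (EuclideanSpace ℂ (Fin 3)) (fun z : Z => z) V)
    (hL : ∀ z, S.IsSLPlane z (V z)) : ∃ e : Fin 3 → ∀ z, E z, S.IsUnitaryFrame V e := by
  obtain ⟨N, s, hs, hspan⟩ := exists_spanning_sections hV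
  have hsm : ∀ i z, s i z ∈ V z := fun i z => by
    rw [← hspan z]; exact Submodule.subset_span (mem_range_self i)
  have hrank : ∀ z, finrank ℝ (Submodule.span ℝ (range fun i => s i z)) = 3 := fun z => by
    rw [hspan z]; exact (hL z).1
  have him : ∀ z u v, u ∈ V z → v ∈ V z → S.h z u v = ((S.h z u v).re : ℂ) := fun z u v hu hv =>
    Complex.ext (by simp) ((hL z).2.1 u hu v hv)
  obtain ⟨c, hc⟩ := S.exists_nowhere_zero hs fun z => by rw [hrank]; norm_num
  obtain ⟨e₁, he₁, h₁s, h₁n⟩ := S.exists_normalize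
    (IsSmoothSection.sum_smul isOpen_univ hs fun i => contMDiffOn_const) hc
  have h₁m : ∀ z, e₁ z ∈ V z := fun z => by
    obtain ⟨r, hr⟩ := he₁ z
    rw [hr]; exact (V z).smul_mem _ (sum_smul_mem (fun i => hsm i z) c)
  -- sections orthogonal to the first one
  let s' : Fin N → ∀ z, E z := fun i z => s i z - (S.h z (e₁ z) (s i z)).re • e₁ z
  have hs' : ∀ i, IsSmoothSection (s' i) univ := fun i =>
    (hs i).sub isOpen_univ (h₁s.smul isOpen_univ (S.contMDiffOn_h_re isOpen_univ h₁s (hs i)))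
  have hsm' : ∀ i z, s' i z ∈ V z := fun i z =>
    (V z).sub_mem (hsm i z) ((V z).smul_mem _ (h₁m z))
  have horth : ∀ i z, S.h z (e₁ z) (s' i z) = 0 := fun i z => by
    simp only [s', map_sub, S.h_smul_right, h₁n, mul_one]
    rw [← him z _ _ (h₁m z) (hsm i z), sub_self]
  obtain ⟨c', hc'⟩ := S.exists_nowhere_zero hs' fun z => by
    -- Removing one component lowers the rank from 3 to at least 2, so general position applies once
    -- more.
    have := finrank_span_sub_smul (fun i => s i z) (e₁ z) fun i => (S.h z (e₁ z) (s i z)).re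
    rw [hrank] at this
    change 2 ≤ finrank ℝ (Submodule.span ℝ (range fun i => s i z - _))
    omega
  obtain ⟨e₂, he₂, h₂s, h₂n⟩ := S.exists_normalize
    (IsSmoothSection.sum_smul isOpen_univ hs' fun i => contMDiffOn_const) hc'
  have h₂m : ∀ z, e₂ z ∈ V z := fun z => by
    obtain ⟨r, hr⟩ := he₂ z
    rw [hr]; exact (V z).smul_mem _ (sum_smul_mem (fun i => hsm' i z) c')
  have h₁₂ : ∀ z, S.h z (e₁ z) (e₂ z) = 0 := fun z => by
    obtain ⟨r, hr⟩ := he₂ z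
    rw [hr]
    simp only [S.h_smul_right, map_sum, horth, mul_zero, Finset.sum_const_zero]
  have h₂₁ : ∀ z, S.h z (e₂ z) (e₁ z) = 0 := fun z => S.h_eq_zero_symm (h₁₂ z)
  -- the third section
  let ν : Fin N → Z → ℝ := fun i z => (S.vol z (fun k => ![e₁, e₂, s i] k z)).re
  have hν : ∀ i, ContMDiffOn (𝓡 1) 𝓘(ℝ, ℝ) ∞ (ν i) univ := fun i =>
    Complex.reCLM.contMDiff.comp_contMDiffOn (S.smooth_vol univ ![e₁, e₂, s i] isOpen_univ
      (by intro k; fin_cases k; exacts [h₁s, h₂s, hs i]))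
  -- A further removal could leave rank 1, too little for general position. Instead Re Ω(e₁, e₂, ·)
  -- is used: weighting the spanning sections by its values gives a vector outside the span of e₁
  -- and e₂.
  let y : ∀ z, E z := fun z => ∑ i, ν i z • s i z
  have hy : IsSmoothSection y univ := IsSmoothSection.sum_smul isOpen_univ hs hν
  have hym : ∀ z, y z ∈ V z := fun z => sum_smul_mem (fun i => hsm i z) _
  let y' : ∀ z, E z := fun z => y z - (S.h z (e₁ z) (y z)).re • e₁ z
    - (S.h z (e₂ z) (y z)).re • e₂ z
  have hy' : IsSmoothSection y' univ :=
    (hy.sub isOpen_univ (h₁s.smul isOpen_univ (S.contMDiffOn_h_re isOpen_univ h₁s hy))).sub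
      isOpen_univ (h₂s.smul isOpen_univ (S.contMDiffOn_h_re isOpen_univ h₂s hy))
  have hym' : ∀ z, y' z ∈ V z := fun z => (V z).sub_mem
    ((V z).sub_mem (hym z) ((V z).smul_mem _ (h₁m z))) ((V z).smul_mem _ (h₂m z))
  have h₁y : ∀ z, S.h z (e₁ z) (y' z) = 0 := fun z => by
    simp only [y', map_sub, S.h_smul_right, h₁n, h₁₂, mul_one, mul_zero, sub_zero]
    rw [← him z _ _ (h₁m z) (hym z), sub_self]
  have h₂y : ∀ z, S.h z (e₂ z) (y' z) = 0 := fun z => by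
    simp only [y', map_sub, S.h_smul_right, h₂n, h₂₁, mul_one, mul_zero, sub_zero]
    rw [← him z _ _ (h₂m z) (hym z), sub_self]
  -- If y lay in the span of e₁ and e₂, then Ω(e₁, e₂, y) = 0; its real part is ∑ νᵢ², so Re Ω(e₁,
  -- e₂, ·) would vanish on the whole plane, contradicting its value on a completion of e₁, e₂ to a
  -- basis.
  have hy0 : ∀ z, y' z ≠ 0 := by
    intro z h0
    have hyz : y z = (S.h z (e₁ z) (y z)).re • e₁ z + (S.h z (e₂ z) (y z)).re • e₂ z := by
      have : y z - (S.h z (e₁ z) (y z)).re • e₁ z - (S.h z (e₂ z) (y z)).re • e₂ z = 0 := h0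
      rw [sub_sub, sub_eq_zero] at this; exact this
    let vl : E z →ₗ[ℂ] ℂ :=
      (S.vol z).toMultilinearMap.toLinearMap ![e₁ z, e₂ z, 0] 2
    have hvl : ∀ x, vl x = S.vol z ![e₁ z, e₂ z, x] := fun x => by
      change S.vol z (Function.update ![e₁ z, e₂ z, 0] 2 x) = _
      congr 1; ext k; fin_cases k <;> rfl
    have hvr : ∀ (r : ℝ) x, vl (r • x) = r * vl x := fun r x => by
      rw [← Complex.coe_smul, map_smul]; simp
    have hν' : ∀ i, ν i z = (vl (s i z)).re := fun i => by
      simp only [ν, hvl]; congr 2; ext k; fin_cases k <;> rfl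
    have e1 : vl (e₁ z) = 0 := by
      rw [hvl]; exact (S.vol z).map_eq_zero_of_eq _ (i := 0) (j := 2) rfl (by decide)
    have e2 : vl (e₂ z) = 0 := by
      rw [hvl]; exact (S.vol z).map_eq_zero_of_eq _ (i := 1) (j := 2) rfl (by decide)
    have hvy : vl (y z) = 0 := by
      rw [hyz, map_add, hvr, hvr, e1, e2]; simp
    have hsq : ∑ i, (ν i z) ^ 2 = 0 := by
      have := congrArg Complex.re hvy
      simp only [y, map_sum, hvr, Complex.re_sum, Complex.re_ofReal_mul, ← hν',
        Complex.zero_re] at this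
      simpa [pow_two] using this
    have hν0 : ∀ i, ν i z = 0 := fun i => by
      have := (Finset.sum_eq_zero_iff_of_nonneg (fun i _ => sq_nonneg (ν i z))).1 hsq i
        (Finset.mem_univ i)
      exact pow_eq_zero_iff (two_ne_zero) |>.1 this
    have hVz : ∀ u ∈ V z, (vl u).re = 0 := fun u hu => by
      rw [← hspan z] at hu
      obtain ⟨a, rfl⟩ := (Submodule.mem_span_range_iff_exists_fun ℝ).1 hu
      simp [map_sum, hvr, Complex.re_sum, ← hν', hν0]
    obtain ⟨u, hu, hun⟩ : ∃ u ∈ V z, u ∉ Submodule.span ℝ (range ![e₁ z, e₂ z]) := by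
      by_contra! hcon
      have : FiniteDimensional ℝ (Submodule.span ℝ (range ![e₁ z, e₂ z])) :=
        FiniteDimensional.span_of_finite ℝ (finite_range _)
      have h1 := Submodule.finrank_mono (show V z ≤ _ from hcon)
      have h2 := finrank_range_le_card (R := ℝ) ![e₁ z, e₂ z]
      rw [(hL z).1] at h1
      rw [Set.finrank] at h2
      simp at h2; omega
    have hli2 : LinearIndependent ℝ ![e₁ z, e₂ z] := by
      rw [LinearIndependent.pair_iff]
      intro a b hab
      have h1 := congrArg (S.h z (e₁ z)) hab
      have h2 := congrArg (S.h z (e₂ z)) hab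
      simp only [map_add, S.h_smul_right, h₁n, h₁₂, h₂₁, h₂n, map_zero] at h1 h2
      simpa using And.intro h1 h2
    have hli : LinearIndependent ℝ (Fin.snoc ![e₁ z, e₂ z] u : Fin 3 → E z) :=
      linearIndependent_finSnoc.2 ⟨hli2, hun⟩
    have hsn : (Fin.snoc ![e₁ z, e₂ z] u : Fin 3 → E z) = ![e₁ z, e₂ z, u] := by
      ext k; fin_cases k <;> rfl
    rw [hsn] at hli
    have hpb := (hL z).isPlaneBasis_of_li hli
      (by intro k; fin_cases k; exacts [h₁m z, h₂m z, hu])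
    exact hpb.vol_re_ne_zero (hL z) (by rw [← hvl]; exact hVz u hu)
  obtain ⟨e₃, he₃, h₃s, h₃n⟩ := S.exists_normalize hy' hy0
  have h₁₃ : ∀ z, S.h z (e₁ z) (e₃ z) = 0 := fun z => by
    obtain ⟨r, hr⟩ := he₃ z
    rw [hr, S.h_smul_right, h₁y, mul_zero]
  have h₂₃ : ∀ z, S.h z (e₂ z) (e₃ z) = 0 := fun z => by
    obtain ⟨r, hr⟩ := he₃ z
    rw [hr, S.h_smul_right, h₂y, mul_zero]
  refine ⟨![e₁, e₂, e₃], ?_, ?_, ?_⟩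
  · intro k; fin_cases k; exacts [h₁s, h₂s, h₃s]
  · intro z i j
    fin_cases i <;> fin_cases j
    exacts [h₁n z, h₁₂ z, h₁₃ z, h₂₁ z, h₂n z, h₂₃ z, S.h_eq_zero_symm (h₁₃ z),
      S.h_eq_zero_symm (h₂₃ z), h₃n z]
  · intro z k
    obtain ⟨r, hr⟩ := he₃ z
    fin_cases k
    exacts [h₁m z, h₂m z, show e₃ z ∈ V z by rw [hr]; exact (V z).smul_mem _ (hym' z)]

end SUStructure

end Frames

/-! ### The sign of a transverse pair and its invariance -/

section Sign

variable {Z : Type*} [TopologicalSpace Z] [ChartedSpace (EuclideanSpace ℝ (Fin 1)) Z]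
  {E : Z → Type*} [∀ z, AddCommGroup (E z)] [∀ z, Module ℂ (E z)]
  [∀ z, TopologicalSpace (E z)] [TopologicalSpace (TotalSpace (EuclideanSpace ℂ (Fin 3)) E)]
  [FiberBundle (EuclideanSpace ℂ (Fin 3)) E] [VectorBundle ℝ (EuclideanSpace ℂ (Fin 3)) E]

namespace SUStructure

/-- A quantity whose sign distinguishes the two components of the space of transverse pairs of
special Lagrangian planes; `e` and `f` are bases of the planes. -/
def pairing (S : SUStructure 3 E) (z : Z) (e f : Fin 3 → E z) : ℝ :=
  (S.vol z e).re * (S.vol z f).re * (Matrix.of fun j k => (S.h z (e j) (f k)).im).det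

/-- The transverse pair `(L, L')` lies in the component on which `pairing` is positive. -/
def PosPair (S : SUStructure 3 E) (z : Z) (L L' : Submodule ℝ (E z)) : Prop :=
  ∃ e f, S.IsPlaneBasis L e ∧ S.IsPlaneBasis L' f ∧ 0 < S.pairing z e f

variable {S : SUStructure 3 E} {z : Z}

/-- A kernel vector of the matrix gives an element of L' that is ω-orthogonal to L, hence lies in L
because L is maximal isotropic; transversality makes it zero. -/
theorem IsTransversePlanes.det_ne_zero {L L' : Submodule ℝ (E z)}
    (hT : S.IsTransversePlanes z L L') {e f : Fin 3 → E z} (he : S.IsPlaneBasis L e)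
    (hf : S.IsPlaneBasis L' f) : (Matrix.of fun j k => (S.h z (e j) (f k)).im).det ≠ 0 := by
  intro hdet
  obtain ⟨c, hc0, hc⟩ := Matrix.exists_mulVec_eq_zero_iff.2 hdet
  apply hc0
  set x := ∑ k, c k • f k with hx
  have hxL' : x ∈ L' := sum_smul_mem hf.mem c
  have h1 : ∀ j, (S.h z (e j) x).im = 0 := fun j => by
    have := congrFun hc j
    simp only [Matrix.mulVec, dotProduct, Matrix.of_apply, Pi.zero_apply] at this
    rw [hx, map_sum, Complex.im_sum, ← this]
    refine Finset.sum_congr rfl fun k _ => ?_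
    rw [S.h_smul_right, Complex.im_ofReal_mul, mul_comm]
  have hxL : x ∈ L := by
    refine hT.1.mem_of_omega fun u hu => ?_
    rw [← he.span_eq] at hu
    obtain ⟨a, rfl⟩ := (Submodule.mem_span_range_iff_exists_fun ℝ).1 hu
    rw [omega, S.h_sum_left, Complex.im_sum]
    refine Finset.sum_eq_zero fun i _ => ?_
    rw [S.h_smul_left, Complex.im_ofReal_mul, h1, mul_zero]
  have hx0 : x = 0 := by
    have : x ∈ L ⊓ L' := ⟨hxL, hxL'⟩
    rwa [hT.2.2, Submodule.mem_bot] at this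
  ext k
  exact Fintype.linearIndependent_iff.1 hf.li c hx0 k

theorem IsTransversePlanes.pairing_ne_zero {L L' : Submodule ℝ (E z)}
    (hT : S.IsTransversePlanes z L L') {e f : Fin 3 → E z} (he : S.IsPlaneBasis L e)
    (hf : S.IsPlaneBasis L' f) : S.pairing z e f ≠ 0 :=
  mul_ne_zero (mul_ne_zero (he.vol_re_ne_zero hT.1) (hf.vol_re_ne_zero hT.2.1))
    (hT.det_ne_zero he hf)

theorem vol_re_sum {L : Submodule ℝ (E z)} (hL : S.IsSLPlane z L) {e : Fin 3 → E z}
    (he : S.IsPlaneBasis L e) (a : Fin 3 → Fin 3 → ℝ) :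
    (S.vol z fun k => ∑ j, a k j • e j).re = (S.vol z e).re * (Matrix.of a).det := by
  have h1 : (fun k => ∑ j, a k j • e j) = fun k => ∑ j, ((a k j : ℝ) : ℂ) • e j := by
    ext k; exact Finset.sum_congr rfl fun j _ => (Complex.coe_smul _ _).symm
  rw [h1, S.vol_sum (he.liC hL) fun j k => ((a k j : ℝ) : ℂ)]
  have hd : (Matrix.of fun j k => ((a k j : ℝ) : ℂ)).det = (((Matrix.of a).det : ℝ) : ℂ) := by
    have h2 := Complex.ofRealHom.map_det (Matrix.of a)
    simp only [Complex.ofRealHom_eq_coe] at h2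
    rw [h2, ← Matrix.det_transpose]; rfl
  rw [hd]; simp

theorem h_im_sum_sum {ι κ : Type*} [Fintype ι] [Fintype κ] (a : ι → ℝ) (b : κ → ℝ) (e : ι → E z)
    (f : κ → E z) : (S.h z (∑ j, a j • e j) (∑ k, b k • f k)).im =
      ∑ j, ∑ k, a j * (S.h z (e j) (f k)).im * b k := by
  rw [S.h_sum_left, Complex.im_sum]
  refine Finset.sum_congr rfl fun j _ => ?_
  rw [map_sum, Complex.im_sum]
  refine Finset.sum_congr rfl fun k _ => ?_
  rw [S.h_smul_left, S.h_smul_right, Complex.im_ofReal_mul, Complex.im_ofReal_mul]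
  ring

/-- If a and b are the matrices of the base changes, the two volume factors contribute det a and det
b, and the ω-matrix contributes both again, so `pairing` is multiplied by (det a · det b)². -/
theorem IsTransversePlanes.pairing_pos_iff {L L' : Submodule ℝ (E z)}
    (hT : S.IsTransversePlanes z L L') {e e' f f' : Fin 3 → E z} (he : S.IsPlaneBasis L e)
    (he' : S.IsPlaneBasis L e') (hf : S.IsPlaneBasis L' f) (hf' : S.IsPlaneBasis L' f')
    (h : 0 < S.pairing z e f) : 0 < S.pairing z e' f' := by
  have hne := hT.pairing_ne_zero he' hf'
  have h1 : ∀ i, e' i ∈ Submodule.span ℝ (range e) := fun i => by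
    rw [he.span_eq]; exact he'.mem i
  have h2 : ∀ i, f' i ∈ Submodule.span ℝ (range f) := fun i => by
    rw [hf.span_eq]; exact hf'.mem i
  choose a ha using fun i => (Submodule.mem_span_range_iff_exists_fun ℝ).1 (h1 i)
  choose b hb using fun i => (Submodule.mem_span_range_iff_exists_fun ℝ).1 (h2 i)
  have hav : e' = fun k => ∑ j, a k j • e j := funext fun k => (ha k).symm
  have hbv : f' = fun k => ∑ j, b k j • f j := funext fun k => (hb k).symm
  have hM : (Matrix.of fun j k => (S.h z (e' j) (f' k)).im) =
      Matrix.of a * (Matrix.of fun j k => (S.h z (e j) (f k)).im) * (Matrix.of b).transpose := by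
    ext i k
    simp only [Matrix.mul_apply, Matrix.of_apply, Matrix.transpose_apply, hav, hbv,
      h_im_sum_sum, Finset.sum_mul]
    rw [Finset.sum_comm]
  have key : S.pairing z e' f' =
      ((Matrix.of a).det * (Matrix.of b).det) ^ 2 * S.pairing z e f := by
    rw [pairing, hM, Matrix.det_mul, Matrix.det_mul, Matrix.det_transpose]
    rw [hav, hbv, vol_re_sum hT.1 he, vol_re_sum hT.2.1 hf, pairing]
    ring
  rw [key] at hne ⊢
  exact mul_pos (lt_of_le_of_ne (sq_nonneg _) (Ne.symm (left_ne_zero_of_mul hne))) h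

theorem IsTransversePlanes.posPair_iff {L L' : Submodule ℝ (E z)}
    (hT : S.IsTransversePlanes z L L') {e f : Fin 3 → E z} (he : S.IsPlaneBasis L e)
    (hf : S.IsPlaneBasis L' f) : S.PosPair z L L' ↔ 0 < S.pairing z e f :=
  ⟨fun ⟨_, _, he', hf', h⟩ => hT.pairing_pos_iff he' he hf' hf h, fun h => ⟨e, f, he, hf, h⟩⟩

theorem IsTransversePlanes.symm {L L' : Submodule ℝ (E z)}
    (hT : S.IsTransversePlanes z L L') : S.IsTransversePlanes z L' L :=
  ⟨hT.2.1, hT.1, by rw [inf_comm]; exact hT.2.2⟩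

/-- The ω-matrix is replaced by minus its transpose, and (−1)³ = −1: odd rank is what separates a
pair from its interchange. -/
theorem pairing_swap (e f : Fin 3 → E z) : S.pairing z f e = -S.pairing z e f := by
  have : (Matrix.of fun j k => (S.h z (f j) (e k)).im) =
      -(Matrix.of fun j k => (S.h z (e j) (f k)).im).transpose := by
    ext i k; exact S.h_im_symm _ _
  rw [pairing, this, Matrix.det_neg, Matrix.det_transpose, pairing]
  simp; ring

/-- Interchanging the planes interchanges the two components. -/
theorem IsTransversePlanes.posPair_swap {L L' : Submodule ℝ (E z)}
    (hT : S.IsTransversePlanes z L L') : S.PosPair z L' L ↔ ¬ S.PosPair z L L' := by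
  obtain ⟨e, he⟩ := hT.1.exists_basis
  obtain ⟨f, hf⟩ := hT.2.1.exists_basis
  rw [hT.posPair_iff he hf, hT.symm.posPair_iff hf he, pairing_swap, neg_pos, not_lt]
  exact (hT.pairing_ne_zero he hf).le_iff_lt.symm

section Continuity

variable {X : Type*} [TopologicalSpace X]

theorem continuousAt_det {x₀ : X} {M : X → Matrix (Fin 3) (Fin 3) ℝ}
    (hM : ∀ i j, ContinuousAt (fun x => M x i j) x₀) : ContinuousAt (fun x => (M x).det) x₀ := by
  have h : Continuous fun A : Matrix (Fin 3) (Fin 3) ℝ => A.det := continuous_id.matrix_det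
  exact h.continuousAt.comp (continuousAt_pi.2 fun i => continuousAt_pi.2 fun j => hM i j)

/-- The component of a transverse pair is locally constant in continuous families. -/
theorem eventually_posPair_iff {g : X → Z} {x₀ : X} {L L' : ∀ x, Submodule ℝ (E (g x))}
    (hT : ∀ x, S.IsTransversePlanes (g x) (L x) (L' x)) {e f : Fin 3 → ∀ x, E (g x)}
    (he : ∀ᶠ x in 𝓝 x₀, S.IsPlaneBasis (L x) fun i => e i x)
    (hf : ∀ᶠ x in 𝓝 x₀, S.IsPlaneBasis (L' x) fun i => f i x)
    (hve : ContinuousAt (fun x => S.vol (g x) fun i => e i x) x₀)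
    (hvf : ContinuousAt (fun x => S.vol (g x) fun i => f i x) x₀)
    (hh : ∀ i j, ContinuousAt (fun x => S.h (g x) (e i x) (f j x)) x₀) :
    ∀ᶠ x in 𝓝 x₀, (S.PosPair (g x) (L x) (L' x) ↔ S.PosPair (g x₀) (L x₀) (L' x₀)) := by
  have hc : ContinuousAt (fun x => S.pairing (g x) (fun i => e i x) fun i => f i x) x₀ :=
    ((Complex.continuous_re.continuousAt.comp hve).mul
      (Complex.continuous_re.continuousAt.comp hvf)).mul
      (continuousAt_det fun i j => Complex.continuous_im.continuousAt.comp (hh i j))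
  have h0 := (hT x₀).posPair_iff he.self_of_nhds hf.self_of_nhds
  rcases ((hT x₀).pairing_ne_zero he.self_of_nhds hf.self_of_nhds).lt_or_gt with h | h
  · filter_upwards [he, hf, hc.eventually (gt_mem_nhds h)] with x hex hfx hx
    rw [(hT x).posPair_iff hex hfx, h0]
    exact ⟨fun h' => absurd h' hx.not_gt, fun h' => absurd h' h.not_gt⟩
  · filter_upwards [he, hf, hc.eventually (lt_mem_nhds h)] with x hex hfx hx
    rw [(hT x).posPair_iff hex hfx, h0]
    exact ⟨fun _ => h, fun _ => hx⟩

theorem isClopen_of_eventually_iff {P : X → Prop} (h : ∀ x₀, ∀ᶠ x in 𝓝 x₀, (P x ↔ P x₀)) :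
    IsClopen {x | P x} := by
  refine ⟨⟨isOpen_iff_mem_nhds.2 fun x hx => ?_⟩, isOpen_iff_mem_nhds.2 fun x hx => ?_⟩
  · filter_upwards [h x] with y hy using fun hy' => hx (hy.1 hy')
  · filter_upwards [h x] with y hy using hy.2 hx

theorem iff_of_eventually_iff [PreconnectedSpace X] {P : X → Prop}
    (h : ∀ x₀, ∀ᶠ x in 𝓝 x₀, (P x ↔ P x₀)) (x y : X) : P x ↔ P y := by
  rcases isClopen_iff.1 (isClopen_of_eventually_iff h) with h0 | h1
  · have hP : ∀ x, ¬ P x := fun x hx => by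
      have : x ∈ {x | P x} := hx
      rw [h0] at this; exact this
    exact iff_of_false (hP x) (hP y)
  · have hP : ∀ x, P x := fun x => by
      have : x ∈ (univ : Set X) := mem_univ x
      rw [← h1] at this; exact this
    exact iff_of_true (hP x) (hP y)

/-- The topology of a fibre is accessible only through a trivialization, so continuity is
transported from the finite-dimensional model. -/
theorem continuous_fibre_linear (l : E z →ₗ[ℝ] ℂ) : Continuous l := by
  have : FiniteDimensional ℝ (EuclideanSpace ℂ (Fin 3)) := FiniteDimensional.complexToReal _
  have h : Continuous (l ∘ₗ (fibreEquiv (E := E) z).symm.toLinearEquiv.toLinearMap) :=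
    LinearMap.continuous_of_finiteDimensional _
  have := h.comp (fibreEquiv (E := E) z).continuous
  convert this using 1
  ext x
  exact congrArg l ((fibreEquiv (E := E) z).symm_apply_apply x).symm

theorem continuousAt_h {a b : X → E z} {x₀ : X} (ha : ContinuousAt a x₀) (hb : ContinuousAt b x₀) :
    ContinuousAt (fun x => S.h z (a x) (b x)) x₀ := by
  have := finiteDimensional_fibre (E := E) z
  let B := finBasis ℂ (E z)
  have h : (fun x => S.h z (a x) (b x)) =
      fun x => ∑ j, star (B.repr (a x) j) * S.h z (B j) (b x) := by
    ext x
    conv_lhs => rw [← B.sum_repr (a x)]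
    rw [S.h_sum_left]
    exact Finset.sum_congr rfl fun j _ => S.h_csmul_left _ _ _
  rw [h]
  refine tendsto_finsetSum _ fun j _ => Filter.Tendsto.mul ?_ ?_
  · have : Continuous fun u : E z => B.coord j u :=
      continuous_fibre_linear ((B.coord j).restrictScalars ℝ)
    exact (continuous_star.continuousAt).comp (this.continuousAt.comp ha)
  · exact (continuous_fibre_linear ((S.h z (B j)).restrictScalars ℝ)).continuousAt.comp hb

theorem continuousAt_vol {a : Fin 3 → X → E z} {x₀ : X} (ha : ∀ i, ContinuousAt (a i) x₀) :
    ContinuousAt (fun x => S.vol z fun i => a i x) x₀ := by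
  have := finiteDimensional_fibre (E := E) z
  let B := finBasisOfFinrankEq ℂ (E z) (finrank_fibre z)
  have h : (fun x => S.vol z fun i => a i x) =
      fun x => S.vol z B * (Matrix.of fun i j => B.repr (a j x) i).det := by
    ext x
    have h1 := congrArg (fun f => f fun i => a i x) (AlternatingMap.eq_smul_basis_det B (S.vol z))
    simp only [AlternatingMap.smul_apply, smul_eq_mul, Basis.det_apply] at h1
    exact h1
  rw [h]
  refine continuousAt_const.mul ?_
  have hd : Continuous fun A : Matrix (Fin 3) (Fin 3) ℂ => A.det := continuous_id.matrix_det
  refine hd.continuousAt.comp (continuousAt_pi.2 fun i => continuousAt_pi.2 fun j => ?_)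
  have : Continuous fun u : E z => B.coord i u :=
    continuous_fibre_linear ((B.coord i).restrictScalars ℝ)
  exact this.continuousAt.comp (ha j)

end Continuity

/-- The sign is locally constant along the path, and the unit interval is connected. -/
theorem SameComponent.posPair_iff {L L' K K' : Submodule ℝ (E z)}
    (h : S.SameComponent z L L' K K') : S.PosPair z L L' ↔ S.PosPair z K K' := by
  obtain ⟨a, a', ha, ha', hT, rfl, rfl, rfl, rfl⟩ := h
  have hc : ∀ t₀, ∀ i, ContinuousAt (fun t => a t i) t₀ := fun t₀ i =>
    ((continuous_apply i).comp ha).continuousAt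
  have hc' : ∀ t₀, ∀ i, ContinuousAt (fun t => a' t i) t₀ := fun t₀ i =>
    ((continuous_apply i).comp ha').continuousAt
  exact iff_of_eventually_iff (P := fun t => S.PosPair z (Submodule.span ℝ (range (a t)))
    (Submodule.span ℝ (range (a' t)))) (fun t₀ => eventually_posPair_iff (g := fun _ => z) hT
      (e := fun i t => a t i) (f := fun i t => a' t i)
      (Filter.Eventually.of_forall fun t => (hT t).1.isPlaneBasis_of_span rfl)
      (Filter.Eventually.of_forall fun t => (hT t).2.1.isPlaneBasis_of_span rfl)
      (continuousAt_vol (hc t₀)) (continuousAt_vol (hc' t₀))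
      fun i j => continuousAt_h (hc t₀ i) (hc' t₀ j)) 0 1

/-- A smooth frame with the right number of sections from the definition of a subbundle. -/
theorem exists_frame {HM EM M : Type*} [NormedAddCommGroup EM] [NormedSpace ℝ EM]
    [TopologicalSpace HM] {IM : ModelWithCorners ℝ EM HM} [TopologicalSpace M] [ChartedSpace HM M]
    {f : M → Z} {V : ∀ x, Submodule ℝ (E (f x))}
    (hV : IsSmoothSubbundle IM (𝓡 1) (EuclideanSpace ℂ (Fin 3)) f V)
    (hL : ∀ x, S.IsSLPlane (f x) (V x)) (x₀ : M) :
    ∃ U : Set M, IsOpen U ∧ x₀ ∈ U ∧ ∃ s : Fin 3 → ∀ x, E (f x),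
      (∀ i, SmoothSectionOn IM (𝓡 1) (EuclideanSpace ℂ (Fin 3)) f (s i) U) ∧
      ∀ x ∈ U, S.IsPlaneBasis (V x) fun i => s i x := by
  obtain ⟨U, hU, hx, m, s, hs, hb⟩ := hV x₀
  have hm : m = 3 := by
    have h1 := finrank_span_eq_card (hb x₀ hx).1
    rw [(hb x₀ hx).2, (hL x₀).1, Fintype.card_fin] at h1
    exact h1.symm
  subst hm
  exact ⟨U, hU, hx, s, hs, fun x hxU => ⟨(hb x hxU).1, (hb x hxU).2⟩⟩

theorem IsTransversePair.eventually_posPair_iff {V V' : ∀ z, Submodule ℝ (E z)}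
    (hV : S.IsTransversePair V V') (z₀ : Z) :
    ∀ᶠ z in 𝓝 z₀, (S.PosPair z (V z) (V' z) ↔ S.PosPair z₀ (V z₀) (V' z₀)) := by
  obtain ⟨U, hU, hz, s, hs, hb⟩ := exists_frame hV.1 (fun z => (hV.2.2 z).1) z₀
  obtain ⟨U', hU', hz', s', hs', hb'⟩ := exists_frame hV.2.1 (fun z => (hV.2.2 z).2.1) z₀
  have hm := hU.mem_nhds hz
  have hm' := hU'.mem_nhds hz'
  refine SUStructure.eventually_posPair_iff (g := fun z => z) hV.2.2 (e := s) (f := s')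
    (Filter.mem_of_superset hm hb) (Filter.mem_of_superset hm' hb') ?_ ?_ fun i j => ?_
  · exact (S.smooth_vol U s hU hs).continuousOn.continuousAt hm
  · exact (S.smooth_vol U' s' hU' hs').continuousOn.continuousAt hm'
  · exact (S.smooth_h (U ∩ U') (s i) (s' j) (hU.inter hU') (ContMDiffOn.mono (hs i) inter_subset_left)
      (ContMDiffOn.mono (hs' j) inter_subset_right)).continuousOn.continuousAt
      (Filter.inter_mem hm hm')

/-- The inclusion of a fibre into the total space is inducing, so continuity in the total space
along fixed `z` is continuity in the fibre. -/
theorem continuousAt_fibre {U : Set (Z × unitInterval)} (hU : IsOpen U)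
    {s : ∀ p : Z × unitInterval, E p.1}
    (hs : SmoothSectionOn ((𝓡 1).prod (𝓡∂ 1)) (𝓡 1) (EuclideanSpace ℂ (Fin 3)) Prod.fst s U)
    {z : Z} {t : unitInterval} (ht : (z, t) ∈ U) :
    ContinuousAt (Y := E z) (fun t => s (z, t)) t := by
  have hc := hs.continuousOn.continuousAt (hU.mem_nhds ht)
  have h2 : ContinuousAt
      (fun t => TotalSpace.mk' (E := E) (EuclideanSpace ℂ (Fin 3)) z (s (z, t))) t :=
    ContinuousAt.comp (f := fun t : unitInterval => (z, t)) hc (by fun_prop)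
  exact (FiberBundle.totalSpaceMk_isInducing (EuclideanSpace ℂ (Fin 3)) E z).continuousAt_iff.2 h2

theorem Equivalent.posPair_iff {V V' W W' : ∀ z, Submodule ℝ (E z)}
    (h : S.Equivalent V V' W W') (z : Z) :
    S.PosPair z (V z) (V' z) ↔ S.PosPair z (W z) (W' z) := by
  obtain ⟨G, G', hG, hG', h0, h1, h0', h1', hT⟩ := h
  rw [← h0, ← h1, ← h0', ← h1']
  refine iff_of_eventually_iff (P := fun t => S.PosPair z (G (z, t)) (G' (z, t)))
    (fun t₀ => ?_) 0 1
  obtain ⟨U, hU, hz, s, hs, hb⟩ := exists_frame hG (fun p => ((hT p.2).2.2 p.1).1) (z, t₀)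
  obtain ⟨U', hU', hz', s', hs', hb'⟩ :=
    exists_frame hG' (fun p => ((hT p.2).2.2 p.1).2.1) (z, t₀)
  have hcont : Continuous fun t : unitInterval => (z, t) := by fun_prop
  refine SUStructure.eventually_posPair_iff (g := fun _ => z) (fun t => (hT t).2.2 z)
    (e := fun i t => s i (z, t)) (f := fun i t => s' i (z, t))
    (Filter.mem_of_superset (hcont.continuousAt.preimage_mem_nhds (hU.mem_nhds hz))
      fun t ht => hb _ ht)
    (Filter.mem_of_superset (hcont.continuousAt.preimage_mem_nhds (hU'.mem_nhds hz'))
      fun t ht => hb' _ ht) (continuousAt_vol fun i => continuousAt_fibre hU (hs i) hz)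
    (continuousAt_vol fun i => continuousAt_fibre hU' (hs' i) hz')
    fun i j => continuousAt_h (continuousAt_fibre hU (hs i) hz) (continuousAt_fibre hU' (hs' j) hz')

end SUStructure

end Sign

/-! ### Isotropic pairs in ℂ³ and the unitary frames they determine -/

section UnitaryPath

/-- The standard Hermitian product on `ℂ³`. -/
def hp (u v : Fin 3 → ℂ) : ℂ := conj (u 0) * v 0 + conj (u 1) * v 1 + conj (u 2) * v 2

/-- The conjugate of the cross product on `ℂ³`. -/
def cc (u v : Fin 3 → ℂ) : Fin 3 → ℂ :=
  ![conj (u 1 * v 2 - u 2 * v 1), conj (u 2 * v 0 - u 0 * v 2), conj (u 0 * v 1 - u 1 * v 0)]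

theorem contDiff_coord {D : Type*} [NormedAddCommGroup D] [NormedSpace ℝ D]
    {f : D → Fin 3 → ℂ} {x : D} (hf : ContDiffAt ℝ ∞ f x) (i : Fin 3) :
    ContDiffAt ℝ ∞ (fun y => f y i) x :=
  contDiffAt_pi.1 hf i

theorem contDiffAt_conj {D : Type*} [NormedAddCommGroup D] [NormedSpace ℝ D]
    {f : D → ℂ} {x : D} (hf : ContDiffAt ℝ ∞ f x) : ContDiffAt ℝ ∞ (fun y => conj (f y)) x :=
  Complex.conjCLE.contDiff.contDiffAt.comp x hf

theorem contDiffAt_re {D : Type*} [NormedAddCommGroup D] [NormedSpace ℝ D]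
    {f : D → ℂ} {x : D} (hf : ContDiffAt ℝ ∞ f x) : ContDiffAt ℝ ∞ (fun y => (f y).re) x :=
  Complex.reCLM.contDiff.contDiffAt.comp x hf

theorem contDiffAt_im {D : Type*} [NormedAddCommGroup D] [NormedSpace ℝ D]
    {f : D → ℂ} {x : D} (hf : ContDiffAt ℝ ∞ f x) : ContDiffAt ℝ ∞ (fun y => (f y).im) x :=
  Complex.imCLM.contDiff.contDiffAt.comp x hf

theorem contDiffAt_hp {D : Type*} [NormedAddCommGroup D] [NormedSpace ℝ D]
    {f g : D → Fin 3 → ℂ} {x : D} (hf : ContDiffAt ℝ ∞ f x) (hg : ContDiffAt ℝ ∞ g x) :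
    ContDiffAt ℝ ∞ (fun y => hp (f y) (g y)) x :=
  (((contDiffAt_conj (contDiff_coord hf 0)).mul (contDiff_coord hg 0)).add
    ((contDiffAt_conj (contDiff_coord hf 1)).mul (contDiff_coord hg 1))).add
    ((contDiffAt_conj (contDiff_coord hf 2)).mul (contDiff_coord hg 2))

theorem contDiffAt_cc {D : Type*} [NormedAddCommGroup D] [NormedSpace ℝ D]
    {f g : D → Fin 3 → ℂ} {x : D} (hf : ContDiffAt ℝ ∞ f x) (hg : ContDiffAt ℝ ∞ g x) :
    ContDiffAt ℝ ∞ (fun y => cc (f y) (g y)) x := by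
  have h : ∀ i j k l : Fin 3, ContDiffAt ℝ ∞ (fun y => conj (f y i * g y j - f y k * g y l)) x :=
    fun i j k l => contDiffAt_conj (((contDiff_coord hf i).mul (contDiff_coord hg j)).sub
      ((contDiff_coord hf k).mul (contDiff_coord hg l)))
  refine contDiffAt_pi.2 fun i => ?_
  fin_cases i
  exacts [h 1 2 2 1, h 2 0 0 2, h 0 1 1 0]

theorem hp_add_right (u v w : Fin 3 → ℂ) : hp u (v + w) = hp u v + hp u w := by
  simp [hp]; ring

theorem hp_sub_right (u v w : Fin 3 → ℂ) : hp u (v - w) = hp u v - hp u w := by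
  simp [hp]; ring

theorem hp_add_left (u v w : Fin 3 → ℂ) : hp (u + v) w = hp u w + hp v w := by
  simp [hp]; ring

theorem hp_csmul_right (c : ℂ) (u v : Fin 3 → ℂ) : hp u (c • v) = c * hp u v := by
  simp [hp]; ring

theorem hp_smul_right (r : ℝ) (u v : Fin 3 → ℂ) : hp u (r • v) = r * hp u v := by
  simp [hp]; ring

theorem hp_smul_left (r : ℝ) (u v : Fin 3 → ℂ) : hp (r • u) v = r * hp u v := by
  simp [hp]; ring

theorem hp_neg_right (u v : Fin 3 → ℂ) : hp u (-v) = -hp u v := by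
  simp [hp]; ring

theorem hp_conj (u v : Fin 3 → ℂ) : conj (hp u v) = hp v u := by
  simp [hp]; ring

theorem hp_self (u : Fin 3 → ℂ) :
    hp u u = ((Complex.normSq (u 0) + Complex.normSq (u 1) + Complex.normSq (u 2) : ℝ) : ℂ) := by
  simp [hp, Complex.normSq_eq_conj_mul_self]

theorem hp_self_eq_re (u : Fin 3 → ℂ) : hp u u = ((hp u u).re : ℂ) := by
  rw [hp_self]; simp

theorem hp_self_pos {u : Fin 3 → ℂ} (hu : u ≠ 0) : 0 < (hp u u).re := by
  rw [hp_self, Complex.ofReal_re]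
  by_contra h
  apply hu
  have h0 := Complex.normSq_nonneg (u 0)
  have h1 := Complex.normSq_nonneg (u 1)
  have h2 := Complex.normSq_nonneg (u 2)
  have e0 : Complex.normSq (u 0) = 0 := by linarith
  have e1 : Complex.normSq (u 1) = 0 := by linarith
  have e2 : Complex.normSq (u 2) = 0 := by linarith
  ext i
  fin_cases i
  exacts [Complex.normSq_eq_zero.1 e0, Complex.normSq_eq_zero.1 e1, Complex.normSq_eq_zero.1 e2]

theorem hp_cc_left (u v : Fin 3 → ℂ) : hp (cc u v) u = 0 := by
  simp [hp, cc]; ring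

theorem hp_cc_right (u v : Fin 3 → ℂ) : hp (cc u v) v = 0 := by
  simp [hp, cc]; ring

/-- Lagrange's identity; it makes `cc` of an orthonormal pair a unit vector. -/
theorem hp_cc_cc (u v : Fin 3 → ℂ) :
    hp (cc u v) (cc u v) = hp u u * hp v v - hp u v * hp v u := by
  simp [hp, cc]; ring

/-- With w = `cc u v` of norm 1 this shows that the completed frame has determinant 1; with general
w it turns nonvanishing of the left side into complex independence of u, v, w. -/
theorem hp_cc_eq_det (u v w : Fin 3 → ℂ) :
    hp (cc u v) w = (Matrix.of fun i k => (![u, v, w] k) i).det := by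
  simp [hp, cc, Matrix.det_fin_three]; ring

theorem cc_ne_zero {u v : Fin 3 → ℂ} (h : LinearIndependent ℂ ![u, v]) : cc u v ≠ 0 := by
  intro h0
  apply (crossProduct_ne_zero_iff_linearIndependent.2 h)
  have h1 := congrFun h0 0
  have h2 := congrFun h0 1
  have h3 := congrFun h0 2
  simp only [cc, Matrix.cons_val_zero, Matrix.cons_val_one, Matrix.cons_val, Pi.zero_apply,
    map_eq_zero] at h1 h2 h3
  rw [cross_apply, h1, h2, h3]
  ext i; fin_cases i <;> rfl

/-- An `ω`-isotropic pair of vectors in `ℂ³`, independent over `ℂ`. -/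
structure IsIsotropicPair (a b : Fin 3 → ℂ) : Prop where
  im_eq_zero : (hp a b).im = 0
  li : LinearIndependent ℂ ![a, b]

theorem linearIndependent_of_hp {n a b : Fin 3 → ℂ} (ha : a ≠ 0) (hna : hp n a = 0)
    (hnb : hp n b ≠ 0) : LinearIndependent ℂ ![a, b] := by
  rw [LinearIndependent.pair_iff]
  intro s t hst
  have h := congrArg (hp n) hst
  rw [hp_add_right, hp_csmul_right, hp_csmul_right, hna, mul_zero, zero_add] at h
  have ht : t = 0 := by
    have h0 : hp n 0 = 0 := by simp [hp]
    rw [h0] at h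
    exact (mul_eq_zero.1 h).resolve_right hnb
  rw [ht, zero_smul, add_zero] at hst
  exact ⟨(smul_eq_zero.1 hst).resolve_right ha, ht⟩

/-- The part of the second vector orthogonal to the first one, up to a factor. -/
def orthPart (a b : Fin 3 → ℂ) : Fin 3 → ℂ := (hp a a).re • b - (hp a b).re • a

/-- The unitary frame with determinant `1` of an isotropic pair. -/
def frameOf (a b : Fin 3 → ℂ) : Fin 3 → Fin 3 → ℂ :=
  let e₁ := (Real.sqrt (hp a a).re)⁻¹ • a
  let e₂ := (Real.sqrt (hp (orthPart a b) (orthPart a b)).re)⁻¹ • orthPart a b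
  ![e₁, e₂, cc e₁ e₂]

namespace IsIsotropicPair

variable {a b : Fin 3 → ℂ}

theorem left_ne_zero (h : IsIsotropicPair a b) : a ≠ 0 := h.li.ne_zero 0

theorem orthPart_ne_zero (h : IsIsotropicPair a b) : orthPart a b ≠ 0 := by
  intro h0
  have := LinearIndependent.pair_iff.1 h.li (-((hp a b).re : ℂ)) ((hp a a).re : ℂ) (by
    rw [← h0, orthPart]
    ext i; simp; ring)
  have h1 := hp_self_pos h.left_ne_zero
  have h2 : (hp a a).re = 0 := by exact_mod_cast this.2
  exact h1.ne' h2

theorem hp_orthPart (h : IsIsotropicPair a b) : hp a (orthPart a b) = 0 := by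
  rw [orthPart, hp_sub_right, hp_smul_right, hp_smul_right, hp_self_eq_re a]
  have : hp a b = ((hp a b).re : ℂ) := Complex.ext rfl (by simp [h.im_eq_zero])
  rw [this]; simp; ring

theorem hp_normalize {u : Fin 3 → ℂ} (hu : u ≠ 0) :
    hp ((Real.sqrt (hp u u).re)⁻¹ • u) ((Real.sqrt (hp u u).re)⁻¹ • u) = 1 := by
  rw [hp_smul_left, hp_smul_right, hp_self_eq_re]
  have h := hp_self_pos hu
  norm_cast
  have h1 := Real.mul_self_sqrt h.le
  have h2 := (Real.sqrt_pos.2 h).ne'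
  field_simp
  nlinarith

theorem hp_frameOf (h : IsIsotropicPair a b) (i j : Fin 3) :
    hp (frameOf a b i) (frameOf a b j) = if i = j then 1 else 0 := by
  set e₁ := frameOf a b 0
  set e₂ := frameOf a b 1
  have h11 : hp e₁ e₁ = 1 := hp_normalize h.left_ne_zero
  have h22 : hp e₂ e₂ = 1 := hp_normalize h.orthPart_ne_zero
  have h12 : hp e₁ e₂ = 0 := by
    change hp (_ • a) (_ • orthPart a b) = 0
    rw [hp_smul_left, hp_smul_right, h.hp_orthPart]; simp
  have h21 : hp e₂ e₁ = 0 := by rw [← hp_conj, h12, map_zero]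
  have h13 : hp (cc e₁ e₂) e₁ = 0 := hp_cc_left _ _
  have h23 : hp (cc e₁ e₂) e₂ = 0 := hp_cc_right _ _
  have h31 : hp e₁ (cc e₁ e₂) = 0 := by rw [← hp_conj, h13, map_zero]
  have h32 : hp e₂ (cc e₁ e₂) = 0 := by rw [← hp_conj, h23, map_zero]
  have h33 : hp (cc e₁ e₂) (cc e₁ e₂) = 1 := by rw [hp_cc_cc, h11, h22, h12]; simp
  fin_cases i <;> fin_cases j
  exacts [h11, h12, h31, h21, h22, h32, h13, h23, h33]

theorem contDiffAt_frameOf (h : IsIsotropicPair a b) (j : Fin 3) :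
    ContDiffAt ℝ ∞ (fun p : (Fin 3 → ℂ) × (Fin 3 → ℂ) => frameOf p.1 p.2 j) (a, b) := by
  have hn : ∀ {f : (Fin 3 → ℂ) × (Fin 3 → ℂ) → Fin 3 → ℂ}, ContDiffAt ℝ ∞ f (a, b) →
      f (a, b) ≠ 0 →
      ContDiffAt ℝ ∞ (fun p => (Real.sqrt (hp (f p) (f p)).re)⁻¹ • f p) (a, b) := by
    intro f hf h0
    have hpos := hp_self_pos h0
    exact (((contDiffAt_re (contDiffAt_hp hf hf)).sqrt hpos.ne').inv
      (Real.sqrt_pos.2 hpos).ne').smul hf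
  have ho : ContDiffAt ℝ ∞ (fun p : (Fin 3 → ℂ) × (Fin 3 → ℂ) => orthPart p.1 p.2) (a, b) :=
    ((contDiffAt_re (contDiffAt_hp contDiffAt_fst contDiffAt_fst)).smul contDiffAt_snd).sub
      ((contDiffAt_re (contDiffAt_hp contDiffAt_fst contDiffAt_snd)).smul contDiffAt_fst)
  have h1 := hn contDiffAt_fst h.left_ne_zero
  have h2 := hn ho h.orthPart_ne_zero
  fin_cases j
  exacts [h1, h2, contDiffAt_cc h1 h2]

end IsIsotropicPair

/-! ### Smooth curves along a chain of segments -/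

/-- The smooth curve through seven points in time `[0, 1]`, running along segments. -/
def nodePath {X : Type*} [AddCommGroup X] [Module ℝ X] (F : Fin 7 → X) (t : ℝ) : X :=
  F 0 + ∑ k : Fin 6, Real.smoothTransition (6 * t - (k : ℕ)) • (F k.succ - F k.castSucc)

theorem nodePath_eq {X : Type*} [AddCommGroup X] [Module ℝ X] (F : Fin 7 → X) (t : ℝ) :
    nodePath F t = F 0 + Real.smoothTransition (6 * t - 0) • (F 1 - F 0) +
      Real.smoothTransition (6 * t - 1) • (F 2 - F 1) +
      Real.smoothTransition (6 * t - 2) • (F 3 - F 2) +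
      Real.smoothTransition (6 * t - 3) • (F 4 - F 3) +
      Real.smoothTransition (6 * t - 4) • (F 5 - F 4) +
      Real.smoothTransition (6 * t - 5) • (F 6 - F 5) := by
  have : nodePath F t = F 0 + (Real.smoothTransition (6 * t - (0 : ℕ)) • (F 1 - F 0) +
      Real.smoothTransition (6 * t - (1 : ℕ)) • (F 2 - F 1) +
      Real.smoothTransition (6 * t - (2 : ℕ)) • (F 3 - F 2) +
      Real.smoothTransition (6 * t - (3 : ℕ)) • (F 4 - F 3) +
      Real.smoothTransition (6 * t - (4 : ℕ)) • (F 5 - F 4) +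
      Real.smoothTransition (6 * t - (5 : ℕ)) • (F 6 - F 5)) := by
    rw [nodePath, Fin.sum_univ_six]; rfl
  rw [this]
  push_cast
  abel

theorem nodePath_zero {X : Type*} [AddCommGroup X] [Module ℝ X] (F : Fin 7 → X) :
    nodePath F 0 = F 0 := by
  have h : ∀ k : ℝ, 0 ≤ k → Real.smoothTransition (6 * 0 - k) = 0 := fun k hk =>
    Real.smoothTransition.zero_of_nonpos (by linarith)
  rw [nodePath_eq, h 0 (by norm_num), h 1 (by norm_num), h 2 (by norm_num), h 3 (by norm_num),
    h 4 (by norm_num), h 5 (by norm_num)]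
  module

theorem nodePath_one {X : Type*} [AddCommGroup X] [Module ℝ X] (F : Fin 7 → X) :
    nodePath F 1 = F 6 := by
  have h : ∀ k : ℝ, k ≤ 5 → Real.smoothTransition (6 * 1 - k) = 1 := fun k hk =>
    Real.smoothTransition.one_of_one_le (by linarith)
  rw [nodePath_eq, h 0 (by norm_num), h 1 (by norm_num), h 2 (by norm_num), h 3 (by norm_num),
    h 4 (by norm_num), h 5 (by norm_num)]
  module

/-- Between consecutive sixths only one transition function is not constantly 0 or 1, and the
finished ones telescope. No bound on `s` is needed later: the conditions on the segments hold along
the entire lines. -/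
theorem exists_nodePath_eq {X : Type*} [AddCommGroup X] [Module ℝ X] (F : Fin 7 → X) (t : ℝ) :
    ∃ (k : Fin 6) (s : ℝ), nodePath F t = (1 - s) • F k.castSucc + s • F k.succ := by
  have h0 : ∀ k : ℝ, 6 * t ≤ k → Real.smoothTransition (6 * t - k) = 0 := fun k hk =>
    Real.smoothTransition.zero_of_nonpos (by linarith)
  have h1 : ∀ k : ℝ, k + 1 ≤ 6 * t → Real.smoothTransition (6 * t - k) = 1 := fun k hk =>
    Real.smoothTransition.one_of_one_le (by linarith)
  rw [nodePath_eq]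
  rcases le_total (6 * t) 1 with a1 | a1
  · refine ⟨0, Real.smoothTransition (6 * t - 0), ?_⟩
    rw [h0 1 (by linarith), h0 2 (by linarith), h0 3 (by linarith), h0 4 (by linarith),
      h0 5 (by linarith)]
    change _ = (1 - Real.smoothTransition (6 * t - 0)) • F 0 +
      Real.smoothTransition (6 * t - 0) • F 1
    module
  rcases le_total (6 * t) 2 with a2 | a2
  · refine ⟨1, Real.smoothTransition (6 * t - 1), ?_⟩
    rw [h1 0 (by linarith), h0 2 (by linarith), h0 3 (by linarith), h0 4 (by linarith),
      h0 5 (by linarith)]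
    change _ = (1 - Real.smoothTransition (6 * t - 1)) • F 1 +
      Real.smoothTransition (6 * t - 1) • F 2
    module
  rcases le_total (6 * t) 3 with a3 | a3
  · refine ⟨2, Real.smoothTransition (6 * t - 2), ?_⟩
    rw [h1 0 (by linarith), h1 1 (by linarith), h0 3 (by linarith), h0 4 (by linarith),
      h0 5 (by linarith)]
    change _ = (1 - Real.smoothTransition (6 * t - 2)) • F 2 +
      Real.smoothTransition (6 * t - 2) • F 3
    module
  rcases le_total (6 * t) 4 with a4 | a4
  · refine ⟨3, Real.smoothTransition (6 * t - 3), ?_⟩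
    rw [h1 0 (by linarith), h1 1 (by linarith), h1 2 (by linarith), h0 4 (by linarith),
      h0 5 (by linarith)]
    change _ = (1 - Real.smoothTransition (6 * t - 3)) • F 3 +
      Real.smoothTransition (6 * t - 3) • F 4
    module
  rcases le_total (6 * t) 5 with a5 | a5
  · refine ⟨4, Real.smoothTransition (6 * t - 4), ?_⟩
    rw [h1 0 (by linarith), h1 1 (by linarith), h1 2 (by linarith), h1 3 (by linarith),
      h0 5 (by linarith)]
    change _ = (1 - Real.smoothTransition (6 * t - 4)) • F 4 +
      Real.smoothTransition (6 * t - 4) • F 5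
    module
  · refine ⟨5, Real.smoothTransition (6 * t - 5), ?_⟩
    rw [h1 0 (by linarith), h1 1 (by linarith), h1 2 (by linarith), h1 3 (by linarith),
      h1 4 (by linarith)]
    change _ = (1 - Real.smoothTransition (6 * t - 5)) • F 5 +
      Real.smoothTransition (6 * t - 5) • F 6
    module

end UnitaryPath

/-! ### The six segments joining two unitary pairs -/

section NodePath

/-- A Hermitian-orthonormal pair in `ℂ³`. -/
structure IsUnitaryPair (g₁ g₂ : Fin 3 → ℂ) : Prop where
  h11 : hp g₁ g₁ = 1
  h22 : hp g₂ g₂ = 1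
  h12 : hp g₁ g₂ = 0

/-- A real combination of `g₁, g₂` that is `ω`-orthogonal to `p`. -/
def isoComb (g₁ g₂ p : Fin 3 → ℂ) : Fin 3 → ℂ := (hp g₁ p).im • g₂ - (hp g₂ p).im • g₁

/-- The real combination of `g₁, g₂` complementary to `isoComb`. -/
def coComb (g₁ g₂ p : Fin 3 → ℂ) : Fin 3 → ℂ := (hp g₁ p).im • g₁ + (hp g₂ p).im • g₂

/-- The modification of `q` by a complex multiple of `p` that is `ω`-orthogonal to `p`. -/
def isoPart (p q : Fin 3 → ℂ) : Fin 3 → ℂ := q - ((hp p q).im / (hp p p).re) • Complex.I • p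

theorem isoPart_im {p : Fin 3 → ℂ} (hp0 : p ≠ 0) (q : Fin 3 → ℂ) : (hp p (isoPart p q)).im = 0 := by
  have h := (hp_self_pos hp0).ne'
  rw [isoPart, hp_sub_right, hp_smul_right, hp_csmul_right, hp_self_eq_re, Complex.sub_im,
    Complex.im_ofReal_mul]
  simp
  field_simp
  ring

/-- Only a multiple of p is subtracted, so a genericity condition on q expressed through a vector
Hermitian-orthogonal to p survives the correction. -/
theorem hp_isoPart {n p : Fin 3 → ℂ} (h : hp n p = 0) (q : Fin 3 → ℂ) :
    hp n (isoPart p q) = hp n q := by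
  rw [isoPart, hp_sub_right, hp_smul_right, hp_csmul_right, h]; simp

namespace IsUnitaryPair

variable {g₁ g₂ : Fin 3 → ℂ} (hg : IsUnitaryPair g₁ g₂) {p : Fin 3 → ℂ}
include hg

theorem h21 : hp g₂ g₁ = 0 := by rw [← hp_conj, hg.h12, map_zero]

theorem hp_coComb (u : Fin 3 → ℂ) :
    hp (coComb g₁ g₂ p) u = (hp g₁ p).im * hp g₁ u + (hp g₂ p).im * hp g₂ u := by
  rw [coComb, hp_add_left, hp_smul_left, hp_smul_left]

theorem hp_isoComb (u : Fin 3 → ℂ) :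
    hp (isoComb g₁ g₂ p) u = (hp g₁ p).im * hp g₂ u - (hp g₂ p).im * hp g₁ u := by
  rw [isoComb, sub_eq_add_neg, ← neg_smul, hp_add_left, hp_smul_left, hp_smul_left]
  push_cast; ring

theorem hp_coComb_coComb : hp (coComb g₁ g₂ p) (coComb g₁ g₂ p) =
    (((hp g₁ p).im ^ 2 + (hp g₂ p).im ^ 2 : ℝ) : ℂ) := by
  rw [hg.hp_coComb]
  simp only [coComb, hp_add_right, hp_smul_right, hg.h11, hg.h12, hg.h21, hg.h22]
  push_cast; ring

theorem hp_coComb_isoComb : hp (coComb g₁ g₂ p) (isoComb g₁ g₂ p) = 0 := by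
  rw [hg.hp_coComb]
  simp only [isoComb, hp_sub_right, hp_smul_right, hg.h11, hg.h12, hg.h21, hg.h22]
  ring

theorem hp_isoComb_coComb : hp (isoComb g₁ g₂ p) (coComb g₁ g₂ p) = 0 := by
  rw [← hp_conj, hg.hp_coComb_isoComb, map_zero]

theorem hp_coComb_im : (hp (coComb g₁ g₂ p) p).im = (hp g₁ p).im ^ 2 + (hp g₂ p).im ^ 2 := by
  rw [hg.hp_coComb, Complex.add_im, Complex.im_ofReal_mul, Complex.im_ofReal_mul]; ring

theorem hp_isoComb_im : (hp (isoComb g₁ g₂ p) p).im = 0 := by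
  rw [hg.hp_isoComb, Complex.sub_im, Complex.im_ofReal_mul, Complex.im_ofReal_mul]; ring

variable (h : ¬((hp g₁ p).im = 0 ∧ (hp g₂ p).im = 0))
include h

theorem sq_pos : 0 < (hp g₁ p).im ^ 2 + (hp g₂ p).im ^ 2 := by
  by_contra hn
  apply h
  have h1 := sq_nonneg (hp g₁ p).im
  have h2 := sq_nonneg (hp g₂ p).im
  exact ⟨pow_eq_zero_iff two_ne_zero |>.1 (by linarith),
    pow_eq_zero_iff two_ne_zero |>.1 (by linarith)⟩

theorem isoComb_ne_zero : isoComb g₁ g₂ p ≠ 0 := by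
  intro h0
  have h1 : hp (isoComb g₁ g₂ p) g₁ = -(hp g₂ p).im := by
    rw [hg.hp_isoComb, hg.h21, hg.h11]; ring
  have h2 : hp (isoComb g₁ g₂ p) g₂ = (hp g₁ p).im := by
    rw [hg.hp_isoComb, hg.h22, hg.h12]; ring
  have hz : ∀ u, hp 0 u = 0 := fun u => by simp [hp]
  rw [h0, hz] at h1 h2
  exact h ⟨by exact_mod_cast h2.symm, neg_eq_zero.1 (by exact_mod_cast h1.symm)⟩

theorem isIsotropicPair_isoComb {u : Fin 3 → ℂ} (hu : (hp (isoComb g₁ g₂ p) u).im = 0)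
    (hu' : hp (coComb g₁ g₂ p) u ≠ 0) : IsIsotropicPair (isoComb g₁ g₂ p) u :=
  ⟨hu, linearIndependent_of_hp (hg.isoComb_ne_zero h) hg.hp_coComb_isoComb hu'⟩

/-- The pairs `(isoComb, λ coComb + μ p)` are isotropic. -/
theorem isIsotropicPair_comb {l m : ℝ} (hlm : ¬(l = 0 ∧ m = 0)) :
    IsIsotropicPair (isoComb g₁ g₂ p) (l • coComb g₁ g₂ p + m • p) := by
  refine hg.isIsotropicPair_isoComb h ?_ ?_
  · rw [hp_add_right, hp_smul_right, hp_smul_right, hg.hp_isoComb_coComb, Complex.add_im,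
      Complex.im_ofReal_mul, Complex.im_ofReal_mul, hg.hp_isoComb_im]
    simp
  · rw [hp_add_right, hp_smul_right, hp_smul_right, hg.hp_coComb_coComb]
    intro h0
    have hs := (hg.sq_pos h).ne'
    -- The term with `l` is real and ω(`coComb`, p) equals the positive sum of squares, so the
    -- imaginary part forces m = 0 and then the real equation forces l = 0.
    have hi := congrArg Complex.im h0
    rw [Complex.add_im, Complex.im_ofReal_mul, Complex.im_ofReal_mul, hg.hp_coComb_im,
      Complex.ofReal_im, mul_zero, zero_add, Complex.zero_im] at hi
    have hm : m = 0 := (mul_eq_zero.1 hi).resolve_right hs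
    rw [hm, Complex.ofReal_zero, zero_mul, add_zero] at h0
    have hl : l * ((hp g₁ p).im ^ 2 + (hp g₂ p).im ^ 2) = 0 := by exact_mod_cast h0
    exact hlm ⟨(mul_eq_zero.1 hl).resolve_right hs, hm⟩

end IsUnitaryPair

namespace IsIsotropicPair

variable {a b q : Fin 3 → ℂ}

/-- This is a real change of basis of determinant (1 − s)² + s² > 0, so the real span of the pair is
unchanged. It serves to exchange the roles of the two vectors. -/
theorem rotate (h : IsIsotropicPair a b) (s : ℝ) :
    IsIsotropicPair ((1 - s) • a + s • b) ((1 - s) • b + s • -a) := by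
  refine ⟨?_, ?_⟩
  · have hba : (hp b a).im = 0 := by rw [← hp_conj, Complex.conj_im, h.im_eq_zero, neg_zero]
    have haa : (hp a a).im = 0 := by rw [hp_self, Complex.ofReal_im]
    have hbb : (hp b b).im = 0 := by rw [hp_self, Complex.ofReal_im]
    simp only [hp_add_left, hp_add_right, hp_smul_left, hp_smul_right, hp_neg_right,
      Complex.add_im, Complex.im_ofReal_mul, Complex.neg_im, hba, haa, hbb, h.im_eq_zero]
    ring
  · rw [LinearIndependent.pair_iff]
    intro x y hxy
    have h1 := LinearIndependent.pair_iff.1 h.li (x * (1 - s) - y * s) (x * s + y * (1 - s)) (by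
      rw [← hxy]
      ext i; simp; ring)
    have hs : (((1 - s) ^ 2 + s ^ 2 : ℝ) : ℂ) ≠ 0 := by
      have : 0 < (1 - s) ^ 2 + s ^ 2 := by nlinarith [sq_nonneg (1 - 2 * s)]
      exact_mod_cast this.ne'
    push_cast at hs
    constructor
    · refine (mul_eq_zero.1 (?_ : x * ((1 - (s : ℂ)) ^ 2 + (s : ℂ) ^ 2) = 0)).resolve_right hs
      linear_combination (1 - (s : ℂ)) * h1.1 + s * h1.2
    · refine (mul_eq_zero.1 (?_ : y * ((1 - (s : ℂ)) ^ 2 + (s : ℂ) ^ 2) = 0)).resolve_right hs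
      linear_combination -(s : ℂ) * h1.1 + (1 - s) * h1.2

theorem swap (h : IsIsotropicPair a b) : IsIsotropicPair b a :=
  ⟨by rw [← hp_conj, Complex.conj_im, h.im_eq_zero, neg_zero], LinearIndependent.pair_symm_iff.1 h.li⟩

/-- Moving the second vector of an isotropic pair in a generic isotropic direction. -/
theorem comb (h : IsIsotropicPair a b) (hq : (hp a q).im = 0) (hq' : hp (cc a b) q ≠ 0) {l m : ℝ}
    (hlm : ¬(l = 0 ∧ m = 0)) : IsIsotropicPair a (l • b + m • q) := by
  refine ⟨?_, ?_⟩
  · rw [hp_add_right, hp_smul_right, hp_smul_right, Complex.add_im, Complex.im_ofReal_mul,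
      Complex.im_ofReal_mul, h.im_eq_zero, hq]
    simp
  · by_cases hm : m = 0
    · have hl : (l : ℂ) ≠ 0 := by exact_mod_cast fun hl => hlm ⟨hl, hm⟩
      rw [LinearIndependent.pair_iff]
      intro x y hxy
      have h1 := LinearIndependent.pair_iff.1 h.li x (y * l) (by
        rw [← hxy, hm]; ext i; simp; ring)
      exact ⟨h1.1, (mul_eq_zero.1 h1.2).resolve_right hl⟩
    · refine linearIndependent_of_hp h.left_ne_zero (hp_cc_left a b) ?_
      rw [hp_add_right, hp_smul_right, hp_smul_right, hp_cc_right, mul_zero, zero_add]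
      exact mul_ne_zero (by exact_mod_cast hm) hq'

end IsIsotropicPair

/-- The pairs joined by segments on the way from the plane of `(g₁, g₂)` to that of `(k₁, k₂)`. -/
def nodes (g₁ g₂ k₁ k₂ p q : Fin 3 → ℂ) : Fin 7 → (Fin 3 → ℂ) × (Fin 3 → ℂ) :=
  ![(isoComb g₁ g₂ p, coComb g₁ g₂ p), (isoComb g₁ g₂ p, p), (p, -isoComb g₁ g₂ p),
    (p, q), (p, isoComb k₁ k₂ p), (isoComb k₁ k₂ p, -p), (isoComb k₁ k₂ p, coComb k₁ k₂ p)]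

theorem one_sub_smul_add_smul_self {X : Type*} [AddCommGroup X] [Module ℝ X] (s : ℝ) (x : X) :
    (1 - s) • x + s • x = x := by module

/-- Since `isoComb` is ω-orthogonal to p, the partner `coComb` can be replaced by p. Rotation puts p
first; with p held fixed, the second vector passes from the g-side to the k-side through q, whose
independence from p and each `isoComb` keeps the pair nondegenerate. The last two segments mirror
the first two. -/
theorem isIsotropicPair_nodePath {g₁ g₂ k₁ k₂ p q : Fin 3 → ℂ} (hg : IsUnitaryPair g₁ g₂)
    (hk : IsUnitaryPair k₁ k₂) (hgp : ¬((hp g₁ p).im = 0 ∧ (hp g₂ p).im = 0))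
    (hkp : ¬((hp k₁ p).im = 0 ∧ (hp k₂ p).im = 0)) (hq : (hp p q).im = 0)
    (hgq : hp (cc p (isoComb g₁ g₂ p)) q ≠ 0) (hkq : hp (cc p (isoComb k₁ k₂ p)) q ≠ 0) (t : ℝ) :
    IsIsotropicPair (nodePath (nodes g₁ g₂ k₁ k₂ p q) t).1
      (nodePath (nodes g₁ g₂ k₁ k₂ p q) t).2 := by
  obtain ⟨k, s, hs⟩ := exists_nodePath_eq (nodes g₁ g₂ k₁ k₂ p q) t
  have hgv : IsIsotropicPair (isoComb g₁ g₂ p) p := by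
    simpa using hg.isIsotropicPair_comb hgp (l := 0) (m := 1) (by simp)
  have hkv : IsIsotropicPair (isoComb k₁ k₂ p) p := by
    simpa using hk.isIsotropicPair_comb hkp (l := 0) (m := 1) (by simp)
  have hs1 : ¬(1 - s = 0 ∧ s = 0) := by rintro ⟨h1, h2⟩; linarith
  rw [hs]
  fin_cases k
  · have := hg.isIsotropicPair_comb hgp hs1
    change IsIsotropicPair ((1 - s) • isoComb g₁ g₂ p + s • isoComb g₁ g₂ p)
      ((1 - s) • coComb g₁ g₂ p + s • p)
    rwa [one_sub_smul_add_smul_self]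
  · exact hgv.rotate s
  · have := hgv.swap.comb hq hgq (l := -(1 - s)) (m := s) (by rintro ⟨h1, h2⟩; linarith)
    change IsIsotropicPair ((1 - s) • p + s • p) ((1 - s) • -isoComb g₁ g₂ p + s • q)
    rwa [one_sub_smul_add_smul_self, smul_neg, ← neg_smul]
  · have := hkv.swap.comb hq hkq (l := s) (m := 1 - s) (by rintro ⟨h1, h2⟩; linarith)
    change IsIsotropicPair ((1 - s) • p + s • p) ((1 - s) • q + s • isoComb k₁ k₂ p)
    rwa [one_sub_smul_add_smul_self, add_comm]
  · exact hkv.swap.rotate s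
  · have := hk.isIsotropicPair_comb hkp (l := s) (m := -(1 - s))
      (by rintro ⟨h1, h2⟩; linarith)
    change IsIsotropicPair ((1 - s) • isoComb k₁ k₂ p + s • isoComb k₁ k₂ p)
      ((1 - s) • -p + s • coComb k₁ k₂ p)
    rwa [one_sub_smul_add_smul_self, smul_neg, ← neg_smul, add_comm]

end NodePath

/-! ### Generic constants and the path of unitary frames -/

section GeneralPosition

variable {Z : Type*} [TopologicalSpace Z] [CompactSpace Z]
  [ChartedSpace (EuclideanSpace ℝ (Fin 1)) Z] [IsManifold (𝓡 1) ∞ Z]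

theorem finrank_complex_three : finrank ℝ (Fin 3 → ℂ) = 6 := by
  rw [finrank_real_of_complex, finrank_fin_fun]

/-- Pairing with a vector as an element of the real dual, smooth in the vector. -/
def hpCLM (u : Fin 3 → ℂ) : (Fin 3 → ℂ) →L[ℝ] ℂ :=
  LinearMap.toContinuousLinearMap
    { toFun := hp u
      map_add' := hp_add_right u
      map_smul' := fun r v => by rw [hp_smul_right]; simp }

theorem hpCLM_apply (u v : Fin 3 → ℂ) : hpCLM u v = hp u v := rfl

theorem contDiff_hpCLM : ContDiff ℝ ∞ hpCLM :=
  contDiff_clm_apply_iff.2 fun _ => contDiff_iff_contDiffAt.2 fun _ =>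
    contDiffAt_hp contDiffAt_id contDiffAt_const

/-- A nonzero complex functional maps onto ℂ, so each condition has real codimension 2, of which the
base uses up one. -/
theorem dimH_iUnion_hp_eq_zero {n : Z → Fin 3 → ℂ} (hn : ContMDiff (𝓡 1) 𝓘(ℝ, Fin 3 → ℂ) ∞ n)
    (h0 : ∀ z, n z ≠ 0) :
    dimH (⋃ z, {q | hp (n z) q = 0}) ≤ ((finrank ℝ (Fin 3 → ℂ) - 1 : ℕ) : ENNReal) := by
  refine dimH_iUnion_lt _ fun z₀ => ⟨univ, isOpen_univ, mem_univ _, fun z => hpCLM (n z),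
    (contDiff_hpCLM.contMDiff.comp hn).contMDiffOn, fun c => ?_, fun z _ q hq => hq⟩
  have h1 : hp (n z₀) (n z₀) ≠ 0 := fun h => (hp_self_pos (h0 z₀)).ne' (by rw [h]; rfl)
  refine ⟨(c / hp (n z₀) (n z₀)) • n z₀, ?_⟩
  rw [hpCLM_apply, hp_csmul_right, div_mul_cancel₀ _ h1]

theorem dimH_iUnion_im_eq_zero {g₁ g₂ : Z → Fin 3 → ℂ}
    (hg₁ : ContMDiff (𝓡 1) 𝓘(ℝ, Fin 3 → ℂ) ∞ g₁) (hg₂ : ContMDiff (𝓡 1) 𝓘(ℝ, Fin 3 → ℂ) ∞ g₂)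
    (hg : ∀ z, IsUnitaryPair (g₁ z) (g₂ z)) :
    dimH (⋃ z, {p | (hp (g₁ z) p).im = 0 ∧ (hp (g₂ z) p).im = 0}) ≤
      ((finrank ℝ (Fin 3 → ℂ) - 1 : ℕ) : ENNReal) := by
  let A : ((Fin 3 → ℂ) →L[ℝ] ℂ) →L[ℝ] (Fin 3 → ℂ) →L[ℝ] ℂ :=
    ContinuousLinearMap.compL ℝ (Fin 3 → ℂ) ℂ ℂ (Complex.ofRealCLM.comp Complex.imCLM)
  let B : ((Fin 3 → ℂ) →L[ℝ] ℂ) →L[ℝ] (Fin 3 → ℂ) →L[ℝ] ℂ :=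
    ContinuousLinearMap.compL ℝ (Fin 3 → ℂ) ℂ ℂ (Complex.imCLM.smulRight Complex.I)
  have hval : ∀ z p, (A (hpCLM (g₁ z)) + B (hpCLM (g₂ z))) p =
      (hp (g₁ z) p).im + (hp (g₂ z) p).im * Complex.I := fun z p => by
    simp [A, B, hpCLM_apply]
  refine dimH_iUnion_lt _ fun z₀ => ⟨univ, isOpen_univ, mem_univ _,
    fun z => A (hpCLM (g₁ z)) + B (hpCLM (g₂ z)), ?_, fun c => ?_, fun z _ q hq => ?_⟩
  · exact ((A.contMDiff.comp (contDiff_hpCLM.contMDiff.comp hg₁)).add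
      (B.contMDiff.comp (contDiff_hpCLM.contMDiff.comp hg₂))).contMDiffOn
  -- By orthonormality the Hermitian products of this vector with g₁ and g₂ are `c.re * I` and `c.im
  -- * I`, whose imaginary parts are the two prescribed values.
  · refine ⟨(c.re * Complex.I) • g₁ z₀ + (c.im * Complex.I) • g₂ z₀, ?_⟩
    have hz := hg z₀
    rw [hval]
    simp only [hp_add_right, hp_csmul_right, hz.h11, hz.h12, hz.h21, hz.h22]
    simp
  · rw [hval, hq.1, hq.2]; simp

/-- Any two smooth families of orthonormal pairs are joined by a smooth family of paths of
unitary frames, up to real base changes at the ends. -/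
theorem exists_frame_path {g₁ g₂ k₁ k₂ : Z → Fin 3 → ℂ}
    (hg₁ : ContMDiff (𝓡 1) 𝓘(ℝ, Fin 3 → ℂ) ∞ g₁) (hg₂ : ContMDiff (𝓡 1) 𝓘(ℝ, Fin 3 → ℂ) ∞ g₂)
    (hk₁ : ContMDiff (𝓡 1) 𝓘(ℝ, Fin 3 → ℂ) ∞ k₁) (hk₂ : ContMDiff (𝓡 1) 𝓘(ℝ, Fin 3 → ℂ) ∞ k₂)
    (hg : ∀ z, IsUnitaryPair (g₁ z) (g₂ z)) (hk : ∀ z, IsUnitaryPair (k₁ z) (k₂ z)) :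
    ∃ m : Fin 3 → Z × ℝ → Fin 3 → ℂ,
      (∀ j, ContMDiff ((𝓡 1).prod 𝓘(ℝ, ℝ)) 𝓘(ℝ, Fin 3 → ℂ) ∞ (m j)) ∧
      (∀ x i j, hp (m i x) (m j x) = if i = j then 1 else 0) ∧
      (∀ x, m 2 x = cc (m 0 x) (m 1 x)) ∧
      (∀ z, ∀ j : Fin 2, ∃ r s : ℝ, m j.castSucc (z, 0) = r • g₁ z + s • g₂ z) ∧
      (∀ z, ∀ j : Fin 2, ∃ r s : ℝ, m j.castSucc (z, 1) = r • k₁ z + s • k₂ z) := by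
  have h6 : 0 < finrank ℝ (Fin 3 → ℂ) := by rw [finrank_complex_three]; norm_num
  -- One constant p is ω-orthogonal to neither of the real planes spanned by g₁, g₂ and by k₁, k₂,
  -- over any point of the base.
  obtain ⟨p, hpp⟩ := exists_forall_notMem_of_dimH_le h6 (dimH_iUnion_im_eq_zero hg₁ hg₂ hg)
    (dimH_iUnion_im_eq_zero hk₁ hk₂ hk)
  have hiso : ∀ {a b : Z → Fin 3 → ℂ}, ContMDiff (𝓡 1) 𝓘(ℝ, Fin 3 → ℂ) ∞ a →
      ContMDiff (𝓡 1) 𝓘(ℝ, Fin 3 → ℂ) ∞ b → ∀ {f : (Fin 3 → ℂ) × (Fin 3 → ℂ) → Fin 3 → ℂ},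
      ContDiff ℝ ∞ f → ContMDiff (𝓡 1) 𝓘(ℝ, Fin 3 → ℂ) ∞ fun z => f (a z, b z) :=
    fun ha hb f hf => hf.contMDiff.comp (ha.prodMk_space hb)
  have him : ∀ {f : (Fin 3 → ℂ) × (Fin 3 → ℂ) → Fin 3 → ℂ}, (∀ x, ContDiffAt ℝ ∞ f x) → ∀ x,
      ContDiffAt ℝ ∞ (fun y => (hp (f y) p).im) x := fun hf x =>
    contDiffAt_im (contDiffAt_hp (hf x) contDiffAt_const)
  have hiC : ContDiff ℝ ∞ fun x : (Fin 3 → ℂ) × (Fin 3 → ℂ) => isoComb x.1 x.2 p :=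
    contDiff_iff_contDiffAt.2 fun x =>
      ((him (fun _ => contDiffAt_fst) x).smul contDiffAt_snd).sub
        ((him (fun _ => contDiffAt_snd) x).smul contDiffAt_fst)
  have hcC : ContDiff ℝ ∞ fun x : (Fin 3 → ℂ) × (Fin 3 → ℂ) => coComb x.1 x.2 p :=
    contDiff_iff_contDiffAt.2 fun x =>
      ((him (fun _ => contDiffAt_fst) x).smul contDiffAt_fst).add
        ((him (fun _ => contDiffAt_snd) x).smul contDiffAt_snd)
  have hccC : ContDiff ℝ ∞ fun x : (Fin 3 → ℂ) × (Fin 3 → ℂ) => cc p (isoComb x.1 x.2 p) :=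
    contDiff_iff_contDiffAt.2 fun x => contDiffAt_cc contDiffAt_const hiC.contDiffAt
  have hv : ∀ {a b : Z → Fin 3 → ℂ} z, IsUnitaryPair (a z) (b z) →
      ¬((hp (a z) p).im = 0 ∧ (hp (b z) p).im = 0) → IsIsotropicPair (isoComb (a z) (b z) p) p := by
    intro a b z h h'
    simpa using h.isIsotropicPair_comb h' (l := 0) (m := 1) (by simp)
  -- One constant q is independent over ℂ of p and `isoComb` for both families at once; `isoPart`
  -- then makes it ω-orthogonal to p.
  obtain ⟨q, hq⟩ := exists_forall_notMem_of_dimH_le h6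
    (dimH_iUnion_hp_eq_zero (hiso hg₁ hg₂ hccC)
      fun z => cc_ne_zero (hv z (hg z) (hpp z).1).swap.li)
    (dimH_iUnion_hp_eq_zero (hiso hk₁ hk₂ hccC)
      fun z => cc_ne_zero (hv z (hk z) (hpp z).2).swap.li)
  let F : Z → Fin 7 → (Fin 3 → ℂ) × (Fin 3 → ℂ) := fun z =>
    nodes (g₁ z) (g₂ z) (k₁ z) (k₂ z) p (isoPart p q)
  have hF : ∀ k, ContMDiff (𝓡 1) 𝓘(ℝ, (Fin 3 → ℂ) × (Fin 3 → ℂ)) ∞ fun z => F z k := by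
    intro k
    have c₁ := hiso hg₁ hg₂ hiC
    have c₂ := hiso hk₁ hk₂ hiC
    fin_cases k
    · exact c₁.prodMk_space (hiso hg₁ hg₂ hcC)
    · exact c₁.prodMk_space contMDiff_const
    · exact contMDiff_const.prodMk_space c₁.neg
    · exact contMDiff_const
    · exact contMDiff_const.prodMk_space c₂
    · exact c₂.prodMk_space contMDiff_const
    · exact c₂.prodMk_space (hiso hk₁ hk₂ hcC)
  let P : Z × ℝ → (Fin 3 → ℂ) × (Fin 3 → ℂ) := fun x => nodePath (F x.1) x.2
  have hP : ContMDiff ((𝓡 1).prod 𝓘(ℝ, ℝ)) 𝓘(ℝ, (Fin 3 → ℂ) × (Fin 3 → ℂ)) ∞ P := by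
    refine ((hF 0).comp contMDiff_fst).add (ContMDiff.sum fun k _ => ?_)
    have h1 : ContDiff ℝ ∞ fun t : ℝ => Real.smoothTransition (6 * t - (k : ℕ)) :=
      Real.smoothTransition.contDiff.comp (by fun_prop)
    have h2 : ContMDiff ((𝓡 1).prod 𝓘(ℝ, ℝ)) 𝓘(ℝ, ℝ) ∞
        fun x : Z × ℝ => Real.smoothTransition (6 * x.2 - (k : ℕ)) :=
      h1.contMDiff.comp contMDiff_snd
    have h3 : ContMDiff ((𝓡 1).prod 𝓘(ℝ, ℝ)) 𝓘(ℝ, (Fin 3 → ℂ) × (Fin 3 → ℂ)) ∞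
        fun x : Z × ℝ => F x.1 k.succ - F x.1 k.castSucc :=
      ((hF k.succ).comp contMDiff_fst).sub ((hF k.castSucc).comp contMDiff_fst)
    exact h2.smul h3
  have hiP : ∀ x, IsIsotropicPair (P x).1 (P x).2 := by
    rintro ⟨z, t⟩
    have hgv := hv z (hg z) (hpp z).1
    refine isIsotropicPair_nodePath (hg z) (hk z) (hpp z).1 (hpp z).2
      (isoPart_im hgv.swap.left_ne_zero q) ?_ ?_ t
    · rw [hp_isoPart (hp_cc_left _ _)]; exact (hq z).1
    · rw [hp_isoPart (hp_cc_left _ _)]; exact (hq z).2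
  -- At the ends the pair spans the real plane of the given orthonormal pair, and orthonormalization
  -- uses only real coefficients.
  have hend : ∀ {a b : Fin 3 → ℂ} (j : Fin 2), ∃ r s : ℝ,
      frameOf (isoComb a b p) (coComb a b p) j.castSucc = r • a + s • b := by
    intro a b j
    have h1 : ∃ r s : ℝ, isoComb a b p = r • a + s • b :=
      ⟨-(hp b p).im, (hp a p).im, by rw [isoComb]; module⟩
    have h2 : ∃ r s : ℝ, coComb a b p = r • a + s • b := ⟨_, _, rfl⟩
    obtain ⟨r, s, h1⟩ := h1
    obtain ⟨r', s', h2⟩ := h2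
    fin_cases j
    · refine ⟨(Real.sqrt (hp (isoComb a b p) (isoComb a b p)).re)⁻¹ * r,
        (Real.sqrt (hp (isoComb a b p) (isoComb a b p)).re)⁻¹ * s, ?_⟩
      change (Real.sqrt (hp (isoComb a b p) (isoComb a b p)).re)⁻¹ • isoComb a b p = _
      generalize (Real.sqrt (hp (isoComb a b p) (isoComb a b p)).re)⁻¹ = c
      rw [h1]; module
    · have h3 : ∃ c x y : ℝ, frameOf (isoComb a b p) (coComb a b p) 1 =
          c • (x • coComb a b p - y • isoComb a b p) := ⟨_, _, _, rfl⟩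
      obtain ⟨c, x, y, h3⟩ := h3
      refine ⟨c * (x * r' - y * r), c * (x * s' - y * s), ?_⟩
      change frameOf (isoComb a b p) (coComb a b p) 1 = _
      rw [h3, h1, h2]; module
  refine ⟨fun j x => frameOf (P x).1 (P x).2 j, fun j x => ?_, fun x => (hiP x).hp_frameOf,
    fun x => rfl, fun z j => ?_, fun z j => ?_⟩
  · exact ((hiP x).contDiffAt_frameOf j).contMDiffAt.comp x (hP x)
  · have : P (z, 0) = F z 0 := nodePath_zero (F z)
    simp only [this]
    exact hend j
  · have : P (z, 1) = F z 6 := nodePath_one (F z)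
    simp only [this]
    exact hend j

end GeneralPosition

/-! ### The Lorentzian form `e₂` on symmetric 3 × 3 matrices -/

section SymmetricMatrices

/-- The second elementary symmetric function of the eigenvalues of a symmetric `3 × 3` matrix. -/
def e₂ (A : Matrix (Fin 3) (Fin 3) ℝ) : ℝ :=
  A 0 0 * A 1 1 + A 0 0 * A 2 2 + A 1 1 * A 2 2 - A 0 1 * A 1 0 - A 0 2 * A 2 0 - A 1 2 * A 2 1

/-- The matrix `A + i r`. -/
def addI (A : Matrix (Fin 3) (Fin 3) ℝ) (r : ℝ) : Matrix (Fin 3) (Fin 3) ℂ :=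
  fun j k => (A j k : ℂ) + if j = k then (r : ℂ) * Complex.I else 0

/-- For r ≠ 0 the imaginary part vanishes exactly when e₂(A) = r², the special Lagrangian equation
for graphs; at r = 1 the real part det A − tr A carries the sign of the pair. -/
theorem det_addI (A : Matrix (Fin 3) (Fin 3) ℝ) (r : ℝ) : (addI A r).det =
    ((A.det - r ^ 2 * A.trace : ℝ) : ℂ) + ((r * (e₂ A - r ^ 2) : ℝ) : ℂ) * Complex.I := by
  rw [Matrix.det_fin_three, Matrix.det_fin_three, Matrix.trace_fin_three, e₂]
  simp only [addI, Fin.isValue, ↓reduceIte, Fin.reduceEq, add_zero]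
  have hI : Complex.I ^ 2 = -1 := Complex.I_sq
  have hI3 : Complex.I ^ 3 = -Complex.I := by rw [pow_succ, hI]; ring
  push_cast
  ring_nf
  rw [hI, hI3]
  ring

/-- For symmetric A, (tr A)² − 3 e₂(A) is a sum of squares of the off-diagonal entries and of the
differences of diagonal entries, with positive coefficients. -/
theorem three_le_trace_sq {A : Matrix (Fin 3) (Fin 3) ℝ} (hA : A.IsSymm) (h : e₂ A = 1) :
    3 ≤ A.trace ^ 2 := by
  have h01 := hA.apply 0 1
  have h02 := hA.apply 0 2
  have h12 := hA.apply 1 2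
  rw [e₂, h01, h02, h12] at h
  rw [Matrix.trace_fin_three]
  nlinarith [sq_nonneg (A 0 0 - A 1 1), sq_nonneg (A 0 0 - A 2 2), sq_nonneg (A 1 1 - A 2 2),
    sq_nonneg (A 0 1), sq_nonneg (A 0 2), sq_nonneg (A 1 2)]

/-- Newton's inequality for the eigenvalues of a symmetric matrix. -/
theorem three_mul_det_mul_trace_le {A : Matrix (Fin 3) (Fin 3) ℝ} (hA : A.IsSymm) :
    3 * (A.det * A.trace) ≤ e₂ A ^ 2 := by
  have h01 := hA.apply 0 1
  have h02 := hA.apply 0 2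
  have h12 := hA.apply 1 2
  rw [Matrix.det_fin_three, Matrix.trace_fin_three, e₂, h01, h02, h12]
  generalize A 0 0 = a
  generalize A 1 1 = b
  generalize A 2 2 = c
  generalize A 0 1 = d
  generalize A 0 2 = e
  generalize A 1 2 = f
  -- This is (tr C)² ≥ 3 e₂(C) for the adjugate C of A, as tr C = e₂(A) and e₂(C) = det A · tr A;
  -- the squares are formed from the cofactors.
  nlinarith [sq_nonneg ((b * c - f * f) - (a * c - e * e)),
    sq_nonneg ((b * c - f * f) - (a * b - d * d)), sq_nonneg ((a * c - e * e) - (a * b - d * d)),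
    sq_nonneg (d * c - e * f), sq_nonneg (d * f - b * e), sq_nonneg (a * f - d * e)]

/-- The two preceding bounds give det A · tr A − (tr A)² ≤ 1/3 − 3. So det A − tr A has the sign
opposite to the trace, and it detects the sheet of the hyperboloid. -/
theorem det_sub_trace_mul_trace_neg {A : Matrix (Fin 3) (Fin 3) ℝ} (hA : A.IsSymm) (h : e₂ A = 1) :
    (A.det - A.trace) * A.trace < 0 := by
  have h1 := three_le_trace_sq hA h
  have h2 := three_mul_det_mul_trace_le hA
  rw [h] at h2
  nlinarith

/-- The traceless part of a matrix. -/
def traceless (A : Matrix (Fin 3) (Fin 3) ℝ) (x : Fin 3 × Fin 3) : ℝ :=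
  A x.1 x.2 - if x.1 = x.2 then A.trace / 3 else 0

/-- The segment between two symmetric matrices on one sheet of the hyperboloid `e₂ = 1` stays in
the cone `0 < e₂`. -/
theorem e₂_segment_pos {A B : Matrix (Fin 3) (Fin 3) ℝ} (hA : A.IsSymm) (hB : B.IsSymm)
    (hA1 : e₂ A = 1) (hB1 : e₂ B = 1) (hAB : 0 < A.det - A.trace ↔ 0 < B.det - B.trace)
    {s : ℝ} (hs : 0 ≤ s) (hs1 : s ≤ 1) : 0 < e₂ ((1 - s) • A + s • B) := by
  have ha := det_sub_trace_mul_trace_neg hA hA1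
  have hb := det_sub_trace_mul_trace_neg hB hB1
  have hpos : 0 < A.trace * B.trace := by
    rcases lt_trichotomy 0 (A.det - A.trace) with h | h | h
    · have h' := hAB.1 h
      exact mul_pos_of_neg_of_neg (by by_contra! hn; nlinarith) (by by_contra! hn; nlinarith)
    · rw [← h] at ha; simp at ha
    · have h' : B.det - B.trace < 0 := by
        rcases lt_trichotomy 0 (B.det - B.trace) with h' | h' | h'
        · exact absurd (hAB.2 h') h.not_gt
        · rw [← h'] at hb; simp at hb
        · exact h'
      exact mul_pos (by by_contra! hn; nlinarith) (by by_contra! hn; nlinarith)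
  have ta := three_le_trace_sq hA hA1
  have tb := three_le_trace_sq hB hB1
  -- With A₀ the traceless part, e₂(A) = (tr A)²/3 − |A₀|²/2. Cauchy–Schwarz for the traceless parts
  -- yields the reversed inequality: the mixed term is nonnegative when both traces have the same
  -- sign.
  have hcs := Finset.sum_mul_sq_le_sq_mul_sq Finset.univ (traceless A) (traceless B)
  have ea : ∑ x, traceless A x ^ 2 = 2 * (A.trace ^ 2 / 3 - 1) := by
    rw [← hA1, Fintype.sum_prod_type]
    simp only [Fin.sum_univ_three, traceless, e₂, Matrix.trace_fin_three, hA.apply 0 1,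
      hA.apply 0 2, hA.apply 1 2, Fin.isValue, ↓reduceIte, Fin.reduceEq, sub_zero]
    ring
  have eb : ∑ x, traceless B x ^ 2 = 2 * (B.trace ^ 2 / 3 - 1) := by
    rw [← hB1, Fintype.sum_prod_type]
    simp only [Fin.sum_univ_three, traceless, e₂, Matrix.trace_fin_three, hB.apply 0 1,
      hB.apply 0 2, hB.apply 1 2, Fin.isValue, ↓reduceIte, Fin.reduceEq, sub_zero]
    ring
  set x := ∑ x, traceless A x * traceless B x with hx
  have hseg : e₂ ((1 - s) • A + s • B) =
      (1 - s) ^ 2 * e₂ A + s ^ 2 * e₂ B + s * (1 - s) * (2 * (A.trace * B.trace) / 3 - x) := by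
    rw [hx, Fintype.sum_prod_type]
    simp only [Fin.sum_univ_three, traceless, e₂, Matrix.trace_fin_three, hA.apply 0 1,
      hA.apply 0 2, hA.apply 1 2, hB.apply 0 1,
      hB.apply 0 2, hB.apply 1 2, Fin.isValue, ↓reduceIte, Fin.reduceEq, sub_zero,
      Matrix.add_apply, Matrix.smul_apply, smul_eq_mul]
    ring
  have hle : x ≤ 2 * (A.trace * B.trace) / 3 := by
    rw [ea, eb] at hcs
    by_contra! hn
    have h1 : (2 * (A.trace * B.trace) / 3) ^ 2 < x ^ 2 := by
      apply pow_lt_pow_left₀ hn (by positivity) two_ne_zero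
    nlinarith
  rw [hseg, hA1, hB1]
  have h1 : 0 ≤ s * (1 - s) * (2 * (A.trace * B.trace) / 3 - x) :=
    mul_nonneg (mul_nonneg hs (by linarith)) (by linarith)
  nlinarith [sq_nonneg (1 - 2 * s)]

end SymmetricMatrices

/-! ### Planes transverse to a given one as graphs of symmetric matrices -/

section Graph

variable {Z : Type*} [TopologicalSpace Z] [ChartedSpace (EuclideanSpace ℝ (Fin 1)) Z]
  {E : Z → Type*} [∀ z, AddCommGroup (E z)] [∀ z, Module ℂ (E z)]
  [∀ z, TopologicalSpace (E z)] [TopologicalSpace (TotalSpace (EuclideanSpace ℂ (Fin 3)) E)]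
  [FiberBundle (EuclideanSpace ℂ (Fin 3)) E] [VectorBundle ℝ (EuclideanSpace ℂ (Fin 3)) E]

namespace SUStructure

/-- A unitary basis of the fibre on which the volume form is real. -/
structure IsUnitaryBasis (S : SUStructure 3 E) (z : Z) (e : Fin 3 → E z) : Prop where
  h_eq : ∀ i j, S.h z (e i) (e j) = if i = j then 1 else 0
  vol_im : (S.vol z e).im = 0

/-- The basis of the graph of `A / r` with respect to the basis `e`. -/
def graphVec {z : Z} (e : Fin 3 → E z) (A : Matrix (Fin 3) (Fin 3) ℝ) (r : ℝ) (k : Fin 3) : E z :=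
  ∑ j, addI A r j k • e j

variable {S : SUStructure 3 E} {z : Z} {e : Fin 3 → E z}

theorem h_sum_right_of_orthonormal (he : ∀ i j, S.h z (e i) (e j) = if i = j then 1 else 0)
    (c : Fin 3 → ℂ) (i : Fin 3) : S.h z (e i) (∑ j, c j • e j) = c i := by
  simp [map_sum, he, S.h_csmul_right]

theorem h_sum_sum_of_orthonormal (he : ∀ i j, S.h z (e i) (e j) = if i = j then 1 else 0)
    (c d : Fin 3 → ℂ) : S.h z (∑ j, c j • e j) (∑ j, d j • e j) = hp c d := by
  rw [S.h_sum_left]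
  simp only [S.h_csmul_left, h_sum_right_of_orthonormal he]
  rw [Fin.sum_univ_three]
  rfl

theorem linearIndependent_of_orthonormal
    (he : ∀ i j, S.h z (e i) (e j) = if i = j then 1 else 0) : LinearIndependent ℂ e := by
  rw [Fintype.linearIndependent_iff]
  intro g hg i
  rw [← h_sum_right_of_orthonormal he g i, hg, map_zero]

theorem sum_h_smul (he : ∀ i j, S.h z (e i) (e j) = if i = j then 1 else 0) (u : E z) :
    ∑ j, S.h z (e j) u • e j = u := by
  have hli := linearIndependent_of_orthonormal he
  have h1 : u = ∑ j, (fibreBasis hli).repr u j • e j := by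
    conv_lhs => rw [← (fibreBasis hli).sum_repr u, coe_fibreBasis]
  have h2 : ∀ j, S.h z (e j) u = (fibreBasis hli).repr u j := fun j => by
    conv_lhs => rw [h1]
    exact h_sum_right_of_orthonormal he _ j
  simp only [h2]
  exact h1.symm

namespace IsUnitaryBasis

theorem liC (he : S.IsUnitaryBasis z e) : LinearIndependent ℂ e :=
  linearIndependent_of_orthonormal he.h_eq

theorem liR (he : S.IsUnitaryBasis z e) : LinearIndependent ℝ e :=
  he.liC.restrict_scalars (R := ℝ) (by
    intro a b hab
    simpa using hab)

theorem isSLPlane (he : S.IsUnitaryBasis z e) :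
    S.IsSLPlane z (Submodule.span ℝ (range e)) :=
  isSLPlane_span he.liR (fun i j => by rw [he.h_eq]; split_ifs <;> simp) he.vol_im

theorem vol_re_ne_zero (he : S.IsUnitaryBasis z e) : (S.vol z e).re ≠ 0 := fun h =>
  S.vol_ne_zero_of_linearIndependent he.liC (Complex.ext h he.vol_im)

theorem h_graphVec (he : S.IsUnitaryBasis z e) (A : Matrix (Fin 3) (Fin 3) ℝ) (r : ℝ)
    (j k : Fin 3) : S.h z (e j) (graphVec e A r k) = addI A r j k :=
  h_sum_right_of_orthonormal he.h_eq (fun j => addI A r j k) j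

theorem vol_graphVec (he : S.IsUnitaryBasis z e) (A : Matrix (Fin 3) (Fin 3) ℝ) (r : ℝ) :
    S.vol z (graphVec e A r) = S.vol z e * (addI A r).det :=
  S.vol_sum he.liC (addI A r)

theorem h_graphVec_graphVec_im (he : S.IsUnitaryBasis z e) (A : Matrix (Fin 3) (Fin 3) ℝ) (r : ℝ)
    (k l : Fin 3) :
    (S.h z (graphVec e A r k) (graphVec e A r l)).im = r * (A l k - A k l) := by
  rw [graphVec, graphVec, h_sum_sum_of_orthonormal he.h_eq]
  fin_cases k <;> fin_cases l <;> simp [hp, addI] <;> ring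

theorem eq_zero_of_sum_eq (he : S.IsUnitaryBasis z e) {A : Matrix (Fin 3) (Fin 3) ℝ} {r : ℝ}
    (hr : r ≠ 0) {a c : Fin 3 → ℝ} (h : ∑ j, a j • e j = ∑ k, c k • graphVec e A r k) : c = 0 := by
  ext k
  have h1 := congrArg (fun v => (S.h z (e k) v).im) h
  simp only [map_sum, S.h_smul_right, he.h_graphVec, he.h_eq, Complex.im_sum,
    Complex.im_ofReal_mul, addI] at h1
  have h2 : ∀ j, a j * (if k = j then (1 : ℂ) else 0).im = 0 := fun j => by split_ifs <;> simp
  have h3 : ∀ j, c j * ((A k j : ℂ) + if k = j then (r : ℂ) * Complex.I else 0).im =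
      if k = j then c j * r else 0 := fun j => by split_ifs <;> simp
  simp only [h2, h3, Finset.sum_const_zero, Finset.sum_ite_eq, Finset.mem_univ, if_true] at h1
  exact (mul_eq_zero.1 h1.symm).resolve_right hr

theorem linearIndependent_graphVec (he : S.IsUnitaryBasis z e) {A : Matrix (Fin 3) (Fin 3) ℝ}
    {r : ℝ} (hr : r ≠ 0) : LinearIndependent ℝ (graphVec e A r) := by
  rw [Fintype.linearIndependent_iff]
  intro c hc
  have := he.eq_zero_of_sum_eq hr (a := 0) (A := A) (c := c) (by rw [hc]; simp)
  exact fun i => congrFun this i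

/-- Symmetry of A makes the graph isotropic, e₂(A) = r² kills Im Ω, and r ≠ 0 separates the graph
from the real span of e. -/
theorem isTransversePlanes_graph (he : S.IsUnitaryBasis z e) {A : Matrix (Fin 3) (Fin 3) ℝ}
    {r : ℝ} (hr : r ≠ 0) (hA : A.IsSymm) (hAr : e₂ A = r ^ 2) :
    S.IsTransversePlanes z (Submodule.span ℝ (range e))
      (Submodule.span ℝ (range (graphVec e A r))) := by
  refine ⟨he.isSLPlane, isSLPlane_span (he.linearIndependent_graphVec hr) (fun i j => ?_) ?_, ?_⟩
  · rw [he.h_graphVec_graphVec_im, hA.apply i j]; ring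
  · rw [he.vol_graphVec, det_addI, hAr, sub_self, mul_zero]
    rw [Complex.ofReal_zero, zero_mul, add_zero, Complex.mul_im, he.vol_im, Complex.ofReal_im]
    simp
  · rw [Submodule.eq_bot_iff]
    rintro x ⟨hx, hx'⟩
    obtain ⟨a, ha⟩ := (Submodule.mem_span_range_iff_exists_fun ℝ).1 hx
    obtain ⟨c, hc⟩ := (Submodule.mem_span_range_iff_exists_fun ℝ).1 hx'
    have := he.eq_zero_of_sum_eq hr (ha.trans hc.symm)
    rw [← hc, this]; simp

/-- For this basis of the graph the ω-matrix is the identity, so `pairing` is (Re Ω(e))² times the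
real part of det(A + i). -/
theorem posPair_iff (he : S.IsUnitaryBasis z e) {L L' : Submodule ℝ (E z)}
    (hT : S.IsTransversePlanes z L L') {A : Matrix (Fin 3) (Fin 3) ℝ}
    (heL : S.IsPlaneBasis L e) (hf : S.IsPlaneBasis L' (graphVec e A 1)) :
    S.PosPair z L L' ↔ 0 < A.det - A.trace := by
  rw [hT.posPair_iff heL hf]
  have h1 : (Matrix.of fun j k => (S.h z (e j) (graphVec e A 1 k)).im) = 1 := by
    ext j k
    rw [Matrix.of_apply, he.h_graphVec, addI, Matrix.one_apply]
    split_ifs <;> simp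
  have h2 : S.pairing z e (graphVec e A 1) = (S.vol z e).re ^ 2 * (A.det - A.trace) := by
    rw [pairing, h1, Matrix.det_one, he.vol_graphVec, det_addI]
    simp [he.vol_im]
    ring
  rw [h2]
  exact mul_pos_iff_of_pos_left (by have := he.vol_re_ne_zero; positivity)

/-- Uniqueness of the matrix describing a plane transverse to the span of `e` as a graph. -/
theorem graph_unique (he : S.IsUnitaryBasis z e) {L L' : Submodule ℝ (E z)}
    (hLL' : L ⊓ L' = ⊥) (heL : ∀ j, e j ∈ L) {A B : Matrix (Fin 3) (Fin 3) ℝ}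
    (hA : ∀ k, graphVec e A 1 k ∈ L') (hB : ∀ k, graphVec e B 1 k ∈ L') : A = B := by
  have h : ∀ k, graphVec e A 1 k - graphVec e B 1 k = 0 := fun k => by
    have h1 : graphVec e A 1 k - graphVec e B 1 k = ∑ j, (A j k - B j k) • e j := by
      rw [graphVec, graphVec, ← Finset.sum_sub_distrib]
      refine Finset.sum_congr rfl fun j _ => ?_
      rw [← sub_smul, ← Complex.coe_smul]
      congr 1
      simp [addI]
    have : graphVec e A 1 k - graphVec e B 1 k ∈ L ⊓ L' :=
      ⟨by rw [h1]; exact sum_smul_mem heL _, L'.sub_mem (hA k) (hB k)⟩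
    rwa [hLL', Submodule.mem_bot] at this
  ext j k
  have h2 := congrArg (fun v => (S.h z (e j) v).re) (h k)
  simp only [map_sub, he.h_graphVec, map_zero, Complex.sub_re, Complex.zero_re] at h2
  have h3 : ∀ C : Matrix (Fin 3) (Fin 3) ℝ, (addI C 1 j k).re = C j k := fun C => by
    rw [addI]; split_ifs <;> simp
  rw [h3, h3] at h2
  linarith

/-- The matrix describing a plane with basis `f` as a graph. -/
theorem graphVec_mem (he : S.IsUnitaryBasis z e) {L L' : Submodule ℝ (E z)}
    (hT : S.IsTransversePlanes z L L') (heL : S.IsPlaneBasis L e) {f : Fin 3 → E z}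
    (hf : S.IsPlaneBasis L' f) (k : Fin 3) :
    graphVec e ((Matrix.of fun i j => (S.h z (e i) (f j)).re) *
      (Matrix.of fun i j => (S.h z (e i) (f j)).im)⁻¹) 1 k ∈ L' := by
  set P := (Matrix.of fun i j => (S.h z (e i) (f j)).re) with hP
  set Q := (Matrix.of fun i j => (S.h z (e i) (f j)).im) with hQ
  have hdet : IsUnit Q.det := (hT.det_ne_zero heL hf).isUnit
  have hmem : ∑ l, Q⁻¹ l k • f l ∈ L' := sum_smul_mem hf.mem _
  -- In the basis e the matrix of f is P + iQ; multiplying on the right by the real matrix Q⁻¹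
  -- changes the basis of L' and gives PQ⁻¹ + i.
  have : graphVec e (P * Q⁻¹) 1 k = ∑ l, Q⁻¹ l k • f l := by
    rw [← sum_h_smul he.h_eq (∑ l, Q⁻¹ l k • f l), graphVec]
    refine Finset.sum_congr rfl fun j _ => ?_
    congr 1
    have h1 : (Q * Q⁻¹) j k = (1 : Matrix (Fin 3) (Fin 3) ℝ) j k := by
      rw [Matrix.mul_nonsing_inv Q hdet]
    rw [Matrix.mul_apply, Matrix.one_apply] at h1
    rw [map_sum, addI, Matrix.mul_apply]
    apply Complex.ext
    · rw [Complex.re_sum]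
      simp only [S.h_smul_right, Complex.re_ofReal_mul]
      have h0 : (if j = k then ((1 : ℝ) : ℂ) * Complex.I else 0).re = 0 := by
        split_ifs <;> simp
      rw [Complex.add_re, Complex.ofReal_re, h0, add_zero]
      exact Finset.sum_congr rfl fun l _ => mul_comm _ _
    · rw [Complex.im_sum]
      simp only [S.h_smul_right, Complex.im_ofReal_mul]
      have h0 : (if j = k then ((1 : ℝ) : ℂ) * Complex.I else 0).im = if j = k then 1 else 0 := by
        split_ifs <;> simp
      rw [Complex.add_im, Complex.ofReal_im, h0, zero_add, ← h1]
      exact Finset.sum_congr rfl fun l _ => mul_comm _ _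
  rw [this]; exact hmem

/-- The properties of the matrix describing a special Lagrangian plane as a graph. -/
theorem graph_props (he : S.IsUnitaryBasis z e) {L' : Submodule ℝ (E z)}
    (hL' : S.IsSLPlane z L') {A : Matrix (Fin 3) (Fin 3) ℝ} (hA : ∀ k, graphVec e A 1 k ∈ L') :
    A.IsSymm ∧ e₂ A = 1 ∧ S.IsPlaneBasis L' (graphVec e A 1) := by
  refine ⟨?_, ?_, hL'.isPlaneBasis_of_li (he.linearIndependent_graphVec one_ne_zero) hA⟩
  · ext i j
    have := hL'.2.1 _ (hA i) _ (hA j)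
    rw [omega, he.h_graphVec_graphVec_im] at this
    rw [Matrix.transpose_apply]
    linarith
  · have := hL'.2.2 _ hA
    rw [he.vol_graphVec, det_addI] at this
    have h0 := he.vol_re_ne_zero
    simp [he.vol_im, h0] at this
    linarith

end IsUnitaryBasis

end SUStructure

end Graph

/-! ### Construction of the homotopy -/

section Assembly

theorem contDiffAt_det {D : Type*} [NormedAddCommGroup D] [NormedSpace ℝ D]
    {M : D → Matrix (Fin 3) (Fin 3) ℝ} {x : D}
    (hM : ∀ i j, ContDiffAt ℝ ∞ (fun y => M y i j) x) : ContDiffAt ℝ ∞ (fun y => (M y).det) x := by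
  simp only [Matrix.det_apply']
  refine ContDiffAt.sum fun σ _ => contDiffAt_const.mul ?_
  exact contDiffAt_prod fun i _ => hM _ _

theorem contDiffAt_mul_inv {D : Type*} [NormedAddCommGroup D] [NormedSpace ℝ D]
    {P Q : D → Matrix (Fin 3) (Fin 3) ℝ} {x : D}
    (hP : ∀ i j, ContDiffAt ℝ ∞ (fun y => P y i j) x)
    (hQ : ∀ i j, ContDiffAt ℝ ∞ (fun y => Q y i j) x) (h0 : (Q x).det ≠ 0) (i j : Fin 3) :
    ContDiffAt ℝ ∞ (fun y => (P y * (Q y)⁻¹) i j) x := by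
  simp only [Matrix.mul_apply, Matrix.inv_def, Matrix.smul_apply, Ring.inverse_eq_inv',
    smul_eq_mul, Matrix.adjugate_apply]
  refine ContDiffAt.sum fun k _ => (hP i k).mul (((contDiffAt_det hQ).inv h0).mul ?_)
  refine contDiffAt_det fun a b => ?_
  simp only [Matrix.updateRow_apply]
  split_ifs
  exacts [contDiffAt_const, hQ a b]

variable {Z : Type*} [TopologicalSpace Z] [ChartedSpace (EuclideanSpace ℝ (Fin 1)) Z]
  {E : Z → Type*} [∀ z, AddCommGroup (E z)] [∀ z, Module ℂ (E z)]
  [∀ z, TopologicalSpace (E z)] [TopologicalSpace (TotalSpace (EuclideanSpace ℂ (Fin 3)) E)]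
  [FiberBundle (EuclideanSpace ℂ (Fin 3)) E] [VectorBundle ℝ (EuclideanSpace ℂ (Fin 3)) E]

namespace SUStructure

variable {S : SUStructure 3 E}

/-- A special Lagrangian plane that contains the first two vectors of a unitary basis with real
volume contains the third one. -/
theorem IsUnitaryBasis.isPlaneBasis {z : Z} {e : Fin 3 → E z} (he : S.IsUnitaryBasis z e)
    {L : Submodule ℝ (E z)} (hL : S.IsSLPlane z L) (hm : ∀ j : Fin 2, e j.castSucc ∈ L) :
    S.IsPlaneBasis L e := by
  have h0 : e 0 ∈ L := hm 0
  have h1 : e 1 ∈ L := hm 1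
  refine hL.isPlaneBasis_of_li he.liR ?_
  have h2 : e 2 ∈ L := by
    refine hL.mem_of_omega fun u hu => ?_
    -- Columns of (e₀, e₁, u) in the basis e: they give Ω(e₀, e₁, u) = Ω(e) · h(e₂, u). The left
    -- side and Ω(e) are real, so ω(u, e₂) = 0 and maximality applies.
    let m : Fin 3 → Fin 3 → ℂ := fun j k =>
      ![if j = 0 then 1 else 0, if j = 1 then 1 else 0, S.h z (e j) u] k
    have hv := S.vol_sum he.liC m
    have hd : (Matrix.of m).det = S.h z (e 2) u := by
      rw [Matrix.det_fin_three]; simp [m]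
    have hvec : ∀ k, ∑ j, m j k • e j ∈ L := by
      intro k
      fin_cases k
      · simpa [m] using h0
      · simpa [m] using h1
      · change ∑ j, S.h z (e j) u • e j ∈ L
        rwa [sum_h_smul he.h_eq]
    have h3 := hL.2.2 _ hvec
    rw [hv, hd, Complex.mul_im, he.vol_im, zero_mul, add_zero] at h3
    rw [omega, S.h_im_symm, (mul_eq_zero.1 h3).resolve_left he.vol_re_ne_zero, neg_zero]
  intro k
  fin_cases k
  exacts [h0, h1, h2]

variable [IsManifold (𝓡 1) ∞ Z] [ContMDiffVectorBundle ∞ (EuclideanSpace ℂ (Fin 3)) E (𝓡 1)]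

/-- The matrix describing a subbundle as a graph over a frame is smooth. -/
theorem contMDiff_graph {V V' : ∀ z, Submodule ℝ (E z)} (hV : S.IsTransversePair V V')
    {e : Fin 3 → ∀ z, E z} (hes : ∀ j, IsSmoothSection (e j) univ)
    (he : ∀ z, S.IsUnitaryBasis z fun j => e j z) (heV : ∀ z, S.IsPlaneBasis (V z) fun j => e j z)
    {A : Z → Matrix (Fin 3) (Fin 3) ℝ} (hA : ∀ z k, graphVec (fun j => e j z) (A z) 1 k ∈ V' z)
    (i j : Fin 3) : ContMDiff (𝓡 1) 𝓘(ℝ, ℝ) ∞ fun z => A z i j := by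
  intro z₀
  obtain ⟨U, hU, hz, s, hs, hb⟩ := exists_frame hV.2.1 (fun z => (hV.2.2 z).2.1) z₀
  have hm := hU.mem_nhds hz
  let H : Z → Fin 3 → Fin 3 → ℂ := fun z i j => S.h z (e i z) (s j z)
  have hH : ContMDiffAt (𝓡 1) 𝓘(ℝ, Fin 3 → Fin 3 → ℂ) ∞ H z₀ := by
    rw [contMDiffAt_pi_space]; intro i
    rw [contMDiffAt_pi_space]; intro j
    exact (S.smooth_h U (e i) (s j) hU ((hes i).mono (subset_univ _)) (hs j)).contMDiffAt hm
  let φ : (Fin 3 → Fin 3 → ℂ) → ℝ := fun H =>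
    ((Matrix.of fun i j => (H i j).re) * (Matrix.of fun i j => (H i j).im)⁻¹) i j
  have hφ : ContDiffAt ℝ ∞ φ (H z₀) := by
    have h : ∀ a b : Fin 3, ContDiffAt ℝ ∞ (fun H : Fin 3 → Fin 3 → ℂ => H a b) (H z₀) :=
      fun a b => contDiffAt_pi.1 (contDiffAt_pi.1 contDiffAt_id a) b
    exact contDiffAt_mul_inv (fun a b => contDiffAt_re (h a b)) (fun a b => contDiffAt_im (h a b))
      ((hV.2.2 z₀).det_ne_zero (heV z₀) (hb z₀ hz)) i j
  refine (hφ.contMDiffAt.comp z₀ hH).congr_of_eventuallyEq ?_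
  filter_upwards [hm] with z hzU
  -- The matrices A were chosen pointwise; uniqueness identifies them with the locally smooth
  -- expression PQ⁻¹.
  have := (he z).graph_unique (hV.2.2 z).2.2 (heV z).mem (hA z)
    ((he z).graphVec_mem (hV.2.2 z) (heV z) (hb z hzU))
  rw [this]; rfl

/-- Two transverse pairs of special Lagrangian subbundles that lie fibrewise in the same component
are joined by smooth families of bases of transverse pairs. -/
theorem exists_frames [T2Space Z] [CompactSpace Z] {V V' W W' : ∀ z, Submodule ℝ (E z)}
    (hV : S.IsTransversePair V V') (hW : S.IsTransversePair W W')
    (hs : ∀ z, S.PosPair z (V z) (V' z) ↔ S.PosPair z (W z) (W' z)) :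
    ∃ e f : Fin 3 → ∀ x : Z × unitInterval, E x.1,
      (∀ j, SmoothSectionOn ((𝓡 1).prod (𝓡∂ 1)) (𝓡 1) (EuclideanSpace ℂ (Fin 3)) Prod.fst
        (e j) univ) ∧
      (∀ j, SmoothSectionOn ((𝓡 1).prod (𝓡∂ 1)) (𝓡 1) (EuclideanSpace ℂ (Fin 3)) Prod.fst
        (f j) univ) ∧
      (∀ x, S.IsTransversePlanes x.1 (Submodule.span ℝ (range fun j => e j x))
        (Submodule.span ℝ (range fun j => f j x))) ∧
      (∀ z, Submodule.span ℝ (range fun j => e j (z, 0)) = V z) ∧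
      (∀ z, Submodule.span ℝ (range fun j => f j (z, 0)) = V' z) ∧
      (∀ z, Submodule.span ℝ (range fun j => e j (z, 1)) = W z) ∧
      (∀ z, Submodule.span ℝ (range fun j => f j (z, 1)) = W' z) := by
  obtain ⟨ε, hε⟩ := S.exists_unitaryFrame hV.1 fun z => (hV.2.2 z).1
  obtain ⟨κ, hκ⟩ := S.exists_unitaryFrame hW.1 fun z => (hW.2.2 z).1
  have hεu : ∀ z, S.IsUnitaryBasis z fun j => ε j z := fun z =>
    ⟨hε.h_eq z, (hV.2.2 z).1.2.2 _ (hε.mem z)⟩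
  let k : Fin 3 → Z → Fin 3 → ℂ := fun j z i => S.h z (ε i z) (κ j z)
  have hks : ∀ j, ContMDiff (𝓡 1) 𝓘(ℝ, Fin 3 → ℂ) ∞ (k j) := fun j => by
    rw [contMDiff_pi_space]
    intro i
    exact contMDiffOn_univ.1
      (S.smooth_h univ (ε i) (κ j) isOpen_univ (hε.smooth i) (hκ.smooth j))
  have hkκ : ∀ z j, ∑ i, k j z i • ε i z = κ j z := fun z j => sum_h_smul (hε.h_eq z) (κ j z)
  have hkp : ∀ z i j, hp (k i z) (k j z) = if i = j then 1 else 0 := fun z i j => by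
    rw [← h_sum_sum_of_orthonormal (hε.h_eq z), hkκ, hkκ, hκ.h_eq]
  -- In the coordinates of the frame ε of V, the starting pair is constant (two standard basis
  -- vectors) and the frame of W becomes a map into ℂ³-valued triples.
  obtain ⟨m, hms, hmu, hmc, hm0, hm1⟩ := exists_frame_path (Z := Z)
    (g₁ := fun _ => Pi.single 0 1) (g₂ := fun _ => Pi.single 1 1) (k₁ := k 0) (k₂ := k 1)
    contMDiff_const contMDiff_const (hks 0) (hks 1)
    (fun z => ⟨by simp [hp], by simp [hp], by simp [hp]⟩)
    (fun z => ⟨hkp z 0 0, hkp z 1 1, hkp z 0 1⟩)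
  -- the moving frame
  let b : Fin 3 → ∀ z, ℝ → E z := fun j z t => ∑ i, m j (z, t) i • ε i z
  have hb : ∀ z t, S.IsUnitaryBasis z fun j => b j z t := by
    intro z t
    refine ⟨fun i j => ?_, ?_⟩
    · rw [← hmu (z, t) i j]
      exact h_sum_sum_of_orthonormal (hε.h_eq z) _ _
    · have h1 := S.vol_sum (hεu z).liC fun i j => m j (z, t) i
      have h2 : (Matrix.of fun i j => m j (z, t) i).det = 1 := by
        have h3 := hp_cc_eq_det (m 0 (z, t)) (m 1 (z, t)) (m 2 (z, t))
        rw [← hmc, hmu, if_pos rfl] at h3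
        rw [h3]
        congr 1
        ext i j
        fin_cases j <;> rfl
      change (S.vol z fun j => ∑ i, m j (z, t) i • ε i z).im = 0
      rw [h1, h2, mul_one]
      exact (hεu z).vol_im
  -- The path controls only the first two vectors at its ends; the third lies in the plane
  -- automatically because Ω is real on the frame.
  have hb0 : ∀ z, S.IsPlaneBasis (V z) fun j => b j z 0 := fun z =>
    (hb z 0).isPlaneBasis (hV.2.2 z).1 fun j => by
      obtain ⟨r, s, hrs⟩ := hm0 z j
      have : b j.castSucc z 0 = r • ε 0 z + s • ε 1 z := by
        simp only [b, hrs, Fin.sum_univ_three]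
        simp
      rw [this]
      exact (V z).add_mem ((V z).smul_mem _ (hε.mem z 0)) ((V z).smul_mem _ (hε.mem z 1))
  have hb1 : ∀ z, S.IsPlaneBasis (W z) fun j => b j z 1 := fun z =>
    (hb z 1).isPlaneBasis (hW.2.2 z).1 fun j => by
      obtain ⟨r, s, hrs⟩ := hm1 z j
      have : b j.castSucc z 1 = r • κ 0 z + s • κ 1 z := by
        rw [← hkκ z 0, ← hkκ z 1, Finset.smul_sum, Finset.smul_sum, ← Finset.sum_add_distrib]
        simp only [b, hrs]
        refine Finset.sum_congr rfl fun i _ => ?_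
        rw [Pi.add_apply, Pi.smul_apply, Pi.smul_apply, add_smul, smul_assoc, smul_assoc]
      rw [this]
      exact (W z).add_mem ((W z).smul_mem _ (hκ.mem z 0)) ((W z).smul_mem _ (hκ.mem z 1))
  have hbs : ∀ t j, IsSmoothSection (fun z => b j z t) univ := fun t j => by
    refine S.smoothSectionOn_sum_csmul contMDiffOn_id isOpen_univ (mapsTo_univ _ _) hε.smooth
      fun i => ?_
    have h1 : ContMDiff (𝓡 1) ((𝓡 1).prod 𝓘(ℝ, ℝ)) ∞ fun z : Z => (z, t) :=
      contMDiff_id.prodMk contMDiff_const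
    exact (contMDiff_pi_space.1 ((hms j).comp h1) i).contMDiffOn
  -- the planes of the second family as graphs over the first one
  have hA : ∀ z, ∃ A, ∀ l, graphVec (fun j => b j z 0) A 1 l ∈ V' z := fun z => by
    obtain ⟨f, hf⟩ := (hV.2.2 z).2.1.exists_basis
    exact ⟨_, (hb z 0).graphVec_mem (hV.2.2 z) (hb0 z) hf⟩
  have hB : ∀ z, ∃ B, ∀ l, graphVec (fun j => b j z 1) B 1 l ∈ W' z := fun z => by
    obtain ⟨f, hf⟩ := (hW.2.2 z).2.1.exists_basis
    exact ⟨_, (hb z 1).graphVec_mem (hW.2.2 z) (hb1 z) hf⟩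
  choose A hA using hA
  choose B hB using hB
  have hAs := contMDiff_graph hV (hbs 0) (fun z => hb z 0) hb0 hA
  have hBs := contMDiff_graph hW (hbs 1) (fun z => hb z 1) hb1 hB
  have hAp := fun z => (hb z 0).graph_props (hV.2.2 z).2.1 (hA z)
  have hBp := fun z => (hb z 1).graph_props (hW.2.2 z).2.1 (hB z)
  have hsign : ∀ z, 0 < (A z).det - (A z).trace ↔ 0 < (B z).det - (B z).trace := fun z => by
    rw [← (hb z 0).posPair_iff (hV.2.2 z) (hb0 z) (hAp z).2.2,
      ← (hb z 1).posPair_iff (hW.2.2 z) (hb1 z) (hBp z).2.2]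
    exact hs z
  -- C leaves the hyperboloid e₂ = 1 but stays in e₂ > 0, so the graph is taken of C/r with r the
  -- square root of e₂(C); at both ends r = 1.
  let C : Z × unitInterval → Matrix (Fin 3) (Fin 3) ℝ := fun x =>
    (1 - (x.2 : ℝ)) • A x.1 + (x.2 : ℝ) • B x.1
  have hCpos : ∀ x, 0 < e₂ (C x) := fun x =>
    e₂_segment_pos (hAp x.1).1 (hBp x.1).1 (hAp x.1).2.1 (hBp x.1).2.1 (hsign x.1) x.2.2.1 x.2.2.2
  have hCsymm : ∀ x, (C x).IsSymm := fun x => ((hAp x.1).1.smul _).add ((hBp x.1).1.smul _)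
  have hval : ContMDiff ((𝓡 1).prod (𝓡∂ 1)) 𝓘(ℝ, ℝ) ∞ fun x : Z × unitInterval => (x.2 : ℝ) :=
    contMDiff_subtypeVal_Icc.comp contMDiff_snd
  have hCs : ∀ i j, ContMDiff ((𝓡 1).prod (𝓡∂ 1)) 𝓘(ℝ, ℝ) ∞ fun x => C x i j := fun i j =>
    ((contMDiff_const.sub hval).smul ((hAs i j).comp contMDiff_fst)).add
      (hval.smul ((hBs i j).comp contMDiff_fst))
  let CC : Z × unitInterval → Fin 3 → Fin 3 → ℝ := fun x i j => C x i j
  have hCC : ContMDiff ((𝓡 1).prod (𝓡∂ 1)) 𝓘(ℝ, Fin 3 → Fin 3 → ℝ) ∞ CC := by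
    rw [contMDiff_pi_space]; intro i
    rw [contMDiff_pi_space]; intro j
    exact hCs i j
  have hM : ∀ j, ContMDiff ((𝓡 1).prod (𝓡∂ 1)) 𝓘(ℝ, Fin 3 → ℂ) ∞
      fun x : Z × unitInterval => m j (x.1, (x.2 : ℝ)) := fun j =>
    (hms j).comp (contMDiff_fst.prodMk hval)
  have hcoef : ∀ k i, ContMDiff ((𝓡 1).prod (𝓡∂ 1)) 𝓘(ℝ, ℂ) ∞ fun x : Z × unitInterval =>
      ∑ j, addI (C x) (Real.sqrt (e₂ (C x))) j k * m j (x.1, (x.2 : ℝ)) i := by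
    intro k i
    let φ : (Fin 3 → Fin 3 → ℝ) × (Fin 3 → Fin 3 → ℂ) → ℂ := fun y =>
      ∑ j, addI (Matrix.of y.1) (Real.sqrt (e₂ (Matrix.of y.1))) j k * y.2 j i
    have hφ : ∀ y, 0 < e₂ (Matrix.of y.1) → ContDiffAt ℝ ∞ φ y := by
      intro y hy
      have h1 : ∀ a b : Fin 3,
          ContDiffAt ℝ ∞ (fun y : (Fin 3 → Fin 3 → ℝ) × (Fin 3 → Fin 3 → ℂ) => y.1 a b) y :=
        fun a b => contDiffAt_pi.1 (contDiffAt_pi.1 contDiffAt_fst a) b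
      have h2 : ∀ a b : Fin 3,
          ContDiffAt ℝ ∞ (fun y : (Fin 3 → Fin 3 → ℝ) × (Fin 3 → Fin 3 → ℂ) => y.2 a b) y :=
        fun a b => contDiffAt_pi.1 (contDiffAt_pi.1 contDiffAt_snd a) b
      have h3 : ContDiffAt ℝ ∞
          (fun y : (Fin 3 → Fin 3 → ℝ) × (Fin 3 → Fin 3 → ℂ) => e₂ (Matrix.of y.1)) y :=
        (((((h1 0 0).mul (h1 1 1)).add ((h1 0 0).mul (h1 2 2))).add ((h1 1 1).mul (h1 2 2))).sub
          ((h1 0 1).mul (h1 1 0))).sub ((h1 0 2).mul (h1 2 0)) |>.sub ((h1 1 2).mul (h1 2 1))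
      refine ContDiffAt.sum fun j _ => ContDiffAt.mul ?_ (h2 j i)
      have hof : ∀ {g : (Fin 3 → Fin 3 → ℝ) × (Fin 3 → Fin 3 → ℂ) → ℝ}, ContDiffAt ℝ ∞ g y →
          ContDiffAt ℝ ∞ (fun y => (g y : ℂ)) y := fun hg =>
        Complex.ofRealCLM.contDiff.contDiffAt.comp y hg
      refine (hof (h1 j k)).add ?_
      split_ifs
      · exact (hof (h3.sqrt hy.ne')).mul contDiffAt_const
      · exact contDiffAt_const
    have hmm : ContMDiff ((𝓡 1).prod (𝓡∂ 1)) 𝓘(ℝ, Fin 3 → Fin 3 → ℂ) ∞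
        fun (x : Z × unitInterval) j => m j (x.1, (x.2 : ℝ)) := by
      rw [contMDiff_pi_space]; exact hM
    intro x
    have hφx := (hφ (CC x, fun j => m j (x.1, (x.2 : ℝ))) (hCpos x)).contMDiffAt
    have hcomp : ContMDiffAt ((𝓡 1).prod (𝓡∂ 1)) 𝓘(ℝ, ℂ) ∞
        (φ ∘ fun x : Z × unitInterval => (CC x, fun j => m j (x.1, (x.2 : ℝ)))) x :=
      ContMDiffAt.comp x hφx ((hCC x).prodMk_space (hmm x))
    exact hcomp
  refine ⟨fun j x => b j x.1 (x.2 : ℝ),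
    fun l x => graphVec (fun j => b j x.1 (x.2 : ℝ)) (C x) (Real.sqrt (e₂ (C x))) l,
    fun j => ?_, fun l => ?_, fun x => ?_, fun z => ?_, fun z => ?_, fun z => ?_, fun z => ?_⟩
  · exact S.smoothSectionOn_sum_csmul contMDiff_fst.contMDiffOn isOpen_univ (mapsTo_univ _ _)
      hε.smooth fun i => (contMDiff_pi_space.1 (hM j) i).contMDiffOn
  · have := S.smoothSectionOn_sum_csmul (U := univ) (f := Prod.fst (α := Z) (β := unitInterval))
      contMDiff_fst.contMDiffOn isOpen_univ (mapsTo_univ _ _) hε.smooth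
      fun i => (hcoef l i).contMDiffOn
    convert this using 2
    rename_i x
    simp only [graphVec, b, Finset.smul_sum, Finset.sum_smul, smul_smul]
    rw [Finset.sum_comm]
  · exact (hb x.1 x.2).isTransversePlanes_graph (Real.sqrt_pos.2 (hCpos x)).ne' (hCsymm x)
      (Real.sq_sqrt (hCpos x).le).symm
  · exact (hb0 z).span_eq
  · have : C (z, 0) = A z := by simp [C]
    simp only [this, (hAp z).2.1, Real.sqrt_one]
    exact (hAp z).2.2.span_eq
  · exact (hb1 z).span_eq
  · have : C (z, 1) = B z := by simp [C]
    simp only [this, (hBp z).2.1, Real.sqrt_one]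
    exact (hBp z).2.2.span_eq

theorem isSmoothSubbundle_of_frame {HM EM M : Type*} [NormedAddCommGroup EM] [NormedSpace ℝ EM]
    [TopologicalSpace HM] {IM : ModelWithCorners ℝ EM HM} [TopologicalSpace M] [ChartedSpace HM M]
    {f : M → Z} {e : Fin 3 → ∀ x, E (f x)}
    (he : ∀ j, SmoothSectionOn IM (𝓡 1) (EuclideanSpace ℂ (Fin 3)) f (e j) univ)
    (hli : ∀ x, LinearIndependent ℝ fun j => e j x) :
    IsSmoothSubbundle IM (𝓡 1) (EuclideanSpace ℂ (Fin 3)) f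
      fun x => Submodule.span ℝ (range fun j => e j x) :=
  fun _ => ⟨univ, isOpen_univ, mem_univ _, 3, e, he, fun x _ => ⟨hli x, rfl⟩⟩

/-- One smooth family of bases serves twice: its spans are the homotopy of subbundles, and its
restriction to a fibre is the path of planes. Hence equality of signs implies both relations, each
of which implies equality of signs. -/
theorem equivalent_and_sameComponent [T2Space Z] [CompactSpace Z]
    {V V' W W' : ∀ z, Submodule ℝ (E z)}
    (hV : S.IsTransversePair V V') (hW : S.IsTransversePair W W')
    (hs : ∀ z, S.PosPair z (V z) (V' z) ↔ S.PosPair z (W z) (W' z)) :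
    S.Equivalent V V' W W' ∧ ∀ z, S.SameComponent z (V z) (V' z) (W z) (W' z) := by
  obtain ⟨e, f, hes, hfs, hT, h0, h0', h1, h1'⟩ := exists_frames hV hW hs
  have hel : ∀ x, LinearIndependent ℝ fun j => e j x := fun x =>
    ((hT x).1.isPlaneBasis_of_span rfl).li
  have hfl : ∀ x, LinearIndependent ℝ fun j => f j x := fun x =>
    ((hT x).2.1.isPlaneBasis_of_span rfl).li
  refine ⟨⟨_, _, isSmoothSubbundle_of_frame hes hel, isSmoothSubbundle_of_frame hfs hfl, h0, h1,
    h0', h1', fun t => ⟨?_, ?_, fun z => hT (z, t)⟩⟩, fun z => ?_⟩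
  · have ht : ContMDiff (𝓡 1) ((𝓡 1).prod (𝓡∂ 1)) ∞ fun z : Z => (z, t) :=
      contMDiff_id.prodMk contMDiff_const
    exact isSmoothSubbundle_of_frame (e := fun j z => e j (z, t))
      (fun j => ContMDiffOn.comp (hes j) ht.contMDiffOn (mapsTo_univ _ _)) fun z => hel (z, t)
  · have ht : ContMDiff (𝓡 1) ((𝓡 1).prod (𝓡∂ 1)) ∞ fun z : Z => (z, t) :=
      contMDiff_id.prodMk contMDiff_const
    exact isSmoothSubbundle_of_frame (e := fun j z => f j (z, t))
      (fun j => ContMDiffOn.comp (hfs j) ht.contMDiffOn (mapsTo_univ _ _)) fun z => hfl (z, t)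
  · exact ⟨fun t j => e j (z, t), fun t j => f j (z, t),
      continuous_pi fun j => continuous_iff_continuousAt.2 fun t =>
        continuousAt_fibre isOpen_univ (hes j) (mem_univ _),
      continuous_pi fun j => continuous_iff_continuousAt.2 fun t =>
        continuousAt_fibre isOpen_univ (hfs j) (mem_univ _),
      fun t => hT (z, t), h0 z, h0' z, h1 z, h1' z⟩

theorem isSmoothSubbundle_replaceOn {A : Set Z} (hA : IsClopen A)
    {V V' : ∀ z, Submodule ℝ (E z)}
    (hV : IsSmoothSubbundle (𝓡 1) (𝓡 1) (EuclideanSpace ℂ (Fin 3)) (fun z : Z => z) V)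
    (hV' : IsSmoothSubbundle (𝓡 1) (𝓡 1) (EuclideanSpace ℂ (Fin 3)) (fun z : Z => z) V') :
    IsSmoothSubbundle (𝓡 1) (𝓡 1) (EuclideanSpace ℂ (Fin 3)) (fun z : Z => z)
      (replaceOn A V V') := by
  intro z₀
  by_cases hz : z₀ ∈ A
  · obtain ⟨U, hU, hzU, m, s, hs, hb⟩ := hV' z₀
    refine ⟨U ∩ A, hU.inter hA.isOpen, ⟨hzU, hz⟩, m, s,
      fun i => ContMDiffOn.mono (hs i) inter_subset_left, fun z hzz => ?_⟩
    rw [replaceOn, if_pos hzz.2]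
    exact hb z hzz.1
  · obtain ⟨U, hU, hzU, m, s, hs, hb⟩ := hV z₀
    refine ⟨U ∩ Aᶜ, hU.inter hA.compl.isOpen, ⟨hzU, hz⟩, m, s,
      fun i => ContMDiffOn.mono (hs i) inter_subset_left, fun z hzz => ?_⟩
    rw [replaceOn, if_neg hzz.2]
    exact hb z hzz.1

theorem IsTransversePair.replaceOn {A : Set Z} (hA : IsClopen A) {V V' : ∀ z, Submodule ℝ (E z)}
    (hV : S.IsTransversePair V V') :
    S.IsTransversePair (replaceOn A V V') (replaceOn A V' V) := by
  refine ⟨isSmoothSubbundle_replaceOn hA hV.1 hV.2.1, isSmoothSubbundle_replaceOn hA hV.2.1 hV.1,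
    fun z => ?_⟩
  rw [SLBundle.replaceOn, SLBundle.replaceOn]
  split_ifs
  exacts [(hV.2.2 z).symm, hV.2.2 z]

end SUStructure

end Assembly

end SLBundle

end

theorem theorem3p11
    {Z : Type*} [TopologicalSpace Z] [T2Space Z] [CompactSpace Z]
    [ChartedSpace (EuclideanSpace ℝ (Fin 1)) Z] [IsManifold (𝓡 1) ∞ Z]
    {E : Z → Type*} [∀ z, AddCommGroup (E z)] [∀ z, Module ℂ (E z)]
    [∀ z, TopologicalSpace (E z)] [TopologicalSpace (TotalSpace (EuclideanSpace ℂ (Fin 3)) E)]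
    [FiberBundle (EuclideanSpace ℂ (Fin 3)) E] [VectorBundle ℝ (EuclideanSpace ℂ (Fin 3)) E]
    [ContMDiffVectorBundle ∞ (EuclideanSpace ℂ (Fin 3)) E (𝓡 1)]
    (S : SLBundle.SUStructure 3 E)
    (V V' W W' : ∀ z, Submodule ℝ (E z))
    (hV : S.IsTransversePair V V') (hW : S.IsTransversePair W W') :
    (S.Equivalent V V' W W' ↔ ∀ z, S.SameComponent z (V z) (V' z) (W z) (W' z)) ∧
    ∃ A : Set Z, IsClopen A ∧
      S.Equivalent (SLBundle.replaceOn A V V') (SLBundle.replaceOn A V' V) W W' := by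
  refine ⟨⟨fun h => (SLBundle.SUStructure.equivalent_and_sameComponent hV hW h.posPair_iff).2,
    fun h => (SLBundle.SUStructure.equivalent_and_sameComponent hV hW fun z => (h z).posPair_iff).1⟩, ?_⟩
  -- The pairs are to be interchanged exactly where the signs disagree; both signs are locally
  -- constant, so this set is clopen.
  let P : Z → Prop := fun z => ¬(S.PosPair z (V z) (V' z) ↔ S.PosPair z (W z) (W' z))
  have hP : IsClopen {z | P z} := SLBundle.SUStructure.isClopen_of_eventually_iff fun z₀ => by
    filter_upwards [hV.eventually_posPair_iff z₀, hW.eventually_posPair_iff z₀] with z h₁ h₂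
    simp only [P, h₁, h₂]
  refine ⟨{z | P z}, hP, (SLBundle.SUStructure.equivalent_and_sameComponent (hV.replaceOn hP) hW fun z => ?_).1⟩
  rw [SLBundle.replaceOn, SLBundle.replaceOn]
  by_cases hz : z ∈ {z | P z}
  · rw [if_pos hz, if_pos hz, (hV.2.2 z).posPair_swap]
    have : ¬(S.PosPair z (V z) (V' z) ↔ S.PosPair z (W z) (W' z)) := hz
    tauto
  · rw [if_neg hz, if_neg hz]
    exact not_not.1 hz
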